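/- Let $n\ge 2$, $\Omega=\mathbb{R}^n\times(0,\infty)$ with points $(x,z)$ and Lebesgue measure $d\mu=dx\,dz$, and let $\nabla,\Delta$ denote the gradient and the Laplacian in $x\in\mathbb{R}^n$. Let $H=L^2(\Omega,z\,d\mu)$ (complex-valued functions), let $$b(\varphi,\eta)=\int_\Omega\Big(z\,\partial_z\varphi\,\partial_z\bar\eta+z^{-1/n}\,\nabla\varphi\cdot\nabla\bar\eta\Big)d\mu ,$$ with weak derivatives, and let $\mathcal{E}=\{\varphi\in H^1_{loc}(\Omega)\cap H:\ b(\varphi,\varphi)<\infty\}$ with norm $\|\varphi\|_{\mathcal E}^2=b(\varphi,\varphi)+\|\varphi\|_H^2$. Let $$D=\{\varphi\in\mathcal{E}:\ \exists\, C>0\ \ \forall\,\eta\in\mathcal{E},\ |b(\varphi,\eta)|\le C\|\eta\|_H\}.$$ For every $\varphi\in D$ there is a unique $\psi\in H$ with $b(\varphi,\eta)=\langle\psi,\eta\rangle_H$ for all $\eta\in\mathcal{E}$; put $A\varphi=\psi$. (On test functions, $A\varphi=-\frac1z\partial_z(z\,\partial_z\varphi)-z^{-1-1/n}\Delta\varphi$.)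 For a function $f$ on $\Omega$, $f(z)$, $z>0$, denotes its trace on $\mathbb{R}^n\times\{z\}$, that is, the value at $z$ of the $L^2(\mathbb{R}^n)$-continuous version of $z\mapsto f(\cdot,z)$ on $(0,\infty)$, and $f(0)$ denotes the limit of $f(z)$ in $L^2(\mathbb{R}^n)$ as $z\to0^+$. There is a constant $C>0$, depending only on $n$, such that for every $\varphi\in D$ the traces $\varphi(z)$ and $\partial_z\varphi(z)$, $z>0$, and $\varphi(0)\in L^2(\mathbb{R}^n)$ exist, and i) $\displaystyle\sup_{0<z\le 1/2}\|z^{1/n}\,\partial_z\varphi(z)\|_{L^2(\mathbb{R}^n)}\le C\,(\|A\varphi\|_H+\|\varphi\|_{\mathcal E})$; ii) $\Delta\varphi(0)\in L^2(\mathbb{R}^n)$ and $\|\Delta\varphi(0)\|_{L^2(\mathbb{R}^n)}\le C\,(\|A\varphi\|_H+\|\varphi\|_{\mathcal E})$; iii) $\displaystyle\Delta\varphi(0)=-\lim_{z\to0^+}\Big(1-\frac1n\Big)z^{1/n}\,\partial_z\varphi(z)$ in the strong topology of $L^2(\mathbb{R}^n)$; iv) $(-\Delta)^{n/(n-1)}\varphi(0)\in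 L^2(\mathbb{R}^n)$, where $(-\Delta)^s$ is the Fourier multiplier with symbol $|\xi|^{2s}$ for the Fourier transform $\hat f(\xi)=\int e^{-ix\cdot\xi}f(x)\,dx$. v) Moreover, this is sharp, in the sense that for every $\gamma\in H^{2n/(n-1)}(\mathbb{R}^n)$ there exists $\varphi\in D$ such that $\varphi(0)=\gamma$. -/

import Mathlib

open MeasureTheory Set Filter Topology
open scoped ContDiff SchwartzMap FourierTransform Laplacian

noncomputable section

namespace TaubWave

/-- The horizontal space `ℝⁿ` with its Euclidean norm. -/
abbrev Rn (n : ℕ) : Type := EuclideanSpace ℝ (Fin n)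

/-- The open half-space `Ω = ℝⁿ × (0, ∞)`, as a subset of `ℝⁿ × ℝ`; points are `p = (x, z)`. -/
def halfSpace (n : ℕ) : Set (Rn n × ℝ) := {p | 0 < p.2}

/-- The measure `z dμ` on `Ω`, where `dμ = dx dz` is Lebesgue measure. -/
def weightedMeasure (n : ℕ) : Measure (Rn n × ℝ) :=
  (volume.restrict (halfSpace n)).withDensity (fun p => ENNReal.ofReal p.2)

/-- The Hilbert space `H = L²(Ω, z dμ)` of complex-valued functions. In Mathlib's convention
`inner ℂ η ψ = ∫ ψ η̄ z dμ`. -/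
abbrev H (n : ℕ) : Type := Lp ℂ 2 (weightedMeasure n)

/-- The space `L²(ℝⁿ)` of complex-valued functions. -/
abbrev L2 (n : ℕ) : Type := Lp ℂ 2 (volume : Measure (Rn n))

/-- `f ∈ L²_loc(Ω)`. -/
def MemL2loc (n : ℕ) (f : Rn n × ℝ → ℂ) : Prop :=
  ∀ K : Set (Rn n × ℝ), IsCompact K → K ⊆ halfSpace n → MemLp f 2 (volume.restrict K)

/-- `g` is a weak derivative of `f` on `Ω` in the direction `e`. -/
def IsWeakDeriv (n : ℕ) (e : Rn n × ℝ) (f g : Rn n × ℝ → ℂ) : Prop :=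
  LocallyIntegrableOn f (halfSpace n) ∧ LocallyIntegrableOn g (halfSpace n) ∧
    ∀ ζ : Rn n × ℝ → ℝ, ContDiff ℝ ∞ ζ → HasCompactSupport ζ → tsupport ζ ⊆ halfSpace n →
      ∫ p in halfSpace n, (fderiv ℝ ζ p e) • f p = -∫ p in halfSpace n, ζ p • g p

/-- `f ∈ H¹_loc(Ω)`. -/
def MemH1loc (n : ℕ) (f : Rn n × ℝ → ℂ) : Prop :=
  MemL2loc n f ∧ ∀ e : Rn n × ℝ, ∃ g, MemL2loc n g ∧ IsWeakDeriv n e f g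

open Classical in
/-- The weak derivative of `f` in the direction `e`, which is unique up to a null subset of `Ω`
(and `0` by convention if it does not exist). -/
def weakDeriv (n : ℕ) (e : Rn n × ℝ) (f : Rn n × ℝ → ℂ) : Rn n × ℝ → ℂ :=
  if h : ∃ g, IsWeakDeriv n e f g then h.choose else 0

/-- The weak derivative `∂_z f`. -/
def dz (n : ℕ) (f : Rn n × ℝ → ℂ) : Rn n × ℝ → ℂ := weakDeriv n (0, 1) f

/-- The weak derivative `∂_{x^i} f`. -/
def dx (n : ℕ) (i : Fin n) (f : Rn n × ℝ → ℂ) : Rn n × ℝ → ℂ :=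
  weakDeriv n (EuclideanSpace.single i 1, 0) f

/-- The sesquilinear form
`b(φ, η) = ∫_Ω (z ∂_zφ conj(∂_zη) + z^{-1/n} ∇φ · conj(∇η)) dμ`. -/
def form (n : ℕ) (φ η : H n) : ℂ :=
  ∫ p in halfSpace n,
    ((p.2 : ℂ) * (dz n φ p * star (dz n η p)) +
      ((p.2 ^ (-(1 / (n : ℝ))) : ℝ) : ℂ) * ∑ i, dx n i φ p * star (dx n i η p))

/-- The energy space `𝓔`: all `φ ∈ H¹_loc(Ω) ∩ H` with `b(φ, φ) < ∞`. -/
def energySpace (n : ℕ) : Set (H n) :=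
  {φ | MemH1loc n φ ∧
    ∫⁻ p in halfSpace n, ENNReal.ofReal
      (p.2 * ‖dz n φ p‖ ^ 2 + p.2 ^ (-(1 / (n : ℝ))) * ∑ i, ‖dx n i φ p‖ ^ 2) < ⊤}

/-- The norm of `𝓔`: `‖φ‖_𝓔² = b(φ, φ) + ‖φ‖_H²`. -/
def energyNorm (n : ℕ) (φ : H n) : ℝ := Real.sqrt ((form n φ φ).re + ‖φ‖ ^ 2)

/-- The domain `D` of `A`: all `φ ∈ 𝓔` such that `|b(φ, η)| ≤ C ‖η‖_H` for all `η ∈ 𝓔`. -/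
def domainA (n : ℕ) : Set (H n) :=
  {φ | φ ∈ energySpace n ∧ ∃ C : ℝ, 0 < C ∧ ∀ η ∈ energySpace n, ‖form n φ η‖ ≤ C * ‖η‖}

/-- `Aφ = ψ`: `φ ∈ D`, and `b(φ, η) = ⟨ψ, η⟩_H` for all `η ∈ 𝓔`. -/
def IsImageA (n : ℕ) (φ ψ : H n) : Prop :=
  φ ∈ domainA n ∧ ∀ η ∈ energySpace n, form n φ η = inner ℂ η ψ

/-- `u z`, for `z > 0`, is the trace of `f` on `ℝⁿ × {z}`: the family `u` is the (unique)
`L²(ℝⁿ)`-continuous version of `z ↦ f(·, z)` on `(0, ∞)`. The values `u z` for `z ≤ 0` are not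
used. -/
def IsTraceFamily (n : ℕ) (f : Rn n × ℝ → ℂ) (u : ℝ → L2 n) : Prop :=
  ContinuousOn u (Ioi 0) ∧
    ∀ᵐ z ∂(volume.restrict (Ioi (0 : ℝ))), (u z : Rn n → ℂ) =ᵐ[volume] fun x => f (x, z)

/-- `γ = φ(0)` is the trace of `φ` on `∂Ω`: the strong `L²(ℝⁿ)`-limit, as `z → 0⁺`, of the traces
of `φ` on `ℝⁿ × {z}`. -/
def IsBoundaryTrace (n : ℕ) (φ : H n) (γ : L2 n) : Prop :=
  ∃ u : ℝ → L2 n, IsTraceFamily n φ u ∧ Tendsto u (𝓝[>] 0) (𝓝 γ)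

/-- `Δγ = w` in the sense of (tempered) distributions on `ℝⁿ`. -/
def IsLaplacian (n : ℕ) (γ w : L2 n) : Prop :=
  Δ (γ : 𝓢'(Rn n, ℂ)) = (w : 𝓢'(Rn n, ℂ))

/-- `(-Δ)^s γ = w`, for a real `s > 0`: the Fourier multiplier with symbol `(2π|ξ|)^{2s}`, for the
Fourier transform `𝓕 γ(ξ) = ∫ exp(-2πi x·ξ) γ(x) dx`. -/
def IsFractionalLaplacian (n : ℕ) (s : ℝ) (γ w : L2 n) : Prop :=
  (𝓕 w : L2 n) =ᵐ[volume]
    fun ξ => (((2 * Real.pi * ‖ξ‖) ^ (2 * s) : ℝ) : ℂ) * (𝓕 γ : L2 n) ξ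

/-- `γ ∈ H^s(ℝⁿ)`. -/
def MemHs (n : ℕ) (s : ℝ) (γ : L2 n) : Prop :=
  TemperedDistribution.MemSobolev s 2 (γ : 𝓢'(Rn n, ℂ))

end TaubWave

end

/-! A Fourier transform in `x` turns `Aφ = ψ` into ordinary differential equations in `z`, one for
each frequency `ξ`. With `a = 1 - 1/n`, `lam = |2πξ|²`, `u = φ̂(ξ, ·)` and `w = z u'`, the equation
reads `w' = lam z^(a-1) u - z ψ̂`. The homogeneous solution that is regular at `z = 0` is `p(z) =
P(lam z^a / a²)` with `P(r) = ∑ r^k / (k!)²`; it is nondecreasing and equals 1 at `z = 0`. The proof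
compares `u` with `p`, with constants that do not depend on `lam`.

Let `N = p w - (z p') u`. The terms with `lam` cancel and `N' = -p z ψ̂`. Finite energy means in
particular that `|w|² / z` is integrable: so `w` is small at points arbitrarily close to 0 and `u =
O(|log z|)`, whereas `z p' = O(z^a)`. Hence `N` tends to 0 along points approaching the boundary,
and `|N(z)| ≤ p(z) z ‖ψ̂‖`, the norm being that of `L²(z dz)`. Since `(u/p)' = N / (z p²)`, it
follows that `|(u/p)'| ≤ ‖ψ̂‖ / p`. Integration from `z` to a point `z₁` where `|u(z₁)| ≤ ‖u‖` gives
the basic estimate `RadialSolution.exists_norm_le`: `|u(z)| / p(z) ≤ ‖u‖ / p(z₁) + ‖ψ̂‖ ∫_z^{z₁}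
1/p`.

It also follows that `u` has a limit `u₀` at 0. Writing `w = N/p + (z p'/p) u`, the first term is
`O(z)` and `z p'` behaves like `(lam/a) z^a`, so that `z^(-a) w` tends to `(lam/a) u₀`. As `z^(-a)
w` is the transform of `z^(1/n) ∂_z φ`, this is iii), and uniform bounds for it give i) and ii).
Those bounds use three properties of `P`: `P'` is increasing, `P'² ≤ 2 P P''`, and `P(r) ≥ r⁴/576`.
The function `p` varies on the length scale `lam^(-1/a)`, so that `∫ 1/p = O(lam^(-1/a))`; hence
`lam^(1/a) |u₀|` is bounded, which is iv) because `1/a = n/(n-1)`.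

By Plancherel, `N(ξ) = ‖ψ̂(ξ, ·)‖ + ‖φ̂(ξ, ·)‖` is an `L²` function of norm at most `‖ψ‖ + ‖φ‖`, and
it dominates all quantities above; dominated convergence turns limits at almost every frequency into
strong limits in `L²(ℝⁿ)`. The passage from the weak formulation to the differential equations uses
test functions `θ(z) h(x)`, the du Bois-Reymond lemma for `L²(ℝⁿ)`-valued functions, and jointly
measurable representatives (`IsImageA.exists_radialSolution`).

For v), put `φ̂(ξ, z) = γ̂(ξ) k(μ z)` with `μ = 1 + lam^(1/a)`, where `k` is the growing solution
for the reduced frequency `lam / μ^a`, an element of `[0, 1]`, times a fixed cutoff. Near the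
boundary `k` solves the homogeneous equation exactly, so the defect lives where `1 ≤ μ z ≤ 2`, and
its norm in `L²(z dz)` is `O(μ)`. Thus `φ ∈ D` as soon as `μ γ̂ ∈ L²`, which holds for `γ ∈
H^(2/a)`. -/

noncomputable section
-- A modified Bessel series and its inequalities
namespace TaubWave

/-- The series `∑ r ^ k / (k! (k + m)!)`, a modified Bessel function up to rescaling. -/
def besselSeries (m : ℕ) (r : ℝ) : ℝ := ∑' k : ℕ, r ^ k / ((k.factorial : ℝ) * ((k + m).factorial : ℝ))

theorem abs_besselSeries_term_le (m k : ℕ) {r R : ℝ} (h : |r| ≤ R) :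
    ‖r ^ k / ((k.factorial : ℝ) * ((k + m).factorial : ℝ))‖ ≤ R ^ k / (k.factorial : ℝ) := by
  have h1 : (1 : ℝ) ≤ ((k + m).factorial : ℝ) := by exact_mod_cast Nat.factorial_pos _
  have h2 : (0 : ℝ) < (k.factorial : ℝ) := by exact_mod_cast Nat.factorial_pos _
  have h3 : |r| ^ k ≤ R ^ k := by gcongr
  have h0 : 0 ≤ R := (abs_nonneg r).trans h
  rw [norm_div, norm_pow, Real.norm_eq_abs, Real.norm_of_nonneg (by positivity)]
  gcongr
  nlinarith

theorem summable_besselSeries (m : ℕ) (r : ℝ) :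
    Summable fun k : ℕ => r ^ k / ((k.factorial : ℝ) * ((k + m).factorial : ℝ)) :=
  Summable.of_norm_bounded (Real.summable_pow_div_factorial |r|)
    fun k => abs_besselSeries_term_le m k le_rfl

/-- Termwise differentiation cancels one factor of `k!` and raises `m` by one. On `(-R, R)` the
differentiated terms are dominated by those of the exponential series at `R`, which justifies it. -/
theorem hasDerivAt_besselSeries (m : ℕ) (r : ℝ) :
    HasDerivAt (besselSeries m) (besselSeries (m + 1) r) r := by
  set R := |r| + 1
  have hterm : ∀ (k : ℕ) (y : ℝ), HasDerivAt
      (fun y : ℝ => y ^ k / ((k.factorial : ℝ) * ((k + m).factorial : ℝ)))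
      (k * y ^ (k - 1) / ((k.factorial : ℝ) * ((k + m).factorial : ℝ))) y := fun k y =>
    (hasDerivAt_pow k y).div_const _
  have key : ∀ k : ℕ, ∀ y : ℝ,
      ((k + 1 : ℕ) : ℝ) * y ^ (k + 1 - 1) / (((k + 1).factorial : ℝ) * ((k + 1 + m).factorial : ℝ))
        = y ^ k / ((k.factorial : ℝ) * ((k + (m + 1)).factorial : ℝ)) := by
    intro k y
    rw [show k + 1 + m = k + (m + 1) by ring, Nat.factorial_succ k]
    have h2 : (k.factorial : ℝ) ≠ 0 := by exact_mod_cast (Nat.factorial_pos _).ne'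
    have h3 : ((k + (m + 1)).factorial : ℝ) ≠ 0 := by exact_mod_cast (Nat.factorial_pos _).ne'
    have h4 : ((k : ℝ) + 1) ≠ 0 := by positivity
    push_cast
    field_simp
  have hd := hasDerivAt_tsum_of_isPreconnected
    (g := fun (k : ℕ) (y : ℝ) => y ^ k / ((k.factorial : ℝ) * ((k + m).factorial : ℝ)))
    (g' := fun (k : ℕ) (y : ℝ) => k * y ^ (k - 1) / ((k.factorial : ℝ) * ((k + m).factorial : ℝ)))
    (u := fun k : ℕ => R ^ (k - 1) / ((k - 1).factorial : ℝ)) (t := Ioo (-R) R) (y₀ := r) (y := r)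
    ?_ isOpen_Ioo isPreconnected_Ioo (fun k y _ => hterm k y) ?_ ?_ (summable_besselSeries m r) ?_
  · have e : (∑' k : ℕ, (k : ℝ) * r ^ (k - 1) / ((k.factorial : ℝ) * ((k + m).factorial : ℝ)))
        = besselSeries (m + 1) r := by
      rw [Summable.tsum_eq_zero_add]
      · simp only [key]
        simp [besselSeries]
      · rw [← summable_nat_add_iff 1]
        simp only [key]
        exact summable_besselSeries (m + 1) r
    rw [← e]
    exact hd
  · rw [← summable_nat_add_iff 1]
    simpa using Real.summable_pow_div_factorial R
  · intro k y hy
    rcases k with _ | k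
    · simp
    · rw [key]
      simpa using abs_besselSeries_term_le (m + 1) k (abs_le.2 ⟨hy.1.le, hy.2.le⟩)
  · constructor <;> simp only [R] <;> linarith [neg_abs_le r, le_abs_self r]
  · constructor <;> simp only [R] <;> linarith [neg_abs_le r, le_abs_self r]

theorem continuous_besselSeries (m : ℕ) : Continuous (besselSeries m) :=
  continuous_iff_continuousAt.2 fun r => (hasDerivAt_besselSeries m r).continuousAt

theorem besselSeries_zero_right (m : ℕ) : besselSeries m 0 = 1 / (m.factorial : ℝ) := by
  rw [besselSeries, tsum_eq_single 0]
  · simp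
  · intro k hk
    simp [hk]

/-- All terms are nonnegative, so each of them is a lower bound; the terms `k = 2` and `k = 4` later
supply polynomial growth. -/
theorem besselSeries_term_le (m k : ℕ) {r : ℝ} (hr : 0 ≤ r) :
    r ^ k / ((k.factorial : ℝ) * ((k + m).factorial : ℝ)) ≤ besselSeries m r :=
  (summable_besselSeries m r).le_tsum k fun j _ => by positivity

theorem besselSeries_pos (m : ℕ) {r : ℝ} (hr : 0 ≤ r) : 0 < besselSeries m r :=
  lt_of_lt_of_le (by positivity) (besselSeries_term_le m 0 hr)

theorem one_le_besselSeries_zero {r : ℝ} (hr : 0 ≤ r) : 1 ≤ besselSeries 0 r := by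
  simpa using besselSeries_term_le 0 0 hr

theorem monotoneOn_besselSeries (m : ℕ) : MonotoneOn (besselSeries m) (Ici 0) := by
  apply monotoneOn_of_deriv_nonneg (convex_Ici 0) (continuous_besselSeries m).continuousOn
    (fun x _ => (hasDerivAt_besselSeries m x).differentiableAt.differentiableWithinAt)
  intro x hx
  rw [(hasDerivAt_besselSeries m x).deriv]
  rw [interior_Ici] at hx
  exact (besselSeries_pos _ (le_of_lt hx)).le

/-- The Bessel differential equation `(r P')' = P`. -/
theorem besselSeries_recurrence (r : ℝ) :
    r * besselSeries 2 r + besselSeries 1 r = besselSeries 0 r := by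
  have h1 : Summable fun k : ℕ => r * (r ^ k / ((k.factorial : ℝ) * ((k + 2).factorial : ℝ))) :=
    (summable_besselSeries 2 r).mul_left r
  have e0 : besselSeries 0 r = 1 + ∑' k : ℕ, r ^ (k + 1) /
      (((k + 1).factorial : ℝ) * ((k + 1).factorial : ℝ)) := by
    rw [besselSeries, (summable_besselSeries 0 r).tsum_eq_zero_add]
    simp
  have e1 : besselSeries 1 r = 1 + ∑' k : ℕ, r ^ (k + 1) /
      (((k + 1).factorial : ℝ) * ((k + 1 + 1).factorial : ℝ)) := by
    rw [besselSeries, (summable_besselSeries 1 r).tsum_eq_zero_add]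
    simp
  have hs := (summable_nat_add_iff 1).2 (summable_besselSeries 1 r)
  rw [e0, e1, besselSeries, ← tsum_mul_left, add_left_comm, ← Summable.tsum_add h1 hs]
  congr 1
  refine tsum_congr fun k => ?_
  have h2 : (k.factorial : ℝ) ≠ 0 := by exact_mod_cast (Nat.factorial_pos _).ne'
  rw [show k + 2 = (k + 1) + 1 by ring, Nat.factorial_succ (k + 1), Nat.factorial_succ k]
  have h4 : ((k : ℝ) + 1) ≠ 0 := by positivity
  have h5 : ((k : ℝ) + 1 + 1) ≠ 0 := by positivity
  push_cast
  field_simp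
  ring

/-- A discriminant argument: with `P = besselSeries 0`, the polynomial `P - 2 t P' + 2 t² P''` is
nonnegative coefficient by coefficient, and `t = P' / (2 P'')` minimises it. In the form `1 / P ≤ 2
P'' / P'²` the inequality bounds `1 / P` by twice the derivative of `-1 / P'`. -/
theorem besselSeries_one_sq_le {r : ℝ} (hr : 0 ≤ r) :
    besselSeries 1 r ^ 2 ≤ 2 * (besselSeries 0 r * besselSeries 2 r) := by
  have key : ∀ t : ℝ, 0 ≤ besselSeries 0 r - 2 * t * besselSeries 1 r
      + 2 * t ^ 2 * besselSeries 2 r := by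
    intro t
    rw [besselSeries, besselSeries, besselSeries, ← tsum_mul_left, ← tsum_mul_left,
      ← Summable.tsum_sub (summable_besselSeries 0 r) ((summable_besselSeries 1 r).mul_left _),
      ← Summable.tsum_add ((summable_besselSeries 0 r).sub ((summable_besselSeries 1 r).mul_left _))
        ((summable_besselSeries 2 r).mul_left _)]
    refine tsum_nonneg fun k => ?_
    have h2 : (k.factorial : ℝ) ≠ 0 := by exact_mod_cast (Nat.factorial_pos _).ne'
    rw [show k + 2 = (k + 1) + 1 by ring, Nat.factorial_succ (k + 1), Nat.factorial_succ k]
    have h4 : (0 : ℝ) < (k : ℝ) + 1 := by positivity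
    have h5 : (0 : ℝ) < (k : ℝ) + 1 + 1 := by positivity
    have : r ^ k / ((k.factorial : ℝ) * ((k + 0).factorial : ℝ))
        - 2 * t * (r ^ k / ((k.factorial : ℝ) * (((k + 1) * k.factorial : ℕ) : ℝ)))
        + 2 * t ^ 2 * (r ^ k / ((k.factorial : ℝ) * (((k + 1 + 1) * ((k + 1) * k.factorial) : ℕ) : ℝ)))
        = r ^ k / (k.factorial : ℝ) ^ 2 *
          ((1 - t / (k + 1)) ^ 2 + t ^ 2 * k / ((k + 1) ^ 2 * (k + 1 + 1))) := by
      push_cast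
      simp only [add_zero]
      field_simp
      ring
    rw [this]
    positivity
  have hpos := besselSeries_pos 2 hr
  have := key (besselSeries 1 r / (2 * besselSeries 2 r))
  have e : besselSeries 0 r - 2 * (besselSeries 1 r / (2 * besselSeries 2 r)) * besselSeries 1 r
      + 2 * (besselSeries 1 r / (2 * besselSeries 2 r)) ^ 2 * besselSeries 2 r
      = besselSeries 0 r - besselSeries 1 r ^ 2 / (2 * besselSeries 2 r) := by
    field_simp
    ring
  rw [e, sub_nonneg, div_le_iff₀ (by positivity)] at this
  linarith

end TaubWave
end

/-! ### The growing homogeneous solution: bounds uniform in the frequency -/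

noncomputable section
namespace TaubWave

theorem integral_mul_le_sqrt_mul_sqrt {α : Type*} [MeasurableSpace α] {μ : Measure α} {f g : α → ℝ}
    (hf : AEStronglyMeasurable f μ) (hg : AEStronglyMeasurable g μ)
    (hf0 : 0 ≤ᵐ[μ] f) (hg0 : 0 ≤ᵐ[μ] g)
    (hf2 : Integrable (fun x => f x ^ 2) μ) (hg2 : Integrable (fun x => g x ^ 2) μ) :
    ∫ x, f x * g x ∂μ ≤ √(∫ x, f x ^ 2 ∂μ) * √(∫ x, g x ^ 2 ∂μ) := by
  have := integral_mul_le_Lp_mul_Lq_of_nonneg (μ := μ) Real.HolderConjugate.two_two hf0 hg0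
    (by simpa using (memLp_two_iff_integrable_sq hf).2 hf2)
    (by simpa using (memLp_two_iff_integrable_sq hg).2 hg2)
  simpa [Real.sqrt_eq_rpow] using this

/-- Integration by parts against a primitive of an integrable vector-valued function. -/
theorem integral_deriv_smul_primitive {E : Type*} [NormedAddCommGroup E] [NormedSpace ℝ E]
    [CompleteSpace E] {φ φ' : ℝ → ℝ} {g : ℝ → E} {x y : ℝ} (hxy : x ≤ y)
    (hφ : ∀ s ∈ Icc x y, HasDerivAt φ (φ' s) s) (hφ' : ContinuousOn φ' (Icc x y))
    (hg : IntegrableOn g (Ioc x y)) :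
    ∫ s in x..y, φ' s • ∫ t in x..s, g t = φ y • (∫ t in x..y, g t) - ∫ s in x..y, φ s • g s := by
  set μ := volume.restrict (Ioc x y)
  have hφ'i : Integrable φ' μ := (hφ'.integrableOn_Icc).mono_set Ioc_subset_Icc_self
  have hφc : ContinuousOn φ (Icc x y) := fun s hs => (hφ s hs).continuousAt.continuousWithinAt
  -- The primitive of an integrable `g` need not be differentiable at every point, so the identity
  -- is obtained from Fubini's theorem on the triangle `t ≤ s`.
  have hprod : Integrable (fun p : ℝ × ℝ => φ' p.1 • g p.2) (μ.prod μ) := hφ'i.smul_prod hg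
  have hmeas : MeasurableSet {p : ℝ × ℝ | p.2 ≤ p.1} := measurableSet_le measurable_snd measurable_fst
  have hind := hprod.indicator hmeas
  have hsw := integral_integral_swap (f := fun s t => {p : ℝ × ℝ | p.2 ≤ p.1}.indicator
    (fun p : ℝ × ℝ => φ' p.1 • g p.2) (s, t)) hind
  have hL : ∫ s in x..y, φ' s • ∫ t in x..s, g t = ∫ s, ∫ t, {p : ℝ × ℝ | p.2 ≤ p.1}.indicator
    (fun p : ℝ × ℝ => φ' p.1 • g p.2) (s, t) ∂μ ∂μ := by
    rw [intervalIntegral.integral_of_le hxy]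
    refine setIntegral_congr_fun measurableSet_Ioc fun s hs => ?_
    rw [intervalIntegral.integral_of_le hs.1.le, ← integral_smul]
    have : (fun t => {p : ℝ × ℝ | p.2 ≤ p.1}.indicator (fun p : ℝ × ℝ => φ' p.1 • g p.2) (s, t))
        = (Iic s).indicator (fun t => φ' s • g t) := by
      ext t
      simp [indicator]
    rw [this, integral_indicator measurableSet_Iic, Measure.restrict_restrict measurableSet_Iic]
    congr 2
    ext t
    simp only [mem_Ioc, mem_inter_iff, mem_Iic]
    constructor
    · rintro ⟨h1, h2⟩; exact ⟨h2, h1, h2.trans hs.2⟩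
    · rintro ⟨h1, h2, h3⟩; exact ⟨h2, h1⟩
  have hR : ∫ t, ∫ s, {p : ℝ × ℝ | p.2 ≤ p.1}.indicator
      (fun p : ℝ × ℝ => φ' p.1 • g p.2) (s, t) ∂μ ∂μ = ∫ t in x..y, (φ y - φ t) • g t := by
    rw [intervalIntegral.integral_of_le hxy]
    refine setIntegral_congr_fun measurableSet_Ioc fun t ht => ?_
    have : (fun s => {p : ℝ × ℝ | p.2 ≤ p.1}.indicator (fun p : ℝ × ℝ => φ' p.1 • g p.2) (s, t))
        = (Ici t).indicator (fun s => φ' s • g t) := by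
      ext s
      simp [indicator]
    rw [this, integral_indicator measurableSet_Ici, Measure.restrict_restrict measurableSet_Ici,
      integral_smul_const]
    congr 1
    have e : Ici t ∩ Ioc x y = Icc t y := by
      ext s
      simp only [mem_inter_iff, mem_Ici, mem_Ioc, mem_Icc]
      constructor
      · rintro ⟨h1, h2, h3⟩; exact ⟨h1, h3⟩
      · rintro ⟨h1, h2⟩; exact ⟨h1, ht.1.trans_le h1, h2⟩
    have hsub : Icc t y ⊆ Icc x y := Icc_subset_Icc_left ht.1.le
    rw [e, integral_Icc_eq_integral_Ioc, ← intervalIntegral.integral_of_le ht.2]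
    refine intervalIntegral.integral_eq_sub_of_hasDerivAt (fun s hs => ?_) ?_
    · rw [uIcc_of_le ht.2] at hs
      exact hφ s (hsub hs)
    · rw [intervalIntegrable_iff_integrableOn_Icc_of_le ht.2]
      exact (hφ'.mono hsub).integrableOn_Icc
  rw [hL, hsw, hR]
  have hi1 : IntervalIntegrable g volume x y := (intervalIntegrable_iff_integrableOn_Ioc_of_le hxy).2 hg
  have hi2 : IntervalIntegrable (fun t => φ t • g t) volume x y :=
    hi1.continuousOn_smul (by rwa [uIcc_of_le hxy])
  simp only [sub_smul]
  have e := intervalIntegral.integral_sub (f := fun t => φ y • g t) (hi1.smul (φ y)) hi2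
  rw [e, intervalIntegral.integral_smul]

/-- The growing solution of `z (z p')' = lam z ^ a p`. -/
def growing (a lam z : ℝ) : ℝ := besselSeries 0 (lam * z ^ a / a ^ 2)

/-- `z p'` for the growing solution `p`. -/
def growingFlux (a lam z : ℝ) : ℝ :=
  a * ((lam * z ^ a / a ^ 2) * besselSeries 1 (lam * z ^ a / a ^ 2))

section
variable {a lam : ℝ}

theorem hasDerivAt_radius (ha : 0 < a) {z : ℝ} (hz : 0 < z) :
    HasDerivAt (fun z : ℝ => lam * z ^ a / a ^ 2) (lam * z ^ (a - 1) / a) z := by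
  have := (((Real.hasDerivAt_rpow_const (p := a) (Or.inl hz.ne')).const_mul lam).div_const (a ^ 2))
  refine this.congr_deriv ?_
  field_simp

theorem hasDerivAt_growing (ha : 0 < a) {z : ℝ} (hz : 0 < z) :
    HasDerivAt (growing a lam) (growingFlux a lam z / z) z := by
  have h := (hasDerivAt_besselSeries 0 (lam * z ^ a / a ^ 2)).comp z (hasDerivAt_radius (lam := lam) ha hz)
  refine h.congr_deriv ?_
  rw [growingFlux, Real.rpow_sub_one hz.ne']
  field_simp

/-- With `r = lam z ^ a / a ^ 2` one has `z d/dz = a r d/dr`, so the identity `(r P')' = P` becomes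
the equation for `growing`. -/
theorem hasDerivAt_growingFlux (ha : 0 < a) {z : ℝ} (hz : 0 < z) :
    HasDerivAt (growingFlux a lam) (lam * z ^ (a - 1) * growing a lam z) z := by
  have h0 : ∀ r : ℝ, HasDerivAt (fun r => a * (r * besselSeries 1 r)) (a * besselSeries 0 r) r := by
    intro r
    have := ((hasDerivAt_id r).mul (hasDerivAt_besselSeries 1 r)).const_mul a
    refine this.congr_deriv ?_
    rw [← besselSeries_recurrence r, id]
    ring
  have h := (h0 (lam * z ^ a / a ^ 2)).comp z (hasDerivAt_radius (lam := lam) ha hz)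
  refine h.congr_deriv ?_
  rw [growing]
  field_simp

theorem radius_nonneg (hlam : 0 ≤ lam) {z : ℝ} (hz : 0 ≤ z) : 0 ≤ lam * z ^ a / a ^ 2 := by
  have := Real.rpow_nonneg hz a
  positivity

theorem radius_mono (ha : 0 < a) (hlam : 0 ≤ lam) {x z : ℝ} (hx : 0 ≤ x) (hxz : x ≤ z) :
    lam * x ^ a / a ^ 2 ≤ lam * z ^ a / a ^ 2 := by
  have := Real.rpow_le_rpow hx hxz ha.le
  gcongr

theorem one_le_growing (hlam : 0 ≤ lam) {z : ℝ} (hz : 0 ≤ z) : 1 ≤ growing a lam z :=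
  one_le_besselSeries_zero (radius_nonneg hlam hz)

theorem growing_mono (ha : 0 < a) (hlam : 0 ≤ lam) {x z : ℝ} (hx : 0 ≤ x) (hxz : x ≤ z) :
    growing a lam x ≤ growing a lam z :=
  monotoneOn_besselSeries 0 (radius_nonneg hlam hx) (radius_nonneg hlam (hx.trans hxz))
    (radius_mono ha hlam hx hxz)

theorem continuous_growing (ha : 0 < a) : Continuous (growing a lam) :=
  (continuous_besselSeries 0).comp
    ((continuous_const.mul (Real.continuous_rpow_const ha.le)).div_const _)

theorem continuous_growingFlux (ha : 0 < a) : Continuous (growingFlux a lam) := by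
  have h : Continuous fun z : ℝ => lam * z ^ a / a ^ 2 :=
    (continuous_const.mul (Real.continuous_rpow_const ha.le)).div_const _
  exact continuous_const.mul (h.mul ((continuous_besselSeries 1).comp h))

theorem growingFlux_nonneg (ha : 0 < a) (hlam : 0 ≤ lam) {z : ℝ} (hz : 0 ≤ z) :
    0 ≤ growingFlux a lam z :=
  mul_nonneg ha.le (mul_nonneg (radius_nonneg hlam hz) (besselSeries_pos 1 (radius_nonneg hlam hz)).le)

/-- Exhibits the factor `z ^ a` by which the flux vanishes at the boundary; it beats logarithmic
growth and is cancelled by `z ^ (-a)` in the weighted normal derivative. -/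
theorem growingFlux_eq (ha : 0 < a) (z : ℝ) :
    growingFlux a lam z = z ^ a * (lam / a * besselSeries 1 (lam * z ^ a / a ^ 2)) := by
  rw [growingFlux]
  field_simp

/-- Since `P'` is increasing, `P(r₁) ≥ P'(r) (r₁ - r)`. The distance kept between `z ≤ b` and `z₁ ≥
b + 1` makes `r₁ - r` at least a fixed multiple of `lam`, which absorbs the factor `lam`. -/
theorem lam_mul_besselSeries_div_growing_le (ha : 0 < a) (hlam : 0 ≤ lam) {b z z₁ : ℝ}
    (hz : 0 ≤ z) (hzb : z ≤ b) (hz₁ : b + 1 ≤ z₁) :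
    lam * besselSeries 1 (lam * z ^ a / a ^ 2) / growing a lam z₁
      ≤ a ^ 2 / ((b + 1) ^ a - b ^ a) := by
  have hb : 0 ≤ b := hz.trans hzb
  have hδ : 0 < (b + 1) ^ a - b ^ a := sub_pos.2 (Real.rpow_lt_rpow hb (by linarith) ha)
  have hP : 0 < growing a lam z₁ := lt_of_lt_of_le one_pos (one_le_growing hlam (by linarith))
  set r := lam * z ^ a / a ^ 2
  set r₁ := lam * z₁ ^ a / a ^ 2
  have hr : 0 ≤ r := radius_nonneg hlam hz
  have hrr : r ≤ r₁ := radius_mono ha hlam hz (by linarith)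
  have hmv : besselSeries 1 r * (r₁ - r) ≤ besselSeries 0 r₁ - besselSeries 0 r := by
    refine (convex_Icc r r₁).mul_sub_le_image_sub_of_le_deriv
      (continuous_besselSeries 0).continuousOn
      (fun x _ => (hasDerivAt_besselSeries 0 x).differentiableAt.differentiableWithinAt)
      (fun x hx => ?_) r (left_mem_Icc.2 hrr) r₁ (right_mem_Icc.2 hrr) hrr
    rw [interior_Icc] at hx
    rw [(hasDerivAt_besselSeries 0 x).deriv]
    exact monotoneOn_besselSeries 1 hr (hr.trans hx.1.le) hx.1.le
  have hgap : lam * (((b + 1) ^ a - b ^ a) / a ^ 2) ≤ r₁ - r := by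
    have h1 : z ^ a ≤ b ^ a := Real.rpow_le_rpow hz hzb ha.le
    have h2 : (b + 1) ^ a ≤ z₁ ^ a := Real.rpow_le_rpow (by linarith) hz₁ ha.le
    simp only [r, r₁]
    rw [← sub_div, ← mul_sub, mul_div_assoc]
    gcongr
  have hQ := besselSeries_pos 1 hr
  have hP0 := besselSeries_pos 0 hr
  rw [div_le_div_iff₀ hP hδ]
  have : besselSeries 1 r * (lam * (((b + 1) ^ a - b ^ a) / a ^ 2)) ≤ growing a lam z₁ :=
    (mul_le_mul_of_nonneg_left hgap hQ.le).trans (by rw [growing]; linarith)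
  have ha2 : 0 < a ^ 2 := by positivity
  calc lam * besselSeries 1 r * ((b + 1) ^ a - b ^ a)
      = a ^ 2 * (besselSeries 1 r * (lam * (((b + 1) ^ a - b ^ a) / a ^ 2))) := by field_simp
    _ ≤ _ := mul_le_mul_of_nonneg_left this ha2.le

/-- By `besselSeries_one_sq_le`, `lam / p` is at most the derivative of `-c / P'(lam s ^ a / a ^
2)`. Integration leaves at most `c / P'` at the lower endpoint, where the prefactor `P'` cancels it.
-/
theorem lam_mul_besselSeries_mul_integral_le (ha : 0 < a) (ha1 : a ≤ 1) (hlam : 0 ≤ lam) {z z₁ : ℝ}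
    (hz : 0 < z) (hz₁ : z ≤ z₁) :
    lam * besselSeries 1 (lam * z ^ a / a ^ 2) * ∫ s in z..z₁, (growing a lam s)⁻¹
      ≤ 2 * a * z₁ ^ (1 - a) := by
  have hpos : ∀ s ∈ Icc z z₁, 0 < s := fun s hs => hz.trans_le hs.1
  have hQ : ∀ s, 0 ≤ s → 0 < besselSeries 1 (lam * s ^ a / a ^ 2) := fun s hs =>
    besselSeries_pos 1 (radius_nonneg hlam hs)
  -- The 2 is that of `besselSeries_one_sq_le`, the `a` cancels the denominator of the derivative of
  -- the argument, and `z₁ ^ (1 - a)` compensates `s ^ (a - 1) ≥ z₁ ^ (a - 1)`.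
  set c := 2 * a * z₁ ^ (1 - a)
  have hz₁0 : 0 < z₁ := hz.trans_le hz₁
  have hc : 0 < c := by positivity
  have hd : ∀ s ∈ Icc z z₁, HasDerivAt (fun s => -c / besselSeries 1 (lam * s ^ a / a ^ 2))
      (c * (besselSeries 2 (lam * s ^ a / a ^ 2) * (lam * s ^ (a - 1) / a))
        / besselSeries 1 (lam * s ^ a / a ^ 2) ^ 2) s := by
    intro s hs
    have h := ((hasDerivAt_besselSeries 1 (lam * s ^ a / a ^ 2)).comp s
      (hasDerivAt_radius (lam := lam) ha (hpos s hs)))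
    have := (hasDerivAt_const s (-c)).div h (hQ s (hpos s hs).le).ne'
    refine this.congr_deriv ?_
    simp
  have hint := intervalIntegral.integral_le_sub_of_hasDeriv_right_of_le hz₁
    (g := fun s => -c / besselSeries 1 (lam * s ^ a / a ^ 2))
    (φ := fun s => lam * (growing a lam s)⁻¹)
    (fun s hs => (hd s hs).continuousAt.continuousWithinAt)
    (fun s hs => (hd s (Ioo_subset_Icc_self hs)).hasDerivWithinAt) ?_ ?_
  · rw [intervalIntegral.integral_const_mul] at hint
    have h1 : -c / besselSeries 1 (lam * z₁ ^ a / a ^ 2) - -c / besselSeries 1 (lam * z ^ a / a ^ 2)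
        ≤ c / besselSeries 1 (lam * z ^ a / a ^ 2) := by
      have : 0 ≤ c / besselSeries 1 (lam * z₁ ^ a / a ^ 2) := (div_pos hc (hQ _ hz₁0.le)).le
      rw [neg_div, neg_div]
      linarith
    calc _ = besselSeries 1 (lam * z ^ a / a ^ 2) * (lam * ∫ s in z..z₁, (growing a lam s)⁻¹) := by ring
      _ ≤ besselSeries 1 (lam * z ^ a / a ^ 2) * (c / besselSeries 1 (lam * z ^ a / a ^ 2)) :=
        mul_le_mul_of_nonneg_left (hint.trans h1) (hQ z hz.le).le
      _ = c := by field_simp [(hQ z hz.le).ne']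
  · refine ContinuousOn.integrableOn_Icc (continuousOn_const.mul
      ((continuous_growing ha).continuousOn.inv₀ fun s hs => ?_))
    exact (lt_of_lt_of_le one_pos (one_le_growing hlam (hpos s hs).le)).ne'
  · intro s hs
    have hs0 := hpos s (Ioo_subset_Icc_self hs)
    have hr := radius_nonneg (a := a) hlam hs0.le
    have h1 := besselSeries_one_sq_le hr
    have hP : 0 < growing a lam s := lt_of_lt_of_le one_pos (one_le_growing hlam hs0.le)
    have hQs := hQ s hs0.le
    have h2 : 1 ≤ z₁ ^ (1 - a) * s ^ (a - 1) := by
      rw [← neg_sub 1 a, Real.rpow_neg hs0.le, ← div_eq_mul_inv,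
        one_le_div (Real.rpow_pos_of_pos hs0 _)]
      exact Real.rpow_le_rpow hs0.le hs.2.le (by linarith)
    have hQ2 := besselSeries_pos 2 hr
    rw [← div_eq_mul_inv, div_le_div_iff₀ hP (by positivity)]
    calc lam * besselSeries 1 (lam * s ^ a / a ^ 2) ^ 2
        ≤ lam * (2 * (growing a lam s * besselSeries 2 (lam * s ^ a / a ^ 2))) * 1 := by
          rw [mul_one]; exact mul_le_mul_of_nonneg_left h1 hlam
      _ ≤ lam * (2 * (growing a lam s * besselSeries 2 (lam * s ^ a / a ^ 2)))
          * (z₁ ^ (1 - a) * s ^ (a - 1)) := by gcongr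
      _ = _ := by simp only [c]; field_simp

/-- The growing solution depends on `s` only through `μ s` with `μ = lam ^ (1 / a)`, so the quantity
is invariant under scaling. It is bounded by comparing `μ / p` with the derivative of a multiple of
`arctan (μ s)`. -/
theorem rpow_mul_integral_growing_le (ha : 1 / 2 ≤ a) (ha1 : a ≤ 1) (hlam : 0 ≤ lam) {z z₁ : ℝ}
    (hz : 0 < z) (hz₁ : z ≤ z₁) :
    lam ^ (1 / a) * ∫ s in z..z₁, (growing a lam s)⁻¹ ≤ 1152 * Real.pi := by
  have ha0 : 0 < a := by linarith
  set μ := lam ^ (1 / a)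
  have hμ0 : 0 ≤ μ := Real.rpow_nonneg hlam _
  have hμa : μ ^ a = lam := by
    rw [← Real.rpow_mul hlam, one_div_mul_cancel ha0.ne', Real.rpow_one]
  have hd : ∀ s : ℝ, HasDerivAt (fun s => 1152 * Real.arctan (μ * s))
      (1152 * (1 / (1 + (μ * s) ^ 2) * μ)) s := fun s => by
    simpa using (((hasDerivAt_id s).const_mul μ).arctan.const_mul 1152)
  rw [← intervalIntegral.integral_const_mul]
  refine (intervalIntegral.integral_le_sub_of_hasDeriv_right_of_le hz₁
    (g := fun s => 1152 * Real.arctan (μ * s))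
    (fun s hs => (hd s).continuousAt.continuousWithinAt)
    (fun s hs => (hd s).hasDerivWithinAt) ?_ ?_).trans ?_
  · refine ContinuousOn.integrableOn_Icc (continuousOn_const.mul
      ((continuous_growing ha0).continuousOn.inv₀ fun s hs => ?_))
    exact (lt_of_lt_of_le one_pos (one_le_growing hlam (hz.le.trans hs.1))).ne'
  · intro s hs
    have hs0 : 0 < s := hz.trans hs.1
    have hP1 := one_le_growing (a := a) hlam hs0.le
    have hr := radius_nonneg (a := a) hlam hs0.le
    -- For `μ s ≥ 1` the term `k = 4` gives `(μ s) ^ 2 ≤ (μ s) ^ (4 a) ≤ 576 p`, where `576 = (4!) ^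
    -- 2` and `a ≥ 1 / 2` is used. Doubling the constant accounts for the summand 1.
    have hP : 1 + (μ * s) ^ 2 ≤ 1152 * growing a lam s := by
      rcases le_total (μ * s) 1 with h | h
      · have : (μ * s) ^ 2 ≤ 1 := pow_le_one₀ (by positivity) h
        linarith
      · have h4 := besselSeries_term_le 0 4 hr
        have e : (μ * s) ^ a = lam * s ^ a := by rw [Real.mul_rpow hμ0 hs0.le, hμa]
        have h5 : (μ * s) ^ 2 ≤ (lam * s ^ a / a ^ 2) ^ 4 := by
          have : (μ * s) ^ a ≤ lam * s ^ a / a ^ 2 := by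
            rw [← e, le_div_iff₀ (by positivity)]
            have : a ^ 2 ≤ 1 := pow_le_one₀ ha0.le ha1
            have h0 : 0 ≤ (μ * s) ^ a := by positivity
            nlinarith
          calc (μ * s) ^ 2 = (μ * s) ^ (2 : ℝ) := by norm_cast
            _ ≤ (μ * s) ^ (a * 4) := Real.rpow_le_rpow_of_exponent_le h (by linarith)
            _ = ((μ * s) ^ a) ^ 4 := by rw [Real.rpow_mul (by positivity)]; norm_cast
            _ ≤ _ := by gcongr
        have h6 : (1 : ℝ) ≤ (μ * s) ^ 2 := one_le_pow₀ h
        have h7 : (lam * s ^ a / a ^ 2) ^ 4 / 576 ≤ growing a lam s := by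
          refine le_trans (le_of_eq ?_) h4
          norm_num [Nat.factorial]
        linarith
    have hPpos : 0 < growing a lam s := by linarith
    have : (growing a lam s)⁻¹ ≤ 1152 * (1 / (1 + (μ * s) ^ 2)) := by
      rw [inv_eq_one_div, mul_one_div, div_le_div_iff₀ hPpos (by positivity)]
      linarith
    calc _ ≤ μ * (1152 * (1 / (1 + (μ * s) ^ 2))) := by gcongr
      _ = _ := by ring
  · have h1 := Real.arctan_lt_pi_div_two (μ * z₁)
    have h2 : 0 ≤ Real.arctan (μ * z) := Real.arctan_nonneg.2 (by positivity)
    have := Real.pi_pos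
    linarith

end

end TaubWave
end

/-! ### The equation at a fixed frequency -/

noncomputable section
namespace TaubWave

/-- The inequality `‖w‖ ≤ ‖w‖ ^ 2 + 1` splits the integrand `s⁻¹ ‖w‖` into an integrable part and
`s⁻¹`, whose integral over `[z, 1]` is `-log z`. -/
theorem norm_le_log_of_eq_integral {u w : ℝ → ℂ}
    (hu : ∀ z, 0 < z → u z = u 1 + ∫ s in (1 : ℝ)..z, s⁻¹ • w s)
    (hi : IntegrableOn (fun s => s⁻¹ * ‖w s‖ ^ 2) (Ioi 0)) {z : ℝ} (hz : 0 < z) (hz1 : z ≤ 1) :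
    ‖u z‖ ≤ ‖u 1‖ + (∫ s in Ioi 0, s⁻¹ * ‖w s‖ ^ 2) - Real.log z := by
  have hsub : Icc z 1 ⊆ Ioi 0 := fun s hs => hz.trans_le hs.1
  have hinv : ContinuousOn (fun s : ℝ => s⁻¹) (Icc z 1) :=
    continuousOn_id.inv₀ fun s hs => (hsub hs).ne'
  have h1 : ‖∫ s in (1 : ℝ)..z, s⁻¹ • w s‖ ≤ ∫ s in z..1, (s⁻¹ * ‖w s‖ ^ 2 + s⁻¹) := by
    rw [intervalIntegral.integral_symm, norm_neg]
    refine intervalIntegral.norm_integral_le_of_norm_le hz1 ?_ ?_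
    · refine Eventually.of_forall fun s hs => ?_
      have hs0 : 0 < s⁻¹ := inv_pos.2 (hz.trans hs.1)
      rw [norm_smul, Real.norm_of_nonneg hs0.le]
      nlinarith [sq_nonneg (‖w s‖ - 1), norm_nonneg (w s)]
    · rw [intervalIntegrable_iff_integrableOn_Icc_of_le hz1]
      exact (hi.mono_set hsub).add hinv.integrableOn_Icc
  have h2 : ∫ s in z..1, (s⁻¹ * ‖w s‖ ^ 2 + s⁻¹) ≤ (∫ s in Ioi 0, s⁻¹ * ‖w s‖ ^ 2) - Real.log z := by
    rw [intervalIntegral.integral_add, integral_inv_of_pos hz one_pos, one_div, Real.log_inv,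
      intervalIntegral.integral_of_le hz1]
    · have : ∫ s in Ioc z 1, s⁻¹ * ‖w s‖ ^ 2 ≤ ∫ s in Ioi 0, s⁻¹ * ‖w s‖ ^ 2 := by
        refine setIntegral_mono_set hi ?_ (Eventually.of_forall fun s hs => hz.trans hs.1)
        filter_upwards [ae_restrict_mem measurableSet_Ioi] with s hs
        have : 0 < s⁻¹ := inv_pos.2 hs
        positivity
      linarith
    · rw [intervalIntegrable_iff_integrableOn_Icc_of_le hz1]
      exact hi.mono_set hsub
    · rw [intervalIntegrable_iff_integrableOn_Icc_of_le hz1]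
      exact hinv.integrableOn_Icc
  rw [hu z hz]
  refine (norm_add_le _ _).trans ?_
  linarith

/-- If `z u' = w` with `w / √z` square integrable, then `u` grows at most logarithmically at `0`. -/
theorem tendsto_rpow_mul_norm_of_eq_integral {u w : ℝ → ℂ}
    (hu : ∀ z, 0 < z → u z = u 1 + ∫ s in (1 : ℝ)..z, s⁻¹ • w s)
    (hi : IntegrableOn (fun s => s⁻¹ * ‖w s‖ ^ 2) (Ioi 0)) {c : ℝ} (hc : 0 < c) :
    Tendsto (fun z : ℝ => z ^ c * ‖u z‖) (𝓝[>] 0) (𝓝 0) := by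
  set B := ‖u 1‖ + ∫ s in Ioi 0, s⁻¹ * ‖w s‖ ^ 2
  have h1 : Tendsto (fun z : ℝ => z ^ c * B - Real.log z * z ^ c) (𝓝[>] 0) (𝓝 0) := by
    have h2 : Tendsto (fun z : ℝ => z ^ c) (𝓝[>] 0) (𝓝 0) := by
      have := (Real.continuous_rpow_const hc.le).tendsto 0
      rw [Real.zero_rpow hc.ne'] at this
      exact this.mono_left nhdsWithin_le_nhds
    simpa using (h2.mul_const B).sub (tendsto_log_mul_rpow_nhdsGT_zero hc)
  refine squeeze_zero' ?_ ?_ h1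
  · filter_upwards [self_mem_nhdsWithin] with z hz
    have := Real.rpow_nonneg (le_of_lt hz) c
    positivity
  · filter_upwards [Ioc_mem_nhdsGT one_pos] with z hz
    have := norm_le_log_of_eq_integral hu hi hz.1 hz.2
    have h3 := Real.rpow_nonneg hz.1.le c
    nlinarith

/-- Solutions of `z (z u')' = lam z ^ a u - z ^ 2 ψ`, with `w = z u'`, of finite energy. -/
structure RadialSolution (a lam : ℝ) (u w ψ : ℝ → ℂ) : Prop where
  cont_u : ContinuousOn u (Ioi 0)
  cont_w : ContinuousOn w (Ioi 0)
  u_eq : ∀ z, 0 < z → u z = u 1 + ∫ s in (1 : ℝ)..z, s⁻¹ • w s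
  w_eq : ∀ z, 0 < z → w z = w 1 + ∫ s in (1 : ℝ)..z, ((lam * s ^ (a - 1)) • u s - s • ψ s)
  meas_ψ : AEStronglyMeasurable ψ (volume.restrict (Ioi 0))
  int_ψ : IntegrableOn (fun s => s * ‖ψ s‖ ^ 2) (Ioi 0)
  int_u : IntegrableOn (fun s => s * ‖u s‖ ^ 2) (Ioi 0)
  int_w : IntegrableOn (fun s => s⁻¹ * ‖w s‖ ^ 2) (Ioi 0)

/-- The norm of a function in `L²((0, ∞), z dz)`. -/
def radialNorm (f : ℝ → ℂ) : ℝ := √(∫ s in Ioi 0, s * ‖f s‖ ^ 2)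

theorem integrableOn_smul_of_radial {ψ : ℝ → ℂ} (hm : AEStronglyMeasurable ψ (volume.restrict (Ioi 0)))
    (hi : IntegrableOn (fun s => s * ‖ψ s‖ ^ 2) (Ioi 0)) (z : ℝ) :
    IntegrableOn (fun s => s • ψ s) (Ioc 0 z) := by
  have h1 : IntegrableOn (fun s => s + s * ‖ψ s‖ ^ 2) (Ioc 0 z) :=
    (continuous_id.integrableOn_Ioc).add (hi.mono_set Ioc_subset_Ioi_self)
  refine h1.mono' ?_ ?_
  · exact (continuous_id.aestronglyMeasurable).smul
      (hm.mono_measure (Measure.restrict_mono Ioc_subset_Ioi_self le_rfl))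
  · filter_upwards [ae_restrict_mem measurableSet_Ioc] with s hs
    rw [norm_smul, Real.norm_of_nonneg hs.1.le]
    nlinarith [sq_nonneg (‖ψ s‖ - 1), norm_nonneg (ψ s), hs.1]

/-- Cauchy–Schwarz after writing `s = √s √s`. The full power of `z` gained here cancels the factor
`1 / z` in `(u / p)' = N / (z p ^ 2)`, where `N` is the Wronskian. -/
theorem integral_norm_smul_le_radialNorm {ψ : ℝ → ℂ}
    (hm : AEStronglyMeasurable ψ (volume.restrict (Ioi 0)))
    (hi : IntegrableOn (fun s => s * ‖ψ s‖ ^ 2) (Ioi 0)) {z : ℝ} (hz : 0 ≤ z) :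
    ∫ s in Ioc 0 z, ‖s • ψ s‖ ≤ z * radialNorm ψ := by
  have e : ∫ s in Ioc 0 z, ‖s • ψ s‖ = ∫ s in Ioc 0 z, √s * (√s * ‖ψ s‖) := by
    refine setIntegral_congr_fun measurableSet_Ioc fun s hs => ?_
    rw [norm_smul, Real.norm_of_nonneg hs.1.le, ← mul_assoc, Real.mul_self_sqrt hs.1.le]
  have e1 : ∫ s in Ioc 0 z, √s ^ 2 = z ^ 2 / 2 := by
    rw [setIntegral_congr_fun (g := fun s => s) measurableSet_Ioc
      (fun s hs => Real.sq_sqrt hs.1.le), ← intervalIntegral.integral_of_le hz, integral_id]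
    ring
  have hm' : AEStronglyMeasurable ψ (volume.restrict (Ioc 0 z)) :=
    hm.mono_measure (Measure.restrict_mono Ioc_subset_Ioi_self le_rfl)
  have e2 : ∀ s ∈ Ioc 0 z, (√s * ‖ψ s‖) ^ 2 = s * ‖ψ s‖ ^ 2 := fun s hs => by
    rw [mul_pow, Real.sq_sqrt hs.1.le]
  have h := integral_mul_le_sqrt_mul_sqrt (μ := volume.restrict (Ioc 0 z)) (f := fun s => √s)
    (g := fun s => √s * ‖ψ s‖) Real.continuous_sqrt.aestronglyMeasurable
    (Real.continuous_sqrt.aestronglyMeasurable.mul hm'.norm)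
    (Eventually.of_forall fun s => Real.sqrt_nonneg s)
    (Eventually.of_forall fun s => by positivity)
    ((integrableOn_congr_fun (fun s hs => Real.sq_sqrt hs.1.le) measurableSet_Ioc).2
      continuous_id.integrableOn_Ioc)
    ((integrableOn_congr_fun e2 measurableSet_Ioc).2 (hi.mono_set Ioc_subset_Ioi_self))
  rw [e]
  refine h.trans ?_
  rw [e1, setIntegral_congr_fun measurableSet_Ioc e2]
  have h1 : √(z ^ 2 / 2) ≤ z := by
    rw [Real.sqrt_le_left hz]
    nlinarith
  have h2 : √(∫ s in Ioc 0 z, s * ‖ψ s‖ ^ 2) ≤ radialNorm ψ := by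
    refine Real.sqrt_le_sqrt (setIntegral_mono_set hi ?_ (Ioc_subset_Ioi_self.eventuallyLE))
    filter_upwards [ae_restrict_mem measurableSet_Ioi] with s hs
    have : (0 : ℝ) < s := hs
    positivity
  gcongr

theorem radialNorm_nonneg (f : ℝ → ℂ) : 0 ≤ radialNorm f := Real.sqrt_nonneg _

namespace RadialSolution

variable {a lam : ℝ} {u w ψ : ℝ → ℂ}

theorem hasDerivAt_u (h : RadialSolution a lam u w ψ) {z : ℝ} (hz : 0 < z) :
    HasDerivAt u (z⁻¹ • w z) z := by
  have hc : ContinuousOn (fun s : ℝ => s⁻¹ • w s) (Ioi 0) :=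
    (continuousOn_id.inv₀ fun s hs => ne_of_gt hs).smul h.cont_w
  have hsub : uIcc 1 z ⊆ Ioi 0 := fun s hs => lt_of_lt_of_le (lt_min one_pos hz) hs.1
  have h1 : HasDerivAt (fun z => u 1 + ∫ s in (1 : ℝ)..z, s⁻¹ • w s) (z⁻¹ • w z) z :=
    (intervalIntegral.integral_hasDerivAt_right ((hc.mono hsub).intervalIntegrable)
      (hc.stronglyMeasurableAtFilter isOpen_Ioi z hz)
      (hc.continuousAt (Ioi_mem_nhds hz))).const_add _
  refine h1.congr_of_eventuallyEq ?_
  filter_upwards [Ioi_mem_nhds hz] with s hs using h.u_eq s hs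

/-- The Wronskian of a solution with the growing homogeneous solution. -/
def wronskian (a lam : ℝ) (u w : ℝ → ℂ) (z : ℝ) : ℂ :=
  growing a lam z • w z - growingFlux a lam z • u z

theorem intervalIntegrable_source (h : RadialSolution a lam u w ψ) {x z : ℝ} (hx : 0 < x)
    (hz : 0 < z) : IntervalIntegrable (fun s => s • ψ s) volume x z := by
  refine (intervalIntegrable_iff).2 ((integrableOn_smul_of_radial h.meas_ψ h.int_ψ (max x z)).mono_set ?_)
  exact fun s hs => ⟨(lt_min hx hz).trans hs.1, hs.2⟩

/-- Both `u` and the growing solution satisfy the equation with the same `lam`, so only the source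
survives in the derivative of the Wronskian. -/
theorem wronskian_sub (h : RadialSolution a lam u w ψ) (ha : 0 < a) {x z : ℝ} (hx : 0 < x)
    (hxz : x ≤ z) :
    wronskian a lam u w z - wronskian a lam u w x
      = -∫ s in x..z, growing a lam s • (s • ψ s) := by
  have hz : 0 < z := hx.trans_le hxz
  have hpos : ∀ s ∈ Icc x z, 0 < s := fun s hs => hx.trans_le hs.1
  -- As `ψ` is merely square integrable, `w` need not be differentiable everywhere. The sum `w + S`
  -- is, and `S` is removed afterwards by integration by parts against a primitive.
  set S : ℝ → ℂ := fun s => ∫ t in x..s, t • ψ t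
  set g : ℝ → ℂ := fun s => (lam * s ^ (a - 1)) • u s
  have hg : ContinuousOn g (Ioi 0) :=
    (continuousOn_const.mul (continuousOn_id.rpow_const fun s hs => Or.inl (ne_of_gt hs))).smul h.cont_u
  have hgi : ∀ s t, 0 < s → 0 < t → IntervalIntegrable g volume s t := fun s t hs ht =>
    (hg.mono fun r hr => lt_of_lt_of_le (lt_min hs ht) hr.1).intervalIntegrable
  have hw : ∀ s, 0 < s → w s + S s = w x + ∫ t in x..s, g t := by
    intro s hs
    have e := intervalIntegral.integral_add_adjacent_intervals
      ((hgi 1 x one_pos hx).sub (h.intervalIntegrable_source one_pos hx))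
      ((hgi x s hx hs).sub (h.intervalIntegrable_source hx hs))
    rw [h.w_eq s hs, h.w_eq x hx, ← e,
      intervalIntegral.integral_sub (hgi x s hx hs) (h.intervalIntegrable_source hx hs)]
    simp only [S]
    ring
  have hd1 : ∀ s ∈ Icc x z, HasDerivAt (fun s => w s + S s) (g s) s := by
    intro s hs
    have hs0 := hpos s hs
    have h1 : HasDerivAt (fun s => w x + ∫ t in x..s, g t) (g s) s :=
      (intervalIntegral.integral_hasDerivAt_right (hgi x s hx hs0)
        (hg.stronglyMeasurableAtFilter isOpen_Ioi s hs0)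
        (hg.continuousAt (Ioi_mem_nhds hs0))).const_add _
    refine h1.congr_of_eventuallyEq ?_
    filter_upwards [Ioi_mem_nhds hs0] with t ht using hw t ht
  have hd : ∀ s ∈ Icc x z, HasDerivAt
      (fun s => growing a lam s • (w s + S s) - growingFlux a lam s • u s)
      ((growingFlux a lam s / s) • S s) s := by
    intro s hs
    have hs0 := hpos s hs
    have := ((hasDerivAt_growing (lam := lam) ha hs0).smul (hd1 s hs)).sub
      ((hasDerivAt_growingFlux (lam := lam) ha hs0).smul (h.hasDerivAt_u hs0))
    refine this.congr_deriv ?_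
    simp only [g, Complex.real_smul]
    push_cast
    field_simp
    ring
  have hcS : ContinuousOn (fun s => (growingFlux a lam s / s) • S s) (Icc x z) := by
    refine ContinuousOn.smul ((continuous_growingFlux ha).continuousOn.div continuousOn_id
      fun s hs => (hpos s hs).ne') ?_
    have := intervalIntegral.continuousOn_primitive_interval'
      (h.intervalIntegrable_source hx hz) (left_mem_uIcc)
    rwa [uIcc_of_le hxz] at this
  have hftc := intervalIntegral.integral_eq_sub_of_hasDerivAt (a := x) (b := z)
    (by rwa [uIcc_of_le hxz]) (hcS.intervalIntegrable_of_Icc hxz)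
  have hibp := integral_deriv_smul_primitive hxz (φ := growing a lam)
    (φ' := fun s => growingFlux a lam s / s) (g := fun s => s • ψ s)
    (fun s hs => hasDerivAt_growing ha (hpos s hs))
    ((continuous_growingFlux ha).continuousOn.div continuousOn_id fun s hs => (hpos s hs).ne')
    ((intervalIntegrable_iff_integrableOn_Ioc_of_le hxz).1 (h.intervalIntegrable_source hx hz))
  have hS0 : S x = 0 := by simp [S]
  rw [hibp] at hftc
  have hSz : (∫ t in x..z, t • ψ t) = S z := rfl
  rw [hSz, hS0] at hftc
  simp only [wronskian]
  simp only [smul_add, add_zero, Complex.real_smul] at hftc ⊢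
  linear_combination -hftc

/-- Otherwise the integrable function `s⁻¹ ‖w‖ ^ 2` would dominate a positive multiple of `s⁻¹` near
0. No limit of `w` at 0 is needed: points with small `w` arbitrarily close to 0 suffice for the
Wronskian. -/
theorem exists_norm_w_lt (h : RadialSolution a lam u w ψ) {ε δ : ℝ} (hε : 0 < ε) (hδ : 0 < δ) :
    ∃ x, 0 < x ∧ x < δ ∧ ‖w x‖ < ε := by
  by_contra! hc
  have h1 : IntegrableOn (fun s : ℝ => s⁻¹) (Ioo 0 δ) := by
    refine ((h.int_w.mono_set Ioo_subset_Ioi_self).const_mul ((ε ^ 2)⁻¹)).mono'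
      measurable_inv.aestronglyMeasurable ?_
    filter_upwards [ae_restrict_mem measurableSet_Ioo] with s hs
    have h2 := hc s hs.1 hs.2
    have hs0 : 0 < s⁻¹ := inv_pos.2 hs.1
    rw [Real.norm_of_nonneg hs0.le]
    have : 1 ≤ (ε ^ 2)⁻¹ * ‖w s‖ ^ 2 := by
      rw [inv_mul_eq_div, one_le_div (by positivity)]
      gcongr
    nlinarith
  have h2 : IntegrableOn (fun s : ℝ => s⁻¹) (Ioc 0 δ) := by
    rwa [integrableOn_Ioc_iff_integrableOn_Ioo]
  have h3 := (intervalIntegrable_iff_integrableOn_Ioc_of_le hδ.le).2 h2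
  rw [intervalIntegrable_inv_iff] at h3
  rcases h3 with h3 | h3
  · exact hδ.ne h3
  · exact h3 left_mem_uIcc

/-- The Wronskian is small at suitable points near 0: the term with `w` by `exists_norm_w_lt`, the
term with `u` because the flux is `O(z ^ a)` and `u` grows at most logarithmically. From there
`wronskian_sub` is integrated, with the growing solution bounded by its value at `z`. -/
theorem norm_wronskian_le (h : RadialSolution a lam u w ψ) (ha : 0 < a) (hlam : 0 ≤ lam) {z : ℝ}
    (hz : 0 < z) : ‖wronskian a lam u w z‖ ≤ growing a lam z * (z * radialNorm ψ) := by
  have hq : Tendsto (fun x => growingFlux a lam x * ‖u x‖) (𝓝[>] 0) (𝓝 0) := by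
    have h1 : Tendsto (fun x : ℝ => lam / a * besselSeries 1 (lam * x ^ a / a ^ 2)) (𝓝[>] 0)
        (𝓝 (lam / a * besselSeries 1 (lam * 0 ^ a / a ^ 2))) :=
      Tendsto.mono_left (Continuous.tendsto (continuous_const.mul ((continuous_besselSeries 1).comp
        ((continuous_const.mul (Real.continuous_rpow_const ha.le)).div_const _))) 0)
        nhdsWithin_le_nhds
    have h2 := h1.mul (tendsto_rpow_mul_norm_of_eq_integral h.u_eq h.int_w ha)
    rw [mul_zero] at h2
    refine h2.congr fun x => ?_
    rw [growingFlux_eq ha]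
    ring
  refine le_of_forall_pos_le_add fun ε hε => ?_
  have hp1 : 0 < growing a lam z := lt_of_lt_of_le one_pos (one_le_growing hlam hz.le)
  obtain ⟨δ, hδ, hδq⟩ := mem_nhdsGT_iff_exists_Ioo_subset.1
    (hq.eventually (gt_mem_nhds (half_pos hε)))
  -- The point is taken below `z`, so that `p(x) ≤ p(z)` and the term `p(x) w(x)` is at most `ε /
  -- 2`.
  obtain ⟨x, hx0, hxδ, hwx⟩ := h.exists_norm_w_lt (ε := ε / 2 / growing a lam z)
    (δ := min δ z) (by positivity) (lt_min hδ hz)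
  have hxz : x ≤ z := (hxδ.trans_le (min_le_right _ _)).le
  have hx1 : growingFlux a lam x * ‖u x‖ < ε / 2 := hδq ⟨hx0, hxδ.trans_le (min_le_left _ _)⟩
  have hN := h.wronskian_sub ha hx0 hxz
  have hNx : ‖wronskian a lam u w x‖ ≤ ε := by
    have hpx : growing a lam x ≤ growing a lam z := growing_mono ha hlam hx0.le hxz
    have hpx0 : 0 ≤ growing a lam x := zero_le_one.trans (one_le_growing hlam hx0.le)
    refine (norm_sub_le _ _).trans ?_
    rw [norm_smul, norm_smul, Real.norm_of_nonneg hpx0,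
      Real.norm_of_nonneg (growingFlux_nonneg ha hlam hx0.le)]
    have : growing a lam x * ‖w x‖ ≤ growing a lam z * (ε / 2 / growing a lam z) := by gcongr
    rw [mul_div_cancel₀ _ hp1.ne'] at this
    linarith
  have hI : ‖∫ s in x..z, growing a lam s • (s • ψ s)‖ ≤ growing a lam z * (z * radialNorm ψ) := by
    have hi : IntegrableOn (fun s => ‖s • ψ s‖) (Ioc 0 z) :=
      (integrableOn_smul_of_radial h.meas_ψ h.int_ψ z).norm
    calc ‖∫ s in x..z, growing a lam s • (s • ψ s)‖
        ≤ ∫ s in x..z, growing a lam z * ‖s • ψ s‖ := by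
          refine intervalIntegral.norm_integral_le_of_norm_le hxz
            (Eventually.of_forall fun s hs => ?_) ?_
          · rw [norm_smul, Real.norm_of_nonneg
              (zero_le_one.trans (one_le_growing hlam (hx0.trans hs.1).le))]
            gcongr
            exact growing_mono ha hlam (hx0.trans hs.1).le hs.2
          · exact ((intervalIntegrable_iff_integrableOn_Ioc_of_le hxz).2
              (hi.mono_set (Ioc_subset_Ioc_left hx0.le))).const_mul _
      _ = growing a lam z * ∫ s in Ioc x z, ‖s • ψ s‖ := by
          rw [intervalIntegral.integral_const_mul, intervalIntegral.integral_of_le hxz]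
      _ ≤ growing a lam z * ∫ s in Ioc 0 z, ‖s • ψ s‖ := by
          refine mul_le_mul_of_nonneg_left ?_ hp1.le
          exact setIntegral_mono_set hi (Eventually.of_forall fun s => norm_nonneg _)
            (Ioc_subset_Ioc_left hx0.le).eventuallyLE
      _ ≤ _ := by
          gcongr
          exact integral_norm_smul_le_radialNorm h.meas_ψ h.int_ψ hz.le
  have e : wronskian a lam u w z
      = wronskian a lam u w x - ∫ s in x..z, growing a lam s • (s • ψ s) := by
    linear_combination hN
  rw [e]
  exact (norm_sub_le _ _).trans (by linarith)

/-- Dividing by the growing solution removes the term with `lam`: `(u / p)' = N / (z p ^ 2)`, and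
`norm_wronskian_le` bounds this by `‖ψ‖ / p`. -/
theorem norm_div_growing_sub_le (h : RadialSolution a lam u w ψ) (ha : 0 < a) (hlam : 0 ≤ lam)
    {x z : ℝ} (hx : 0 < x) (hxz : x ≤ z) :
    ‖(growing a lam z)⁻¹ • u z - (growing a lam x)⁻¹ • u x‖
      ≤ radialNorm ψ * ∫ s in x..z, (growing a lam s)⁻¹ := by
  have hpos : ∀ s ∈ Icc x z, 0 < s := fun s hs => hx.trans_le hs.1
  have hp : ∀ s ∈ Icc x z, 0 < growing a lam s := fun s hs =>
    lt_of_lt_of_le one_pos (one_le_growing hlam (hpos s hs).le)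
  have hd : ∀ s ∈ Icc x z, HasDerivAt (fun s => (growing a lam s)⁻¹ • u s)
      ((s * growing a lam s ^ 2)⁻¹ • wronskian a lam u w s) s := by
    intro s hs
    have hs0 := hpos s hs
    have hps : (growing a lam s : ℂ) ≠ 0 := by exact_mod_cast (hp s hs).ne'
    have hsc : (s : ℂ) ≠ 0 := by exact_mod_cast hs0.ne'
    have := ((hasDerivAt_growing (lam := lam) ha hs0).inv (hp s hs).ne').smul (h.hasDerivAt_u hs0)
    refine this.congr_deriv ?_
    simp only [wronskian, Complex.real_smul, Pi.inv_apply]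
    push_cast
    field_simp
    ring
  have hcp : ContinuousOn (fun s => (growing a lam s)⁻¹) (Icc x z) :=
    (continuous_growing ha).continuousOn.inv₀ fun s hs => (hp s hs).ne'
  have hc : ContinuousOn (fun s => (s * growing a lam s ^ 2)⁻¹ • wronskian a lam u w s) (Icc x z) := by
    refine ContinuousOn.smul ((continuousOn_id.mul ((continuous_growing ha).continuousOn.pow 2)).inv₀
      fun s hs => ?_) (((continuous_growing ha).continuousOn.smul (h.cont_w.mono hpos)).sub
        ((continuous_growingFlux ha).continuousOn.smul (h.cont_u.mono hpos)))
    exact (mul_pos (hpos s hs) (pow_pos (hp s hs) 2)).ne'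
  rw [← intervalIntegral.integral_eq_sub_of_hasDerivAt (a := x) (b := z)
    (f := fun s => (growing a lam s)⁻¹ • u s) (by rwa [uIcc_of_le hxz]) (hc.intervalIntegrable_of_Icc hxz), ← intervalIntegral.integral_const_mul]
  refine intervalIntegral.norm_integral_le_of_norm_le hxz (Eventually.of_forall fun s hs => ?_)
    ((hcp.intervalIntegrable_of_Icc hxz).const_mul _)
  have hs' := Ioc_subset_Icc_self hs
  have hs0 := hpos s hs'
  have hps := hp s hs'
  rw [norm_smul, norm_inv, Real.norm_of_nonneg (by positivity)]
  calc _ ≤ (s * growing a lam s ^ 2)⁻¹ * (growing a lam s * (s * radialNorm ψ)) := by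
        gcongr
        exact h.norm_wronskian_le ha hlam hs0
    _ = _ := by field_simp

/-- The minimum over an interval of length one is at most the quadratic mean there, and on that
interval the weight `s` is at least 1. -/
theorem exists_norm_le_radialNorm (h : RadialSolution a lam u w ψ) {b : ℝ} (hb : 0 < b) :
    ∃ z₁ ∈ Icc (b + 1) (b + 2), ‖u z₁‖ ≤ radialNorm u := by
  have hsub : Icc (b + 1) (b + 2) ⊆ Ioi 0 := fun s hs => by
    have := hs.1
    simp only [mem_Ioi]; linarith
  obtain ⟨z₁, hz₁, hmin⟩ := isCompact_Icc.exists_isMinOn (nonempty_Icc.2 (by linarith))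
    ((h.cont_u.mono hsub).norm)
  refine ⟨z₁, hz₁, Real.le_sqrt_of_sq_le ?_⟩
  calc ‖u z₁‖ ^ 2 = ∫ s in Icc (b + 1) (b + 2), ‖u z₁‖ ^ 2 := by
        simp [integral_const]
        norm_num
    _ ≤ ∫ s in Icc (b + 1) (b + 2), s * ‖u s‖ ^ 2 := by
        refine setIntegral_mono_on (integrableOn_const (by simp)) (h.int_u.mono_set hsub)
          measurableSet_Icc fun s hs => ?_
        have h1 : ‖u z₁‖ ≤ ‖u s‖ := hmin hs
        have h2 : ‖u z₁‖ ^ 2 ≤ ‖u s‖ ^ 2 := by gcongr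
        have h3 : 1 ≤ s := by linarith [hs.1]
        nlinarith [sq_nonneg ‖u s‖]
    _ ≤ _ := by
        refine setIntegral_mono_set h.int_u ?_ hsub.eventuallyLE
        filter_upwards [ae_restrict_mem measurableSet_Ioi] with s hs
        have : (0 : ℝ) < s := hs
        positivity

/-- The basic estimate for `u`, uniform in `lam`. -/
theorem exists_norm_le (h : RadialSolution a lam u w ψ) (ha : 0 < a) (hlam : 0 ≤ lam) {b : ℝ}
    (hb : 0 < b) : ∃ z₁ ∈ Icc (b + 1) (b + 2), ∀ z, 0 < z → z ≤ b →
      ‖(growing a lam z)⁻¹ • u z‖ ≤ radialNorm u * (growing a lam z₁)⁻¹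
        + radialNorm ψ * ∫ s in z..z₁, (growing a lam s)⁻¹ := by
  obtain ⟨z₁, hz₁, hu⟩ := h.exists_norm_le_radialNorm hb
  refine ⟨z₁, hz₁, fun z hz hzb => ?_⟩
  have hp : 0 < growing a lam z₁ := lt_of_lt_of_le one_pos (one_le_growing hlam (by linarith [hz₁.1]))
  have h1 := h.norm_div_growing_sub_le ha hlam hz (show z ≤ z₁ by linarith [hz₁.1])
  have h2 : ‖(growing a lam z₁)⁻¹ • u z₁‖ ≤ radialNorm u * (growing a lam z₁)⁻¹ := by
    rw [norm_smul, Real.norm_of_nonneg (by positivity), mul_comm]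
    gcongr
  have h3 := norm_sub_norm_le ((growing a lam z)⁻¹ • u z) ((growing a lam z₁)⁻¹ • u z₁)
  rw [norm_sub_rev] at h3
  linarith

/-- By monotonicity `1 / p(z₁)` and the integrand `1 / p(s)` are at most `1 / p(z)`, so the factor
`1 / p(z)` on the left of the basic estimate cancels; the interval of integration has length at most
`b + 2`. -/
theorem norm_u_le (h : RadialSolution a lam u w ψ) (ha : 0 < a) (hlam : 0 ≤ lam) {b : ℝ}
    (hb : 0 < b) {z : ℝ} (hz : 0 < z) (hzb : z ≤ b) :
    ‖u z‖ ≤ (b + 2) * (radialNorm ψ + radialNorm u) := by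
  obtain ⟨z₁, hz₁, H⟩ := h.exists_norm_le ha hlam hb
  have h1 := H z hz hzb
  have hp : 0 < growing a lam z := lt_of_lt_of_le one_pos (one_le_growing hlam hz.le)
  have hz1z : z ≤ z₁ := by linarith [hz₁.1]
  have hp₁ : 0 < growing a lam z₁ := hp.trans_le (growing_mono ha hlam hz.le hz1z)
  have hI : ∫ s in z..z₁, (growing a lam s)⁻¹ ≤ (b + 2) * (growing a lam z)⁻¹ := by
    have : ∫ s in z..z₁, (growing a lam s)⁻¹ ≤ ∫ s in z..z₁, (growing a lam z)⁻¹ := by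
      refine intervalIntegral.integral_mono_on hz1z ?_ (by simp) fun s hs => ?_
      · refine ContinuousOn.intervalIntegrable_of_Icc hz1z
          ((continuous_growing ha).continuousOn.inv₀ fun s hs => ?_)
        exact (hp.trans_le (growing_mono ha hlam hz.le hs.1)).ne'
      · gcongr
        exact growing_mono ha hlam hz.le hs.1
    refine this.trans ?_
    rw [intervalIntegral.integral_const, smul_eq_mul]
    gcongr
    linarith [hz₁.2]
  have hinv : (growing a lam z₁)⁻¹ ≤ (growing a lam z)⁻¹ := by
    gcongr
    exact growing_mono ha hlam hz.le hz1z
  rw [norm_smul, Real.norm_of_nonneg (by positivity)] at h1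
  have hY := radialNorm_nonneg ψ
  have hK := radialNorm_nonneg u
  have h2 : (growing a lam z)⁻¹ * ‖u z‖
      ≤ (growing a lam z)⁻¹ * ((b + 2) * (radialNorm ψ + radialNorm u)) := by
    calc _ ≤ radialNorm u * (growing a lam z)⁻¹ + radialNorm ψ * ((b + 2) * (growing a lam z)⁻¹) := by
          refine h1.trans ?_
          gcongr
      _ = (growing a lam z)⁻¹ * (radialNorm u + (b + 2) * radialNorm ψ) := by ring
      _ ≤ _ := by
          gcongr
          nlinarith
  exact le_of_mul_le_mul_left h2 (inv_pos.2 hp)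

/-- The definition of `wronskian` solved for `w`, with the factor `z ^ a` of the flux cancelled. The
first summand is an error of order `z ^ (1 - a)`, the second carries the boundary value of `u`. -/
theorem rpow_smul_w_eq (ha : 0 < a) (hlam : 0 ≤ lam) {z : ℝ} (hz : 0 < z) (u w : ℝ → ℂ) :
    z ^ (-a) • w z = z ^ (-a) • ((growing a lam z)⁻¹ • wronskian a lam u w z)
      + (lam / a * besselSeries 1 (lam * z ^ a / a ^ 2)) • ((growing a lam z)⁻¹ • u z) := by
  have hp : (growing a lam z : ℂ) ≠ 0 := by
    exact_mod_cast (lt_of_lt_of_le one_pos (one_le_growing hlam hz.le)).ne'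
  have hza : ((z ^ a : ℝ) : ℂ) ≠ 0 := by exact_mod_cast (Real.rpow_pos_of_pos hz a).ne'
  simp only [wronskian, growingFlux_eq ha, Real.rpow_neg hz.le, Complex.real_smul]
  push_cast
  field_simp
  ring

/-- The constant in the estimate of the weighted normal derivative. -/
def fluxConst (a b : ℝ) : ℝ := b ^ (1 - a) + a / ((b + 1) ^ a - b ^ a) + 2 * (b + 2) ^ (1 - a)

theorem fluxConst_pos (ha : 0 < a) {b : ℝ} (hb : 0 < b) : 0 < fluxConst a b := by
  have hδ : 0 < (b + 1) ^ a - b ^ a := sub_pos.2 (Real.rpow_lt_rpow hb.le (by linarith) ha)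
  have h1 := Real.rpow_pos_of_pos hb (1 - a)
  have h2 := Real.rpow_pos_of_pos (show 0 < b + 2 by linarith) (1 - a)
  rw [fluxConst]
  positivity

theorem norm_rpow_smul_wronskian_le (h : RadialSolution a lam u w ψ) (ha : 0 < a)
    (hlam : 0 ≤ lam) {z : ℝ} (hz : 0 < z) :
    ‖z ^ (-a) • ((growing a lam z)⁻¹ • wronskian a lam u w z)‖ ≤ z ^ (1 - a) * radialNorm ψ := by
  have hp : 0 < growing a lam z := lt_of_lt_of_le one_pos (one_le_growing hlam hz.le)
  have hza := Real.rpow_pos_of_pos hz (-a)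
  rw [norm_smul, norm_smul, Real.norm_of_nonneg hza.le, norm_inv, Real.norm_of_nonneg hp.le]
  calc _ ≤ z ^ (-a) * ((growing a lam z)⁻¹ * (growing a lam z * (z * radialNorm ψ))) := by
        gcongr
        exact h.norm_wronskian_le ha hlam hz
    _ = _ := by
      rw [sub_eq_neg_add, Real.rpow_add_one hz.ne']
      field_simp

/-- Besides the Wronskian term, `rpow_smul_w_eq` contains `lam` times the basic estimate for `u /
p`. Its part coming from `z₁` is controlled by `lam_mul_besselSeries_div_growing_le`, its part
coming from `ψ` by `lam_mul_besselSeries_mul_integral_le`. The three summands of `fluxConst` belong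
to these three contributions, in this order. -/
theorem norm_rpow_smul_w_le (h : RadialSolution a lam u w ψ) (ha : 0 < a) (ha1 : a ≤ 1)
    (hlam : 0 ≤ lam) {b : ℝ} (hb : 0 < b) {z : ℝ} (hz : 0 < z) (hzb : z ≤ b) :
    ‖z ^ (-a) • w z‖ ≤ fluxConst a b * (radialNorm ψ + radialNorm u) := by
  obtain ⟨z₁, hz₁, H⟩ := h.exists_norm_le ha hlam hb
  have h1 := H z hz hzb
  have hz1z : z ≤ z₁ := by linarith [hz₁.1]
  have hY := radialNorm_nonneg ψ
  have hK := radialNorm_nonneg u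
  have hQ := besselSeries_pos 1 (radius_nonneg (a := a) hlam hz.le)
  have hN := h.norm_rpow_smul_wronskian_le ha hlam hz
  have hT1 := lam_mul_besselSeries_div_growing_le ha hlam hz.le hzb hz₁.1
  have hT2 := lam_mul_besselSeries_mul_integral_le ha ha1 hlam hz hz1z
  rw [rpow_smul_w_eq ha hlam hz u w]
  refine (norm_add_le _ _).trans ?_
  have h2 : ‖(lam / a * besselSeries 1 (lam * z ^ a / a ^ 2)) • ((growing a lam z)⁻¹ • u z)‖
      ≤ a / ((b + 1) ^ a - b ^ a) * radialNorm u + 2 * (b + 2) ^ (1 - a) * radialNorm ψ := by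
    rw [norm_smul, Real.norm_of_nonneg (by positivity)]
    have h3 : z₁ ^ (1 - a) ≤ (b + 2) ^ (1 - a) :=
      Real.rpow_le_rpow (by linarith) hz₁.2 (by linarith)
    calc _ ≤ lam / a * besselSeries 1 (lam * z ^ a / a ^ 2) * (radialNorm u * (growing a lam z₁)⁻¹
          + radialNorm ψ * ∫ s in z..z₁, (growing a lam s)⁻¹) := by gcongr
      _ = a⁻¹ * (lam * besselSeries 1 (lam * z ^ a / a ^ 2) / growing a lam z₁) * radialNorm u
          + a⁻¹ * (lam * besselSeries 1 (lam * z ^ a / a ^ 2) *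
            ∫ s in z..z₁, (growing a lam s)⁻¹) * radialNorm ψ := by
          field_simp
      _ ≤ a⁻¹ * (a ^ 2 / ((b + 1) ^ a - b ^ a)) * radialNorm u
          + a⁻¹ * (2 * a * (b + 2) ^ (1 - a)) * radialNorm ψ := by
          have h7 := hT2.trans (mul_le_mul_of_nonneg_left h3 (by positivity : 0 ≤ 2 * a))
          have ha' : 0 ≤ a⁻¹ := by positivity
          exact add_le_add
            (mul_le_mul_of_nonneg_right (mul_le_mul_of_nonneg_left hT1 ha') hK)
            (mul_le_mul_of_nonneg_right (mul_le_mul_of_nonneg_left h7 ha') hY)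
      _ = _ := by field_simp
  have h4 : z ^ (1 - a) ≤ b ^ (1 - a) := Real.rpow_le_rpow hz.le hzb (by linarith)
  have h5 : 0 ≤ b ^ (1 - a) := Real.rpow_nonneg hb.le _
  have h6 : 0 ≤ (b + 2) ^ (1 - a) := Real.rpow_nonneg (by linarith) _
  have h7 : 0 < (b + 1) ^ a - b ^ a := sub_pos.2 (Real.rpow_lt_rpow hb.le (by linarith) ha)
  have h8 : 0 ≤ a / ((b + 1) ^ a - b ^ a) := by positivity
  rw [fluxConst]
  nlinarith [mul_nonneg h5 hK, mul_nonneg h6 hK, mul_nonneg h8 hY, mul_le_mul_of_nonneg_right h4 hY]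

/-- As `1 / p ≤ 1`, the quotient `u / p` is Lipschitz near 0 by `norm_div_growing_sub_le`, hence
Cauchy, and `p` is continuous and positive at 0. -/
theorem exists_tendsto_u (h : RadialSolution a lam u w ψ) (ha : 0 < a) (hlam : 0 ≤ lam) :
    ∃ u₀, Tendsto u (𝓝[>] 0) (𝓝 u₀) := by
  have hY := radialNorm_nonneg ψ
  have hcauchy : Cauchy (map (fun z => (growing a lam z)⁻¹ • u z) (𝓝[>] 0)) := by
    have hle : ∀ x z, 0 < x → x ≤ z → ‖(growing a lam z)⁻¹ • u z - (growing a lam x)⁻¹ • u x‖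
        ≤ radialNorm ψ * z := by
      intro x z hx hxz
      refine (h.norm_div_growing_sub_le ha hlam hx hxz).trans ?_
      gcongr
      have : ∫ s in x..z, (growing a lam s)⁻¹ ≤ ∫ s in x..z, (1 : ℝ) := by
        refine intervalIntegral.integral_mono_on hxz ?_ (by simp) fun s hs => ?_
        · refine ContinuousOn.intervalIntegrable_of_Icc hxz
            ((continuous_growing ha).continuousOn.inv₀ fun s hs => ?_)
          exact (lt_of_lt_of_le one_pos (one_le_growing hlam (hx.le.trans hs.1))).ne'
        · exact inv_le_one_of_one_le₀ (one_le_growing hlam (hx.le.trans hs.1))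
      refine this.trans ?_
      simp
      linarith
    rw [Metric.cauchy_iff]
    refine ⟨map_neBot, fun ε hε => ?_⟩
    set δ := ε / (radialNorm ψ + 1)
    have hδ : 0 < δ := by positivity
    refine ⟨_, image_mem_map (Ioo_mem_nhdsGT hδ), ?_⟩
    have hlt : ∀ z, z < δ → radialNorm ψ * z < ε := by
      intro z hz
      have h1 : δ * (radialNorm ψ + 1) = ε := by simp only [δ]; field_simp
      nlinarith
    rintro _ ⟨x, hx, rfl⟩ _ ⟨z, hz, rfl⟩
    rcases le_total x z with hxz | hxz
    · rw [dist_comm, dist_eq_norm]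
      exact (hle x z hx.1 hxz).trans_lt (hlt z hz.2)
    · rw [dist_eq_norm]
      exact (hle z x hz.1 hxz).trans_lt (hlt x hx.2)
  obtain ⟨u₀, hu₀⟩ := CompleteSpace.complete hcauchy
  have hp : Tendsto (growing a lam) (𝓝[>] 0) (𝓝 (growing a lam 0)) :=
    ((continuous_growing ha).tendsto 0).mono_left nhdsWithin_le_nhds
  refine ⟨growing a lam 0 • u₀, (hp.smul (show Tendsto _ _ _ from hu₀)).congr' ?_⟩
  filter_upwards [self_mem_nhdsWithin] with z hz
  exact smul_inv_smul₀ (lt_of_lt_of_le one_pos (one_le_growing hlam (le_of_lt hz))).ne' _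

/-- In `rpow_smul_w_eq` the Wronskian term is `O(z ^ (1 - a))`, which vanishes because `a < 1`, and
`besselSeries 0` and `besselSeries 1` both equal 1 at the origin. -/
theorem tendsto_rpow_smul_w (h : RadialSolution a lam u w ψ) (ha : 0 < a) (ha1 : a < 1)
    (hlam : 0 ≤ lam) {u₀ : ℂ} (hu : Tendsto u (𝓝[>] 0) (𝓝 u₀)) :
    Tendsto (fun z : ℝ => z ^ (-a) • w z) (𝓝[>] 0) (𝓝 ((lam / a) • u₀)) := by
  have hr : Tendsto (fun z : ℝ => lam * z ^ a / a ^ 2) (𝓝[>] 0) (𝓝 0) := by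
    have : Continuous fun z : ℝ => lam * z ^ a / a ^ 2 :=
      (continuous_const.mul (Real.continuous_rpow_const ha.le)).div_const _
    have := this.tendsto 0
    rw [Real.zero_rpow ha.ne', mul_zero, zero_div] at this
    exact this.mono_left nhdsWithin_le_nhds
  have h1 : Tendsto (fun z : ℝ => z ^ (-a) • ((growing a lam z)⁻¹ • wronskian a lam u w z))
      (𝓝[>] 0) (𝓝 0) := by
    have h2 : Tendsto (fun z : ℝ => z ^ (1 - a) * radialNorm ψ) (𝓝[>] 0) (𝓝 0) := by
      have := (Real.continuous_rpow_const (sub_nonneg.2 ha1.le)).tendsto 0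
      rw [Real.zero_rpow (sub_pos.2 ha1).ne'] at this
      simpa using (this.mono_left nhdsWithin_le_nhds).mul_const (radialNorm ψ)
    refine squeeze_zero_norm' ?_ h2
    filter_upwards [self_mem_nhdsWithin] with z hz using h.norm_rpow_smul_wronskian_le ha hlam hz
  have hQ := ((continuous_besselSeries 1).tendsto 0).comp hr
  have hP := ((continuous_besselSeries 0).tendsto 0).comp hr
  rw [besselSeries_zero_right] at hQ hP
  have h3 := h1.add ((hQ.const_mul (lam / a)).smul ((hP.inv₀ (by norm_num)).smul hu))
  simp only [Nat.factorial, Nat.cast_one, div_one, inv_one, one_smul, mul_one, zero_add] at h3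
  refine (h3.congr' ?_)
  filter_upwards [self_mem_nhdsWithin] with z hz
  exact (rpow_smul_w_eq ha hlam hz u w).symm

/-- The limit `z → 0` in the basic estimate with `b = 1`, multiplied by `lam ^ (1 / a)`. The
integral of `1 / p` has exactly the decay that compensates this factor. -/
theorem rpow_mul_norm_limit_le (h : RadialSolution a lam u w ψ) (ha : 1 / 2 ≤ a) (ha1 : a ≤ 1)
    (hlam : 0 ≤ lam) {u₀ : ℂ} (hu : Tendsto u (𝓝[>] 0) (𝓝 u₀)) :
    lam ^ (1 / a) * ‖u₀‖ ≤ 1152 * Real.pi * (radialNorm ψ + radialNorm u) := by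
  have ha0 : 0 < a := by linarith
  have hY := radialNorm_nonneg ψ
  have hK := radialNorm_nonneg u
  obtain ⟨z₁, hz₁, H⟩ := h.exists_norm_le ha0 hlam one_pos
  have hp : Tendsto (fun z => lam ^ (1 / a) * ‖(growing a lam z)⁻¹ • u z‖) (𝓝[>] 0)
      (𝓝 (lam ^ (1 / a) * ‖u₀‖)) := by
    have h1 : Tendsto (growing a lam) (𝓝[>] 0) (𝓝 (growing a lam 0)) :=
      ((continuous_growing ha0).tendsto 0).mono_left nhdsWithin_le_nhds
    have e : growing a lam 0 = 1 := by
      simp [growing, Real.zero_rpow ha0.ne', besselSeries_zero_right]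
    rw [e] at h1
    have := ((h1.inv₀ one_ne_zero).smul hu).norm.const_mul (lam ^ (1 / a))
    simpa using this
  refine le_of_tendsto hp ?_
  filter_upwards [Ioc_mem_nhdsGT one_pos] with z hz
  have hz1z : z ≤ z₁ := by linarith [hz₁.1, hz.2]
  have h2 := rpow_mul_integral_growing_le ha ha1 hlam hz.1 hz1z
  -- Since `1 / a ≤ 2`, one has `lam ^ (1 / a) ≤ 1 + lam ^ 2`, while `p(z₁)` is at least 1 and at
  -- least `lam ^ 2 / 4` by the term `k = 2`; thus `5 = 1 + 4`.
  have h3 : lam ^ (1 / a) * (growing a lam z₁)⁻¹ ≤ 5 := by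
    have hz₁1 : (1 : ℝ) ≤ z₁ := by linarith [hz₁.1]
    have hp1 : 1 ≤ growing a lam z₁ := one_le_growing hlam (by linarith)
    have hr : lam ≤ lam * z₁ ^ a / a ^ 2 := by
      have h4 : 1 ≤ z₁ ^ a := Real.one_le_rpow hz₁1 ha0.le
      have h5 : a ^ 2 ≤ 1 := pow_le_one₀ ha0.le ha1
      rw [le_div_iff₀ (by positivity)]
      nlinarith
    have hp2 : lam ^ 2 / 4 ≤ growing a lam z₁ := by
      refine le_trans ?_ (besselSeries_term_le 0 2 (radius_nonneg hlam (by linarith)))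
      have : lam ^ 2 ≤ (lam * z₁ ^ a / a ^ 2) ^ 2 := by gcongr
      norm_num [Nat.factorial]
      linarith
    have h6 : lam ^ (1 / a) ≤ 1 + lam ^ 2 := by
      rcases le_total lam 1 with hl | hl
      · have := Real.rpow_le_one hlam hl (show 0 ≤ 1 / a by positivity)
        nlinarith [sq_nonneg lam]
      · have : lam ^ (1 / a) ≤ lam ^ (2 : ℝ) := Real.rpow_le_rpow_of_exponent_le hl (by
          rw [div_le_iff₀ ha0]; linarith)
        rw [Real.rpow_two] at this
        linarith
    rw [← div_eq_mul_inv, div_le_iff₀ (by linarith)]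
    linarith
  have h7 := H z hz.1 hz.2
  have hl := Real.rpow_nonneg hlam (1 / a)
  calc _ ≤ lam ^ (1 / a) * (radialNorm u * (growing a lam z₁)⁻¹
        + radialNorm ψ * ∫ s in z..z₁, (growing a lam s)⁻¹) := by gcongr
    _ = (lam ^ (1 / a) * (growing a lam z₁)⁻¹) * radialNorm u
        + (lam ^ (1 / a) * ∫ s in z..z₁, (growing a lam s)⁻¹) * radialNorm ψ := by ring
    _ ≤ 5 * radialNorm u + 1152 * Real.pi * radialNorm ψ := by gcongr
    _ ≤ _ := by nlinarith [Real.pi_gt_three]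

end RadialSolution

end TaubWave
end

/-! ### Functions on `ℝⁿ × ℝ` as `L²(ℝⁿ)`-valued functions of `z` -/

noncomputable section
namespace TaubWave

open scoped ENNReal

/-- In a second countable space an open set is a countable union of balls, and the preimages of
balls are measurable by assumption. -/
theorem measurable_of_measurable_edist {α β : Type*} [MeasurableSpace α] [PseudoEMetricSpace β]
    [SecondCountableTopology β] [MeasurableSpace β] [BorelSpace β] {f : α → β}
    (h : ∀ c, Measurable fun z => edist (f z) c) : Measurable f := by
  refine measurable_of_isOpen fun U hU => ?_
  choose! ε hε hεU using fun x (hx : x ∈ U) => EMetric.isOpen_iff.1 hU x hx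
  obtain ⟨T, hT, hTU⟩ := TopologicalSpace.isOpen_iUnion_countable
    (fun x : U => Metric.eball (x : β) (ε x)) fun x => Metric.isOpen_eball
  have e : U = ⋃ x ∈ T, Metric.eball ((x : U) : β) (ε x) := by
    rw [hTU]
    ext y
    simp only [mem_iUnion]
    exact ⟨fun hy => ⟨⟨y, hy⟩, Metric.mem_eball_self (hε y hy)⟩, fun ⟨x, hx⟩ => hεU x x.2 hx⟩
  rw [e, preimage_iUnion₂]
  exact MeasurableSet.biUnion hT fun x _ => measurableSet_lt (h x) measurable_const

theorem eLpNorm_two_eq {α E : Type*} [MeasurableSpace α] {μ : Measure α} [NormedAddCommGroup E]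
    (f : α → E) : eLpNorm f 2 μ = (∫⁻ x, ‖f x‖ₑ ^ 2 ∂μ) ^ (1 / 2 : ℝ) := by
  simp [eLpNorm_eq_lintegral_rpow_enorm_toReal (p := 2) (by norm_num) (by norm_num)]

theorem enorm_sq_eq_lintegral {n : ℕ} (f : L2 n) : ‖f‖ₑ ^ 2 = ∫⁻ x, ‖f x‖ₑ ^ 2 := by
  rw [Lp.enorm_def, eLpNorm_two_eq, ← ENNReal.rpow_natCast, ← ENNReal.rpow_mul]
  norm_num

theorem memLp_two_iff_lintegral {α E : Type*} [MeasurableSpace α] {μ : Measure α}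
    [NormedAddCommGroup E] {f : α → E} :
    MemLp f 2 μ ↔ AEStronglyMeasurable f μ ∧ ∫⁻ x, ‖f x‖ₑ ^ 2 ∂μ < ⊤ := by
  rw [MemLp, eLpNorm_two_eq, ENNReal.rpow_lt_top_iff_of_pos (by norm_num)]

open Classical in
/-- The slice `f(·, z)` of a function on `ℝⁿ × ℝ` as an element of `L²(ℝⁿ)`. -/
def slice {n : ℕ} (f : Rn n × ℝ → ℂ) (z : ℝ) : L2 n :=
  if h : MemLp (fun x => f (x, z)) 2 volume then h.toLp _ else 0

variable {n : ℕ}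

instance fact_two_ne_top : Fact ((2 : ℝ≥0∞) ≠ ⊤) := ⟨by simp⟩

theorem coeFn_slice {f : Rn n × ℝ → ℂ} {z : ℝ} (h : MemLp (fun x => f (x, z)) 2 volume) :
    (slice f z : Rn n → ℂ) =ᵐ[volume] fun x => f (x, z) := by
  rw [slice, dif_pos h]
  exact h.coeFn_toLp

theorem slice_congr {f g : Rn n × ℝ → ℂ} {z : ℝ}
    (h : (fun x => f (x, z)) =ᵐ[volume] fun x => g (x, z)) : slice f z = slice g z := by
  by_cases hf : MemLp (fun x => f (x, z)) 2 volume
  · have hg := (memLp_congr_ae h).1 hf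
    rw [slice, slice, dif_pos hf, dif_pos hg, MemLp.toLp_eq_toLp_iff]
    exact h
  · have hg := fun h' => hf ((memLp_congr_ae h).2 h')
    rw [slice, slice, dif_neg hf, dif_neg hg]

theorem ae_ae_of_ae_prod_swap {τ : Measure ℝ} [SFinite τ] {p : Rn n × ℝ → Prop}
    (h : ∀ᵐ q ∂(volume.prod τ), p q) : ∀ᵐ z ∂τ, ∀ᵐ x ∂(volume : Measure (Rn n)), p (x, z) := by
  have : ∀ᵐ q ∂(τ.prod (volume : Measure (Rn n))), p q.swap :=
    Measure.measurePreserving_swap.quasiMeasurePreserving.ae h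
  exact Measure.ae_ae_of_ae_prod this

/-- The distance of a slice to a fixed element of `L²` is a power of a partial integral, measurable
in `z` by Tonelli. The slices outside `L²`, replaced by 0, occur on a measurable set of `z`. -/
theorem stronglyMeasurable_slice {f : Rn n × ℝ → ℂ} (hf : StronglyMeasurable f) :
    StronglyMeasurable (slice f) := by
  borelize (L2 n)
  have hm : ∀ z, StronglyMeasurable fun x => f (x, z) := fun z =>
    hf.comp_measurable measurable_prodMk_right
  refine (measurable_of_measurable_edist fun c => ?_).stronglyMeasurable
  have hI : ∀ g : Rn n → ℂ, StronglyMeasurable g →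
      Measurable fun z => eLpNorm (fun x => f (x, z) - g x) 2 volume := by
    intro g hg
    simp only [eLpNorm_two_eq]
    refine Measurable.pow_const ?_ _
    exact Measurable.lintegral_prod_left'
      ((hf.sub (hg.comp_measurable measurable_fst)).enorm.pow_const 2)
  have hS : MeasurableSet {z | MemLp (fun x => f (x, z)) 2 volume} := by
    have : {z | MemLp (fun x => f (x, z)) 2 volume}
        = {z | eLpNorm (fun x => f (x, z) - 0) 2 volume < ⊤} := by
      ext z
      simp [MemLp, (hm z).aestronglyMeasurable]
    rw [this]
    exact measurableSet_lt (hI 0 stronglyMeasurable_zero) measurable_const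
  obtain ⟨g, hg, hgc⟩ := (Lp.aestronglyMeasurable c)
  classical
  have e : (fun z => edist (slice f z) c) = fun z =>
      if z ∈ {z | MemLp (fun x => f (x, z)) 2 volume} then
        eLpNorm (fun x => f (x, z) - g x) 2 volume else edist 0 c := by
    ext z
    split_ifs with h
    · rw [Lp.edist_def]
      refine eLpNorm_congr_ae ?_
      filter_upwards [coeFn_slice h, hgc] with x h1 h2
      simp [h1, h2]
    · rw [slice, dif_neg (show ¬ MemLp (fun x => f (x, z)) 2 volume from h)]
  rw [e]
  exact Measurable.ite hS (hI g hg) measurable_const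

theorem aestronglyMeasurable_slice {τ : Measure ℝ} [SFinite τ] {f : Rn n × ℝ → ℂ}
    (hf : AEStronglyMeasurable f (volume.prod τ)) : AEStronglyMeasurable (slice f) τ := by
  refine ⟨slice (hf.mk f), stronglyMeasurable_slice hf.stronglyMeasurable_mk, ?_⟩
  filter_upwards [ae_ae_of_ae_prod_swap hf.ae_eq_mk] with z hz using slice_congr hz

/-- A jointly measurable representative of an `L²(ℝⁿ)`-valued function. -/
def IsSlices (τ : Measure ℝ) (f : Rn n × ℝ → ℂ) (X : ℝ → L2 n) : Prop :=
  AEStronglyMeasurable f (volume.prod τ) ∧ AEStronglyMeasurable X τ ∧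
    ∀ᵐ z ∂τ, (X z : Rn n → ℂ) =ᵐ[volume] fun x => f (x, z)

theorem isSlices_slice {τ : Measure ℝ} [SFinite τ] {f : Rn n × ℝ → ℂ}
    (hf : AEStronglyMeasurable f (volume.prod τ))
    (h : ∀ᵐ z ∂τ, MemLp (fun x => f (x, z)) 2 volume) : IsSlices τ f (slice f) :=
  ⟨hf, aestronglyMeasurable_slice hf, h.mono fun _ hz => coeFn_slice hz⟩

theorem IsSlices.mono {τ τ' : Measure ℝ} {f : Rn n × ℝ → ℂ} {X : ℝ → L2 n} [SFinite τ] [SFinite τ']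
    (h : IsSlices τ f X) (hτ : τ' ≪ τ) : IsSlices τ' f X :=
  ⟨h.1.mono_ac (Measure.AbsolutelyContinuous.prod Measure.AbsolutelyContinuous.rfl hτ),
    h.2.1.mono_ac hτ, hτ.ae_le h.2.2⟩

theorem lintegral_mk_sub_eq (c Y : L2 n) :
    ∫⁻ x, ‖(Lp.aestronglyMeasurable c).mk c x - Y x‖ₑ ^ 2 = edist c Y ^ 2 := by
  rw [edist_eq_enorm_sub, enorm_sq_eq_lintegral]
  refine lintegral_congr_ae ?_
  filter_upwards [Lp.coeFn_sub c Y, (Lp.aestronglyMeasurable c).ae_eq_mk] with x h2 h3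
  rw [h2, Pi.sub_apply, h3]

/-- Converse of slicing. The map is approximated within `2⁻ᵏ` by the first suitable member of a
dense sequence; each approximation takes countably many values and is jointly measurable once
representatives are fixed. The squared errors are summable, so on every slice the approximations
converge almost everywhere. -/
theorem exists_isSlices {τ : Measure ℝ} [SFinite τ] {X : ℝ → L2 n} (hX : AEStronglyMeasurable X τ) :
    ∃ f : Rn n × ℝ → ℂ, StronglyMeasurable f ∧ IsSlices τ f X := by
  classical
  borelize (L2 n)
  set Y := hX.mk X
  have hY : Measurable Y := hX.stronglyMeasurable_mk.measurable
  set d := TopologicalSpace.denseSeq (L2 n)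
  have hex : ∀ (k : ℕ) z, ∃ j, edist (Y z) (d j) < (2⁻¹ : ℝ≥0∞) ^ k := by
    intro k z
    obtain ⟨_, ⟨j, rfl⟩, hj⟩ := EMetric.mem_closure_iff.1
      ((TopologicalSpace.denseRange_denseSeq (L2 n)) (Y z)) ((2⁻¹ : ℝ≥0∞) ^ k)
      (ENNReal.pow_pos (by simp) k)
    exact ⟨j, hj⟩
  obtain ⟨N, hN, hspec⟩ : ∃ N : ℕ → ℝ → ℕ, (∀ k, Measurable (N k)) ∧
      ∀ k z, edist (Y z) (d (N k z)) < (2⁻¹ : ℝ≥0∞) ^ k :=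
    ⟨fun k z => Nat.find (hex k z), fun k => measurable_find (hex k) fun j =>
      measurableSet_lt (hY.edist measurable_const) measurable_const,
      fun k z => Nat.find_spec (hex k z)⟩
  obtain ⟨D, hD⟩ : ∃ D : ℕ → Rn n → ℂ, D = fun j => (Lp.aestronglyMeasurable (d j)).mk (d j) :=
    ⟨_, rfl⟩
  set F : ℕ → Rn n × ℝ → ℂ := fun k p => D (N k p.2) p.1
  have hF : ∀ k, StronglyMeasurable (F k) := by
    intro k
    have h1 : Measurable fun q : Rn n × ℕ => D q.2 q.1 :=
      measurable_from_prod_countable_left fun j => by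
        rw [hD]
        exact (Lp.aestronglyMeasurable (d j)).stronglyMeasurable_mk.measurable
    have h2 : Measurable fun p : Rn n × ℝ => (p.1, N k p.2) :=
      measurable_fst.prodMk ((hN k).comp measurable_snd)
    exact (h1.comp h2).stronglyMeasurable
  have hFY : ∀ k z, ∫⁻ x, ‖F k (x, z) - Y z x‖ₑ ^ 2 ≤ ((2⁻¹ : ℝ≥0∞) ^ k) ^ 2 := by
    intro k z
    have h1 := lintegral_mk_sub_eq (d (N k z)) (Y z)
    simp only [F, hD]
    rw [h1, edist_comm]
    gcongr
    exact (hspec k z).le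
  have hlim : ∀ z, ∀ᵐ x, Tendsto (fun k => F k (x, z)) atTop (𝓝 (Y z x)) := by
    intro z
    have hmeas : ∀ k, AEMeasurable (fun x => ‖F k (x, z) - Y z x‖ₑ ^ 2) volume := fun k =>
      ((((hF k).comp_measurable measurable_prodMk_right).aestronglyMeasurable.sub
        (Lp.aestronglyMeasurable (Y z))).enorm.pow_const 2)
    have hsum : ∫⁻ x, ∑' k, ‖F k (x, z) - Y z x‖ₑ ^ 2 ≠ ⊤ := by
      rw [lintegral_tsum hmeas]
      refine ((ENNReal.tsum_le_tsum fun k => hFY k z).trans_lt ?_).ne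
      have : ∀ k : ℕ, ((2⁻¹ : ℝ≥0∞) ^ k) ^ 2 ≤ (2⁻¹ : ℝ≥0∞) ^ k := fun k =>
        pow_le_of_le_one (zero_le) (pow_le_one₀ (zero_le) (by simp)) two_ne_zero
      refine (ENNReal.tsum_le_tsum this).trans_lt ?_
      rw [ENNReal.tsum_geometric]
      simp
    filter_upwards [ae_lt_top' (AEMeasurable.tsum hmeas) hsum] with x hx
    have h0 := ENNReal.tendsto_atTop_zero_of_tsum_ne_top hx.ne
    rw [tendsto_iff_edist_tendsto_0]
    have h1 := h0.ennrpow_const (1 / 2 : ℝ)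
    rw [ENNReal.zero_rpow_of_pos (by norm_num)] at h1
    refine h1.congr fun k => ?_
    rw [← ENNReal.rpow_natCast, ← ENNReal.rpow_mul, edist_eq_enorm_sub]
    norm_num
  -- The default value 0 is taken where the sequence diverges, which on each slice is a null set.
  set G : Rn n × ℝ → ℂ := fun p =>
    if ∃ l, Tendsto (fun k => F k p) atTop (𝓝 l) then limUnder atTop (fun k => F k p) else 0
  have hG : StronglyMeasurable G := StronglyMeasurable.ite
    (MeasureTheory.measurableSet_exists_tendsto fun k => (hF k).measurable)
    (StronglyMeasurable.limUnder hF) stronglyMeasurable_const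
  refine ⟨G, hG, hG.aestronglyMeasurable, hX, ?_⟩
  filter_upwards [hX.ae_eq_mk] with z hz
  rw [hz]
  filter_upwards [hlim z] with x hx
  have : ∃ l, Tendsto (fun k => F k (x, z)) atTop (𝓝 l) := ⟨_, hx⟩
  simp only [G, if_pos this]
  exact hx.limUnder_eq.symm

theorem IsSlices.lintegral_eq {τ : Measure ℝ} [SFinite τ] {f : Rn n × ℝ → ℂ} {X : ℝ → L2 n}
    (h : IsSlices τ f X) {ρ : ℝ → ℝ≥0∞} (hρ : Measurable ρ) :
    ∫⁻ p, ρ p.2 * ‖f p‖ₑ ^ 2 ∂(volume.prod τ) = ∫⁻ z, ρ z * ‖X z‖ₑ ^ 2 ∂τ := by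
  have hm : AEMeasurable (fun p : Rn n × ℝ => ρ p.2 * ‖f p‖ₑ ^ 2) (volume.prod τ) :=
    (hρ.comp measurable_snd).aemeasurable.mul (h.1.enorm.pow_const 2)
  rw [lintegral_prod_symm _ hm]
  refine lintegral_congr_ae ?_
  filter_upwards [h.2.2] with z hz
  rw [lintegral_const_mul'' _ (by
    have := (Lp.aestronglyMeasurable (X z)).congr hz
    exact this.enorm.pow_const 2), enorm_sq_eq_lintegral]
  congr 1
  refine lintegral_congr_ae ?_
  filter_upwards [hz] with x hx
  rw [hx]

theorem ae_memLp_slice {τ : Measure ℝ} [SFinite τ] {f : Rn n × ℝ → ℂ} {ρ : ℝ → ℝ≥0∞}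
    (hf : AEStronglyMeasurable f (volume.prod τ)) (hρ : Measurable ρ) (hρ0 : ∀ᵐ z ∂τ, ρ z ≠ 0)
    (h : ∫⁻ p, ρ p.2 * ‖f p‖ₑ ^ 2 ∂(volume.prod τ) < ⊤) :
    ∀ᵐ z ∂τ, MemLp (fun x => f (x, z)) 2 volume := by
  have hm : AEMeasurable (fun p : Rn n × ℝ => ρ p.2 * ‖f p‖ₑ ^ 2) (volume.prod τ) :=
    (hρ.comp measurable_snd).aemeasurable.mul (hf.enorm.pow_const 2)
  rw [lintegral_prod_symm _ hm] at h
  have hfm : ∀ᵐ z ∂τ, AEStronglyMeasurable (fun x => f (x, z)) volume := by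
    filter_upwards [ae_ae_of_ae_prod_swap hf.ae_eq_mk] with z hz
    exact ⟨_, hf.stronglyMeasurable_mk.comp_measurable measurable_prodMk_right, hz⟩
  filter_upwards [ae_lt_top' (AEMeasurable.lintegral_prod_left' hm) h.ne, hρ0, hfm] with z h1 h2 h3
  refine memLp_two_iff_lintegral.2 ⟨h3, ?_⟩
  rw [lintegral_const_mul'' _ (h3.enorm.pow_const 2)] at h1
  exact lt_top_iff_ne_top.2 fun h4 => by
    rw [h4, ENNReal.mul_top h2] at h1
    exact h1.ne rfl

theorem IsSlices.integrableOn_prod {τ : Measure ℝ} [SFinite τ] {f : Rn n × ℝ → ℂ} {X : ℝ → L2 n}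
    (h : IsSlices τ f X) (hX : Integrable X τ) {s : Set (Rn n)}
    (hμs : volume s ≠ ⊤) : Integrable f ((volume.restrict s).prod τ) := by
  have hac : (volume.restrict s).prod τ ≪ (volume : Measure (Rn n)).prod τ :=
    Measure.AbsolutelyContinuous.prod Measure.absolutelyContinuous_restrict Measure.AbsolutelyContinuous.rfl
  refine ⟨h.1.mono_ac hac, ?_⟩
  rw [HasFiniteIntegral, lintegral_prod_symm _ (h.1.mono_ac hac).enorm]
  have h1 : ∀ᵐ z ∂τ, ∫⁻ x in s, ‖f (x, z)‖ₑ ≤ ‖X z‖ₑ * volume s ^ (1 / 2 : ℝ) := by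
    filter_upwards [h.2.2] with z hz
    have h2 : AEStronglyMeasurable (fun x => f (x, z)) (volume.restrict s) :=
      ((Lp.aestronglyMeasurable (X z)).congr hz).restrict
    have h3 := eLpNorm_le_eLpNorm_mul_rpow_measure_univ (p := 1) (q := 2) one_le_two h2
    rw [eLpNorm_one_eq_lintegral_enorm] at h3
    refine h3.trans ?_
    have h4 : eLpNorm (fun x => f (x, z)) 2 (volume.restrict s) ≤ ‖X z‖ₑ := by
      rw [Lp.enorm_def, eLpNorm_congr_ae hz]
      exact eLpNorm_mono_measure _ Measure.restrict_le_self
    norm_num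
    gcongr
  refine (lintegral_mono_ae h1).trans_lt ?_
  rw [lintegral_mul_const'' _ h.2.1.enorm]
  exact ENNReal.mul_lt_top hX.2 (ENNReal.rpow_lt_top_of_nonneg (by norm_num) hμs)

theorem IsSlices.ae_integrable {τ : Measure ℝ} [SFinite τ] {f : Rn n × ℝ → ℂ} {X : ℝ → L2 n}
    (h : IsSlices τ f X) (hX : Integrable X τ) :
    ∀ᵐ x ∂(volume : Measure (Rn n)), Integrable (fun z => f (x, z)) τ := by
  have : ∀ k, ∀ᵐ x ∂((volume : Measure (Rn n)).restrict (spanningSets volume k)),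
      Integrable (fun z => f (x, z)) τ := fun k =>
    (h.integrableOn_prod hX (measure_spanningSets_lt_top _ k).ne).prod_right_ae
  have h2 := (ae_restrict_iUnion_iff (μ := (volume : Measure (Rn n))) (spanningSets volume) _).2 this
  rwa [iUnion_spanningSets, Measure.restrict_univ] at h2

/-- The Bochner integral of an `L²(ℝⁿ)`-valued function is computed pointwise. -/
theorem IsSlices.coeFn_integral {τ : Measure ℝ} [SFinite τ] {f : Rn n × ℝ → ℂ} {X : ℝ → L2 n}
    (h : IsSlices τ f X) (hX : Integrable X τ) :
    ((∫ z, X z ∂τ : L2 n) : Rn n → ℂ) =ᵐ[volume] fun x => ∫ z, f (x, z) ∂τ := by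
  refine ae_eq_of_forall_setIntegral_eq_of_sigmaFinite (fun s hs hμs => ?_) (fun s hs hμs => ?_)
    fun s hs hμs => ?_
  · have : IsFiniteMeasure (volume.restrict s) := ⟨by simpa using hμs⟩
    exact ((Lp.memLp _).restrict s).integrable one_le_two
  · exact (h.integrableOn_prod hX hμs.ne).integral_prod_left
  -- Integration over `s` is the inner product with an indicator function. It commutes with the
  -- Bochner integral on one side and is exchanged with `∫ dz` by Fubini on the other.
  · rw [integral_integral_swap (f := fun x z => f (x, z)) (h.integrableOn_prod hX hμs.ne),
      ← MeasureTheory.L2.inner_indicatorConstLp_one (𝕜 := ℂ) hs hμs.ne, ← integral_inner hX]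
    refine integral_congr_ae ?_
    filter_upwards [h.2.2] with z hz
    rw [MeasureTheory.L2.inner_indicatorConstLp_one hs hμs.ne]
    exact setIntegral_congr_ae hs (hz.mono fun x hx _ => hx)

end TaubWave
end

/-! ### Weak derivatives on `(0, ∞)` -/

noncomputable section
namespace TaubWave

/-- The interval is enlarged so as to contain 1, the base point of all primitives. -/
theorem exists_tsupport_subset_Ioo {ζ : ℝ → ℝ} (hc : HasCompactSupport ζ) (hs : tsupport ζ ⊆ Ioi 0) :
    ∃ α β : ℝ, 0 < α ∧ α < 1 ∧ 1 < β ∧ tsupport ζ ⊆ Ioo α β := by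
  rcases (tsupport ζ).eq_empty_or_nonempty with h | h
  · exact ⟨1 / 2, 2, by norm_num, by norm_num, by norm_num, by simp [h]⟩
  · obtain ⟨x, hx, hx'⟩ := IsCompact.exists_isLeast hc h
    obtain ⟨y, hy, hy'⟩ := IsCompact.exists_isGreatest hc h
    have hx0 : 0 < x := hs hx
    refine ⟨min x 1 / 2, max y 1 + 1, by positivity, ?_, ?_, fun z hz => ⟨?_, ?_⟩⟩
    · linarith [min_le_right x 1]
    · linarith [le_max_right y 1]
    · linarith [hx' hz, min_le_left x 1, lt_min hx0 one_pos]
    · linarith [hy' hz, le_max_left y 1]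

theorem setIntegral_eq_intervalIntegral_of_tsupport {E : Type*} [NormedAddCommGroup E]
    [NormedSpace ℝ E] {f : ℝ → E} {α β : ℝ} (hα : 0 < α) (hαβ : α ≤ β)
    (h : ∀ x, x ∉ Ioo α β → f x = 0) : ∫ z in Ioi 0, f z = ∫ z in α..β, f z := by
  rw [intervalIntegral.integral_of_le hαβ]
  refine setIntegral_eq_of_subset_of_forall_sdiff_eq_zero measurableSet_Ioi
    (fun x hx => hα.trans hx.1) fun x hx => h x fun h' => hx.2 ⟨h'.1, h'.2.le⟩

theorem integrableOn_smul_of_locallyIntegrableOn {E : Type*} [NormedAddCommGroup E]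
    [NormedSpace ℝ E] {f : ℝ → E} (hf : LocallyIntegrableOn f (Ioi 0)) {ζ : ℝ → ℝ}
    (hζ : Continuous ζ) (hc : HasCompactSupport ζ) (hs : tsupport ζ ⊆ Ioi 0) :
    IntegrableOn (fun z => ζ z • f z) (Ioi 0) := by
  have h1 : IntegrableOn (fun z => ζ z • f z) (tsupport ζ) :=
    (hf.integrableOn_compact_subset hs hc).continuousOn_smul hζ.continuousOn hc
  refine (integrableOn_iff_integrable_of_support_subset ?_).1 h1 |>.integrableOn
  exact (Function.support_smul_subset_left _ _).trans (subset_tsupport ζ)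

theorem intervalIntegrable_of_locallyIntegrableOn {E : Type*} [NormedAddCommGroup E] {g : ℝ → E}
    (hg : LocallyIntegrableOn g (Ioi 0)) {x y : ℝ} (hx : 0 < x) (hy : 0 < y) :
    IntervalIntegrable g volume x y := by
  refine (intervalIntegrable_iff').2 (hg.integrableOn_compact_subset ?_ isCompact_uIcc)
  exact fun s hs => lt_of_lt_of_le (lt_min hx hy) hs.1

theorem continuousOn_primitive {E : Type*} [NormedAddCommGroup E] [NormedSpace ℝ E]
    {g : ℝ → E} (hg : LocallyIntegrableOn g (Ioi 0)) :
    ContinuousOn (fun z => ∫ s in (1 : ℝ)..z, g s) (Ioi 0) := by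
  intro z hz
  have h1 := intervalIntegral.continuousOn_primitive_interval' (a := 1)
    (intervalIntegrable_of_locallyIntegrableOn hg (x := min 1 (z / 2)) (y := max 1 (z + 1))
      (lt_min one_pos (half_pos hz)) (by positivity)) (by
      rw [uIcc_of_le ((min_le_left _ _).trans (le_max_left _ _))]
      exact ⟨min_le_left _ _, le_max_left _ _⟩)
  rw [uIcc_of_le ((min_le_left _ _).trans (le_max_left _ _))] at h1
  have hz' : (0 : ℝ) < z := hz
  exact (h1.continuousAt (Icc_mem_nhds ((min_le_right _ _).trans_lt (by linarith))
    (lt_of_lt_of_le (by linarith) (le_max_right _ _)))).continuousWithinAt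

/-- Integration by parts against a primitive. -/
theorem setIntegral_deriv_smul_primitive {E : Type*} [NormedAddCommGroup E] [NormedSpace ℝ E]
    [CompleteSpace E] {g : ℝ → E} (hg : LocallyIntegrableOn g (Ioi 0)) {ζ : ℝ → ℝ}
    (hζ : ContDiff ℝ ∞ ζ) (hc : HasCompactSupport ζ) (hs : tsupport ζ ⊆ Ioi 0) :
    ∫ z in Ioi 0, deriv ζ z • (∫ s in (1 : ℝ)..z, g s) = -∫ z in Ioi 0, ζ z • g z := by
  have hgi : ∀ x y, 0 < x → 0 < y → IntervalIntegrable g volume x y := fun x y hx hy =>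
    intervalIntegrable_of_locallyIntegrableOn hg hx hy
  set G : ℝ → E := fun z => ∫ s in (1 : ℝ)..z, g s
  obtain ⟨α, β, hα, hα1, hβ1, hsub⟩ := exists_tsupport_subset_Ioo hc hs
  have hαβ : α ≤ β := by linarith
  have hz : ∀ x, x ∉ Ioo α β → ζ x = 0 := fun x hx =>
    image_eq_zero_of_notMem_tsupport fun h' => hx (hsub h')
  have hdz : ∀ x, x ∉ Ioo α β → deriv ζ x = 0 := fun x hx =>
    image_eq_zero_of_notMem_tsupport fun h' => hx (hsub (tsupport_deriv_subset h'))
  have hα' : α ∉ Ioo α β := fun h => lt_irrefl _ h.1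
  have hβ' : β ∉ Ioo α β := fun h => lt_irrefl _ h.2
  have hd : ∀ s, HasDerivAt ζ (deriv ζ s) s := fun s =>
    (hζ.differentiable (by simp)).differentiableAt.hasDerivAt
  have hdc : Continuous (deriv ζ) := hζ.continuous_deriv (by simp)
  rw [setIntegral_eq_intervalIntegral_of_tsupport hα hαβ (fun x hx => by rw [hdz x hx, zero_smul]),
    setIntegral_eq_intervalIntegral_of_tsupport hα hαβ (fun x hx => by rw [hz x hx, zero_smul])]
  -- Moving the base point from 1 to `α` adds a constant, which integrates to 0 against `deriv ζ`.
  have e : ∀ z ∈ uIcc α β, deriv ζ z • G z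
      = deriv ζ z • (∫ s in (1 : ℝ)..α, g s) + deriv ζ z • ∫ s in α..z, g s := by
    intro z hz
    rw [uIcc_of_le hαβ] at hz
    rw [← smul_add, intervalIntegral.integral_add_adjacent_intervals (hgi _ _ one_pos hα)
      (hgi _ _ hα (hα.trans_le hz.1))]
  rw [intervalIntegral.integral_congr e, intervalIntegral.integral_add,
    intervalIntegral.integral_smul_const, intervalIntegral.integral_eq_sub_of_hasDerivAt
      (fun s _ => hd s) (hdc.intervalIntegrable _ _),
    integral_deriv_smul_primitive hαβ (fun s _ => hd s) hdc.continuousOn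
      ((intervalIntegrable_iff_integrableOn_Ioc_of_le hαβ).1 (hgi _ _ hα (by linarith))),
    hz α hα', hz β hβ']
  · simp
  · exact (hdc.smul continuous_const).intervalIntegrable _ _
  · refine ContinuousOn.intervalIntegrable (hdc.continuousOn.smul ?_)
    exact intervalIntegral.continuousOn_primitive_interval' (hgi _ _ hα (by linarith)) left_mem_uIcc

/-- The du Bois-Reymond lemma on `(0, ∞)` for vector-valued functions. -/
theorem exists_ae_eq_const_add_integral {E : Type*} [NormedAddCommGroup E] [NormedSpace ℝ E]
    [CompleteSpace E] {f g : ℝ → E} (hf : LocallyIntegrableOn f (Ioi 0))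
    (hg : LocallyIntegrableOn g (Ioi 0))
    (h : ∀ ζ : ℝ → ℝ, ContDiff ℝ ∞ ζ → HasCompactSupport ζ → tsupport ζ ⊆ Ioi 0 →
      ∫ z in Ioi 0, deriv ζ z • f z = -∫ z in Ioi 0, ζ z • g z) :
    ∃ c, ∀ᵐ z ∂(volume.restrict (Ioi (0 : ℝ))), f z = c + ∫ s in (1 : ℝ)..z, g s := by
  set G : ℝ → E := fun z => ∫ s in (1 : ℝ)..z, g s
  have hG : ContinuousOn G (Ioi 0) := continuousOn_primitive hg
  have hGl : LocallyIntegrableOn G (Ioi 0) := hG.locallyIntegrableOn measurableSet_Ioi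
  have hl : LocallyIntegrableOn (fun z => f z - G z) (Ioi 0) := hf.sub hGl
  have hGζ : ∀ ζ : ℝ → ℝ, ContDiff ℝ ∞ ζ → HasCompactSupport ζ → tsupport ζ ⊆ Ioi 0 →
      ∫ z in Ioi 0, deriv ζ z • G z = -∫ z in Ioi 0, ζ z • g z :=
    fun ζ hζ hc hs => setIntegral_deriv_smul_primitive hg hζ hc hs
  have hzero : ∀ ζ : ℝ → ℝ, ContDiff ℝ ∞ ζ → HasCompactSupport ζ → tsupport ζ ⊆ Ioi 0 →
      ∫ z in Ioi 0, deriv ζ z • (f z - G z) = 0 := by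
    intro ζ hζ hc hs
    have hdc : Continuous (deriv ζ) := hζ.continuous_deriv (by simp)
    have hds := (tsupport_deriv_subset (f := ζ)).trans hs
    simp only [smul_sub]
    rw [integral_sub (integrableOn_smul_of_locallyIntegrableOn hf hdc hc.deriv hds)
      (integrableOn_smul_of_locallyIntegrableOn hGl hdc hc.deriv hds), h ζ hζ hc hs, hGζ ζ hζ hc hs,
      sub_self]
  let b : ContDiffBump (1 : ℝ) := ⟨1 / 4, 1 / 2, by norm_num, by norm_num⟩
  set ζ₀ : ℝ → ℝ := b.normed volume
  have hζ₀ : ContDiff ℝ ∞ ζ₀ := b.contDiff_normed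
  have hζ₀c : HasCompactSupport ζ₀ := b.hasCompactSupport_normed
  have hζ₀s : tsupport ζ₀ ⊆ Ioi 0 := by
    rw [b.tsupport_normed_eq, Real.closedBall_eq_Icc]
    intro x hx
    have := hx.1
    simp only [b] at this
    norm_num at this
    simp only [mem_Ioi]
    linarith
  have hζ₀i : ∫ x, ζ₀ x = 1 := b.integral_normed
  set c := ∫ z in Ioi 0, ζ₀ z • (f z - G z)
  have hmain : ∀ ζ : ℝ → ℝ, ContDiff ℝ ∞ ζ → HasCompactSupport ζ → tsupport ζ ⊆ Ioi 0 →
      ∫ z in Ioi 0, ζ z • (f z - G z) = (∫ z, ζ z) • c := by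
    intro ζ hζ hc hs
    set I := ∫ z, ζ z
    -- Subtracting a multiple of the normalised bump makes the mean zero. The primitive `Θ` then has
    -- compact support in `(0, ∞)` and is an admissible test function with derivative `θ`.
    set θ : ℝ → ℝ := fun z => ζ z - I * ζ₀ z
    have hθ : ContDiff ℝ ∞ θ := hζ.sub (contDiff_const.mul hζ₀)
    have hθi : ∫ z, θ z = 0 := by
      simp only [θ]
      rw [integral_sub (hζ.continuous.integrable_of_hasCompactSupport hc)
        ((hζ₀.continuous.integrable_of_hasCompactSupport hζ₀c).const_mul I), integral_const_mul,
        hζ₀i, mul_one, sub_self]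
    obtain ⟨α, β, hα, hα1, hβ1, hsub⟩ := exists_tsupport_subset_Ioo hc hs
    obtain ⟨α', β', hα', hα1', hβ1', hsub'⟩ := exists_tsupport_subset_Ioo hζ₀c hζ₀s
    set A := min α α'
    set B := max β β'
    have hA0 : 0 < A := lt_min hα hα'
    have hθz : ∀ x, x ∉ Ioo A B → θ x = 0 := by
      intro x hx
      have h1 : ζ x = 0 := image_eq_zero_of_notMem_tsupport fun h' => hx
        ⟨(min_le_left _ _).trans_lt (hsub h').1, (hsub h').2.trans_le (le_max_left _ _)⟩
      have h2 : ζ₀ x = 0 := image_eq_zero_of_notMem_tsupport fun h' => hx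
        ⟨(min_le_right _ _).trans_lt (hsub' h').1, (hsub' h').2.trans_le (le_max_right _ _)⟩
      simp [θ, h1, h2]
    have hAB : A ≤ B := (min_le_left _ _).trans ((by linarith : α ≤ β).trans (le_max_left _ _))
    set Θ : ℝ → ℝ := fun z => ∫ s in A..z, θ s
    have hΘd : ∀ z, HasDerivAt Θ (θ z) z := fun z =>
      intervalIntegral.integral_hasDerivAt_right (hθ.continuous.intervalIntegrable _ _)
        (hθ.continuous.stronglyMeasurableAtFilter _ _) hθ.continuous.continuousAt
    have hΘderiv : deriv Θ = θ := funext fun z => (hΘd z).deriv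
    have hΘ : ContDiff ℝ ∞ Θ := by
      rw [contDiff_infty_iff_deriv, hΘderiv]
      exact ⟨fun z => (hΘd z).differentiableAt, hθ⟩
    have hθAB : ∫ s in A..B, θ s = 0 := by
      rw [intervalIntegral.integral_of_le hAB, ← hθi]
      exact setIntegral_eq_integral_of_forall_compl_eq_zero fun x hx =>
        hθz x fun h' => hx ⟨h'.1, h'.2.le⟩
    have hΘz : ∀ x, x ∉ Icc A B → Θ x = 0 := by
      intro x hx
      rcases lt_or_ge x A with h1 | h1
      · simp only [Θ]
        rw [intervalIntegral.integral_symm, intervalIntegral.integral_of_le h1.le,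
          setIntegral_eq_zero_of_forall_eq_zero fun s hs => hθz s fun h' => ?_, neg_zero]
        exact absurd hs.2 (not_le.2 h'.1)
      · have h2 : B ≤ x := le_of_not_ge fun h2 => hx ⟨h1, h2⟩
        simp only [Θ]
        rw [← intervalIntegral.integral_add_adjacent_intervals
          (hθ.continuous.intervalIntegrable A B) (hθ.continuous.intervalIntegrable B x), hθAB,
          zero_add, intervalIntegral.integral_of_le h2,
          setIntegral_eq_zero_of_forall_eq_zero fun s hs => hθz s fun h' => ?_]
        exact absurd hs.1 (not_lt.2 h'.2.le)
    have hΘc : HasCompactSupport Θ := HasCompactSupport.intro isCompact_Icc hΘz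
    have hΘs : tsupport Θ ⊆ Ioi 0 := by
      have : tsupport Θ ⊆ Icc A B :=
        closure_minimal (fun x hx => by_contra fun h' => hx (hΘz x h')) isClosed_Icc
      exact fun x hx => hA0.trans_le (this hx).1
    have := hzero Θ hΘ hΘc hΘs
    rw [hΘderiv] at this
    simp only [θ, sub_smul, mul_smul] at this
    have e := integral_sub (integrableOn_smul_of_locallyIntegrableOn hl hζ.continuous hc hs)
      (g := fun z => I • (ζ₀ z • (f z - G z)))
      ((integrableOn_smul_of_locallyIntegrableOn hl hζ₀.continuous hζ₀c hζ₀s).smul I)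
    rw [e, integral_smul, sub_eq_zero] at this
    exact this
  refine ⟨c, ?_⟩
  have hlc : LocallyIntegrableOn (fun z => f z - G z - c) (Ioi 0) :=
    hl.sub (locallyIntegrableOn_const c)
  have hfin := isOpen_Ioi.ae_eq_zero_of_integral_contDiff_smul_eq_zero hlc (fun ζ hζ hc hs => ?_)
  · rw [ae_restrict_iff' measurableSet_Ioi]
    filter_upwards [hfin] with z hz hz0
    have := hz hz0
    simp only [sub_sub, sub_eq_zero] at this
    rw [this, add_comm]
  · rw [← setIntegral_eq_integral_of_forall_compl_eq_zero (s := Ioi 0) fun x hx => by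
      rw [image_eq_zero_of_notMem_tsupport fun h' => hx (hs h'), zero_smul]]
    simp only [smul_sub (ζ _) (_ - _) c]
    rw [integral_sub (integrableOn_smul_of_locallyIntegrableOn hl hζ.continuous hc hs)
      ((hζ.continuous.integrable_of_hasCompactSupport hc).smul_const c).integrableOn,
      hmain ζ hζ hc hs, integral_smul_const, setIntegral_eq_integral_of_forall_compl_eq_zero, sub_self]
    exact fun x hx => image_eq_zero_of_notMem_tsupport fun h' => hx (hs h')

end TaubWave
end

/-! ### Weak derivatives and the Fourier transform on `ℝⁿ` -/

noncomputable section
namespace TaubWave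

variable {n : ℕ}

theorem integrable_smul_L2 {v : Rn n → ℝ} (hv : MemLp v 2 volume) (Y : L2 n) :
    Integrable (fun x => v x • Y x) volume := by
  have h : MemLp (fun x => v x • Y x) 1 volume := MemLp.smul (p := 2) (q := 2) (Lp.memLp Y) hv
  exact memLp_one_iff_integrable.1 h

/-- Weak identities extend from compactly supported to rapidly decaying test functions. -/
theorem integral_fderiv_smul_of_forall_hasCompactSupport {ι : Type*} [Fintype ι] {e : ι → Rn n}
    {Y : ι → L2 n} {Z : L2 n}
    (h : ∀ ζ : Rn n → ℝ, ContDiff ℝ ∞ ζ → HasCompactSupport ζ →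
      ∑ j, ∫ x, (fderiv ℝ ζ x (e j)) • Y j x = -∫ x, ζ x • Z x)
    {v : Rn n → ℝ} (hv : ContDiff ℝ ∞ v) (hv2 : MemLp v 2 volume)
    (hdv : ∀ j, MemLp (fun x => fderiv ℝ v x (e j)) 2 volume) :
    ∑ j, ∫ x, (fderiv ℝ v x (e j)) • Y j x = -∫ x, v x • Z x := by
  let b : ContDiffBump (0 : Rn n) := ⟨1, 2, by norm_num, by norm_num⟩
  set δ : ℕ → ℝ := fun k => 1 / ((k : ℝ) + 1)
  have hδ : Tendsto δ atTop (𝓝 0) := tendsto_one_div_add_atTop_nhds_zero_nat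
  have hδ0 : ∀ k, 0 < δ k := fun k => by positivity
  have hδ1 : ∀ k, δ k ≤ 1 := fun k => by
    simp only [δ]
    rw [div_le_one (by positivity)]
    linarith [k.cast_nonneg (α := ℝ)]
  have hb : ContDiff ℝ ∞ b := b.contDiff
  -- Cutoffs at distance of order `1 / δ k`: they tend to 1, while their gradients are `O(δ k)`, so
  -- that the extra term of the product rule vanishes in the limit.
  set χ : ℕ → Rn n → ℝ := fun k x => b (δ k • x)
  have hχ : ∀ k, ContDiff ℝ ∞ (χ k) := fun k => hb.comp (contDiff_const_smul _)
  have hχd : ∀ k x y, fderiv ℝ (χ k) x y = δ k * fderiv ℝ b (δ k • x) y := by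
    intro k x y
    have h1 : HasFDerivAt (χ k) ((fderiv ℝ b (δ k • x)).comp (δ k • ContinuousLinearMap.id ℝ (Rn n))) x :=
      ((hb.differentiable (by simp)).differentiableAt.hasFDerivAt).comp x
        ((hasFDerivAt_id x).const_smul (δ k))
    rw [h1.fderiv]
    simp
  obtain ⟨M, hM⟩ : ∃ M, ∀ x, ‖fderiv ℝ b x‖ ≤ M :=
    (hb.continuous_fderiv (by simp)).bounded_above_of_compact_support
      (b.hasCompactSupport.fderiv ℝ)
  have hM0 : 0 ≤ M := (norm_nonneg _).trans (hM 0)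
  have hbx : ∀ x : Rn n, Tendsto (fun k => χ k x) atTop (𝓝 1) := by
    intro x
    have h1 : Tendsto (fun k => δ k • x) atTop (𝓝 0) := by simpa using hδ.smul_const x
    have h2 := (hb.continuous.tendsto 0).comp h1
    rwa [b.one_of_mem_closedBall (by simp [b])] at h2
  have hχ1 : ∀ k x, |χ k x| ≤ 1 := fun k x => by
    rw [abs_of_nonneg b.nonneg]; exact b.le_one
  have hprod : ∀ k x y, fderiv ℝ (fun x => χ k x * v x) x y
      = χ k x * fderiv ℝ v x y + (δ k * fderiv ℝ b (δ k • x) y) * v x := by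
    intro k x y
    have := (((hχ k).differentiable (by simp)).differentiableAt (x := x)).hasFDerivAt.mul
      ((hv.differentiable (by simp)).differentiableAt (x := x)).hasFDerivAt
    have e1 : fderiv ℝ (fun x => χ k x * v x) x = χ k x • fderiv ℝ v x + v x • fderiv ℝ (χ k) x :=
      this.fderiv
    rw [e1]
    simp [hχd]
    ring
  have hk : ∀ k, ∑ j, ∫ x, (fderiv ℝ (fun x => χ k x * v x) x (e j)) • Y j x
      = -∫ x, (χ k x * v x) • Z x := fun k => by
    refine h _ ((hχ k).mul hv) ?_
    have : HasCompactSupport (χ k) := b.hasCompactSupport.comp_smul (hδ0 k).ne'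
    exact this.mul_right
  have hL : Tendsto (fun k => ∑ j, ∫ x, (fderiv ℝ (fun x => χ k x * v x) x (e j)) • Y j x) atTop
      (𝓝 (∑ j, ∫ x, (fderiv ℝ v x (e j)) • Y j x)) := by
    refine tendsto_finsetSum _ fun j _ => ?_
    refine tendsto_integral_of_dominated_convergence
      (fun x => ‖(fderiv ℝ v x (e j)) • Y j x‖ + (M * ‖e j‖) * ‖v x • Y j x‖) (fun k => ?_) ?_
      (fun k => ?_) ?_
    · have hc : Continuous fun x => fderiv ℝ (fun x => χ k x * v x) x (e j) :=
        (((hχ k).mul hv).continuous_fderiv (by simp)).clm_apply continuous_const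
      exact hc.aestronglyMeasurable.smul (Lp.aestronglyMeasurable (Y j))
    · exact (integrable_smul_L2 (hdv j) (Y j)).norm.add ((integrable_smul_L2 hv2 (Y j)).norm.const_mul _)
    · refine Eventually.of_forall fun x => ?_
      rw [hprod, add_smul]
      refine (norm_add_le _ _).trans (add_le_add ?_ ?_)
      · rw [norm_smul, norm_smul, norm_mul]
        gcongr
        exact mul_le_of_le_one_left (norm_nonneg _) (hχ1 k x)
      · rw [norm_smul, norm_smul, norm_mul, norm_mul, ← mul_assoc]
        have h1 : ‖δ k‖ * ‖fderiv ℝ b (δ k • x) (e j)‖ ≤ 1 * (M * ‖e j‖) := by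
          refine mul_le_mul ?_ ?_ (norm_nonneg _) zero_le_one
          · rw [Real.norm_of_nonneg (hδ0 k).le]; exact hδ1 k
          · exact (ContinuousLinearMap.le_opNorm _ _).trans
              (mul_le_mul_of_nonneg_right (hM _) (norm_nonneg _))
        rw [one_mul] at h1
        rw [mul_assoc, ← norm_smul]
        have := mul_le_mul_of_nonneg_right h1 (norm_nonneg (v x • Y j x))
        rw [norm_smul] at this ⊢
        linarith
    · refine Eventually.of_forall fun x => ?_
      refine Tendsto.smul_const ?_ _
      simp only [hprod]
      have h1 : Tendsto (fun k => (δ k * fderiv ℝ b (δ k • x) (e j)) * v x) atTop (𝓝 0) := by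
        have h2 : Tendsto (fun k => δ k * fderiv ℝ b (δ k • x) (e j)) atTop (𝓝 0) := by
          refine squeeze_zero_norm (fun k => ?_) (by simpa using hδ.mul_const (M * ‖e j‖))
          rw [norm_mul, Real.norm_of_nonneg (hδ0 k).le]
          have := hδ0 k
          gcongr
          exact (ContinuousLinearMap.le_opNorm _ _).trans (by gcongr; exact hM _)
        simpa using h2.mul_const (v x)
      simpa using ((hbx x).mul_const (fderiv ℝ v x (e j))).add h1
  have hR : Tendsto (fun k => -∫ x, (χ k x * v x) • Z x) atTop (𝓝 (-∫ x, v x • Z x)) := by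
    refine Tendsto.neg (tendsto_integral_of_dominated_convergence
      (fun x => ‖v x • Z x‖) (fun k => ?_) (integrable_smul_L2 hv2 Z).norm (fun k => ?_) ?_)
    · exact ((hχ k).continuous.mul hv.continuous).aestronglyMeasurable.smul (Lp.aestronglyMeasurable _)
    · refine Eventually.of_forall fun x => ?_
      rw [norm_smul, norm_smul, norm_mul]
      gcongr
      exact mul_le_of_le_one_left (norm_nonneg _) (hχ1 k x)
    · refine Eventually.of_forall fun x => ?_
      refine Tendsto.smul_const ?_ _
      simpa using (hbx x).mul_const (v x)
  simp only [hk] at hL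
  exact tendsto_nhds_unique hL hR

/-- Real test functions determine the identity: the real and imaginary parts of a Schwartz function
are treated separately. -/
theorem integral_lineDeriv_mul_of_forall_hasCompactSupport {ι : Type*} [Fintype ι] {e : ι → Rn n}
    {Y : ι → L2 n} {Z : L2 n}
    (h : ∀ ζ : Rn n → ℝ, ContDiff ℝ ∞ ζ → HasCompactSupport ζ →
      ∑ j, ∫ x, (fderiv ℝ ζ x (e j)) • Y j x = -∫ x, ζ x • Z x) (u : 𝓢(Rn n, ℂ)) :
    ∑ j, ∫ x, (fderiv ℝ u x (e j)) * Y j x = -∫ x, u x * Z x := by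
  have hu2 : MemLp u 2 volume := u.memLp 2 volume
  have hdu : ∀ j, MemLp (fun x => fderiv ℝ u x (e j)) 2 volume := fun j =>
    (LineDeriv.lineDerivOp (e j) u).memLp 2 volume
  have hus : ContDiff ℝ ∞ u := u.smooth ⊤
  have hre : ∀ x y, fderiv ℝ (fun x => (u x).re) x y = (fderiv ℝ u x y).re := fun x y => by
    have : HasFDerivAt (fun x => (u x).re) (Complex.reCLM.comp (fderiv ℝ u x)) x :=
      Complex.reCLM.hasFDerivAt.comp x (u.hasFDerivAt x)
    rw [this.fderiv]
    simp
  have him : ∀ x y, fderiv ℝ (fun x => (u x).im) x y = (fderiv ℝ u x y).im := fun x y => by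
    have : HasFDerivAt (fun x => (u x).im) (Complex.imCLM.comp (fderiv ℝ u x)) x :=
      Complex.imCLM.hasFDerivAt.comp x (u.hasFDerivAt x)
    rw [this.fderiv]
    simp
  have h1 := integral_fderiv_smul_of_forall_hasCompactSupport h (v := fun x => (u x).re)
    (Complex.reCLM.contDiff.comp hus) hu2.re (fun j => by simp only [hre]; exact MemLp.re (hdu j))
  have h2 := integral_fderiv_smul_of_forall_hasCompactSupport h (v := fun x => (u x).im)
    (Complex.imCLM.contDiff.comp hus) hu2.im (fun j => by simp only [him]; exact MemLp.im (hdu j))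
  simp only [hre] at h1
  simp only [him] at h2
  have key : ∀ (w : Rn n → ℂ) (_ : MemLp w 2 volume) (T : L2 n),
      ∫ x, w x * T x = (∫ x, (w x).re • T x) + Complex.I * ∫ x, (w x).im • T x := by
    intro w hw T
    have i1 : Integrable (fun x => (w x).re • T x) volume := integrable_smul_L2 (MemLp.re hw) T
    have i2 : Integrable (fun x => (w x).im • T x) volume := integrable_smul_L2 (MemLp.im hw) T
    rw [← integral_const_mul, ← integral_add i1 (i2.const_mul Complex.I)]
    refine integral_congr_ae (Eventually.of_forall fun x => ?_)
    simp only [Complex.real_smul]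
    rw [← mul_assoc, ← add_mul, mul_comm Complex.I, Complex.re_add_im]
  simp only [fun j => key _ (hdu j) (Y j), key _ hu2 Z]
  rw [Finset.sum_add_distrib, ← Finset.mul_sum, h1, h2]
  ring

theorem ae_eq_of_forall_integral_schwartz {F : Rn n → ℂ} (hF : LocallyIntegrable F) (g : L2 n)
    (h : ∀ u : 𝓢(Rn n, ℂ), ∫ x, u x * F x = ∫ x, u x * g x) : (g : Rn n → ℂ) =ᵐ[volume] F := by
  refine ae_eq_of_integral_contDiff_smul_eq
    ((Lp.memLp g).locallyIntegrable one_le_two) hF fun v hv hvc => ?_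
  have hc : HasCompactSupport (Complex.ofRealCLM ∘ v) := hvc.comp_left rfl
  have hs : ContDiff ℝ ∞ (Complex.ofRealCLM ∘ v) := by fun_prop
  have := h (hc.toSchwartzMap hs)
  simpa using this.symm

theorem locallyIntegrable_continuous_mul {m : Rn n → ℂ} (hm : Continuous m) (f : L2 n) :
    LocallyIntegrable (fun x => m x * f x) := by
  rw [← locallyIntegrableOn_univ]
  exact (((Lp.memLp f).locallyIntegrable one_le_two).locallyIntegrableOn univ).continuousOn_mul
    hm.continuousOn isOpen_univ.isLocallyClosed

theorem smulLeftCLM_toTemperedDistribution_apply {m : Rn n → ℂ} (hm : m.HasTemperateGrowth)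
    (f : L2 n) (u : 𝓢(Rn n, ℂ)) :
    TemperedDistribution.smulLeftCLM ℂ m (f : 𝓢'(Rn n, ℂ)) u = ∫ x, u x * (m x * f x) := by
  rw [TemperedDistribution.smulLeftCLM_apply_apply, Lp.toTemperedDistribution_apply]
  refine integral_congr_ae (Eventually.of_forall fun x => ?_)
  simp only [SchwartzMap.smulLeftCLM_apply_apply hm, smul_eq_mul]
  ring

theorem integrable_schwartz_mul_mul {m : Rn n → ℂ} (hm : m.HasTemperateGrowth)
    (f : L2 n) (u : 𝓢(Rn n, ℂ)) : Integrable (fun x => u x * (m x * f x)) volume := by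
  have h1 : MemLp (SchwartzMap.smulLeftCLM ℂ m u) 2 volume := SchwartzMap.memLp _ 2 volume
  have h : MemLp (fun x => SchwartzMap.smulLeftCLM ℂ m u x * f x) 1 volume :=
    MemLp.mul (p := 2) (q := 2) (Lp.memLp f) h1
  refine (memLp_one_iff_integrable.1 h).congr (Eventually.of_forall fun x => ?_)
  simp only [SchwartzMap.smulLeftCLM_apply_apply hm, smul_eq_mul]
  ring

/-- The Fourier transform of a weak divergence. -/
theorem fourier_ae_eq_of_weak_divergence {ι : Type*} [Fintype ι] {e : ι → Rn n}
    {Y : ι → L2 n} {Z : L2 n}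
    (h : ∀ ζ : Rn n → ℝ, ContDiff ℝ ∞ ζ → HasCompactSupport ζ →
      ∑ j, ∫ x, (fderiv ℝ ζ x (e j)) • Y j x = -∫ x, ζ x • Z x) :
    ((𝓕 Z : L2 n) : Rn n → ℂ) =ᵐ[volume]
      fun ξ => ∑ j, (2 * Real.pi * Complex.I * (inner ℝ ξ (e j) : ℝ)) * (𝓕 (Y j) : L2 n) ξ := by
  have hd : (Z : 𝓢'(Rn n, ℂ)) = ∑ j, LineDeriv.lineDerivOp (e j) (Y j : 𝓢'(Rn n, ℂ)) := by
    ext u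
    have := integral_lineDeriv_mul_of_forall_hasCompactSupport h u
    rw [sum_apply]
    simp only [TemperedDistribution.lineDerivOp_apply_apply, Lp.toTemperedDistribution_apply,
      smul_eq_mul]
    simp only [neg_apply, SchwartzMap.lineDerivOp_apply_eq_fderiv, neg_mul, integral_neg,
      Finset.sum_neg_distrib]
    rw [this, neg_neg]
  refine ae_eq_of_forall_integral_schwartz ?_ _ fun u => ?_
  · refine locallyIntegrable_finsetSum _ fun j _ => locallyIntegrable_continuous_mul (by fun_prop) _
  · have h2 := congrArg (fun T => (𝓕 T : 𝓢'(Rn n, ℂ)) u) hd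
    simp only [FourierTransform.fourier_sum] at h2
    rw [sum_apply] at h2
    simp only [TemperedDistribution.fourier_lineDerivOp_eq, Lp.fourier_toTemperedDistribution_eq] at h2
    have hm : ∀ j, (fun x : Rn n => (2 * Real.pi * Complex.I * (inner ℝ x (e j) : ℝ) : ℂ)).HasTemperateGrowth :=
      fun j => by fun_prop
    have h3 : ∀ j, ((2 * (Real.pi : ℂ) * Complex.I) • (TemperedDistribution.smulLeftCLM ℂ
        fun x : Rn n => ((inner ℝ x (e j) : ℝ) : ℂ)) ((𝓕 (Y j) : L2 n) : 𝓢'(Rn n, ℂ))) u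
        = ∫ x, u x * ((2 * Real.pi * Complex.I * (inner ℝ x (e j) : ℝ)) * (𝓕 (Y j) : L2 n) x) := by
      intro j
      rw [smul_apply, smulLeftCLM_toTemperedDistribution_apply (by fun_prop), smul_eq_mul,
        ← integral_const_mul]
      refine integral_congr_ae (Eventually.of_forall fun x => ?_)
      simp only
      ring
    rw [Finset.sum_congr rfl fun j _ => h3 j, ← integral_finsetSum _ fun j _ =>
      integrable_schwartz_mul_mul (hm j) _ u, Lp.toTemperedDistribution_apply] at h2
    simp only [Finset.mul_sum]
    exact h2.symm

/-- The relation of symbols is an equality of Fourier transforms of tempered distributions.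
Inversion gives `Z = ∂_e Y`, which is then paired with the test function. -/
theorem weak_lineDeriv_of_fourier_ae_eq {e : Rn n} {Y Z : L2 n}
    (h : ((𝓕 Z : L2 n) : Rn n → ℂ) =ᵐ[volume]
      fun ξ => (2 * Real.pi * Complex.I * (inner ℝ ξ e : ℝ)) * (𝓕 Y : L2 n) ξ)
    {ζ : Rn n → ℝ} (hζ : ContDiff ℝ ∞ ζ) (hc : HasCompactSupport ζ) :
    ∫ x, (fderiv ℝ ζ x e) • Y x = -∫ x, ζ x • Z x := by
  have h1 : (Z : 𝓢'(Rn n, ℂ)) = LineDeriv.lineDerivOp e (Y : 𝓢'(Rn n, ℂ)) := by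
    have h2 : 𝓕 (Z : 𝓢'(Rn n, ℂ)) = 𝓕 (LineDeriv.lineDerivOp e (Y : 𝓢'(Rn n, ℂ))) := by
      ext u
      rw [TemperedDistribution.fourier_lineDerivOp_eq, Lp.fourier_toTemperedDistribution_eq,
        Lp.fourier_toTemperedDistribution_eq, Lp.toTemperedDistribution_apply, smul_apply,
        smulLeftCLM_toTemperedDistribution_apply (by fun_prop), smul_eq_mul, ← integral_const_mul]
      refine integral_congr_ae ?_
      filter_upwards [h] with x hx
      rw [hx, smul_eq_mul]
      ring
    have := congrArg (fun T => (𝓕⁻ T : 𝓢'(Rn n, ℂ))) h2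
    simpa only [FourierTransform.fourierInv_fourier_eq] using this
  have hcc : HasCompactSupport (Complex.ofRealCLM ∘ ζ) := hc.comp_left rfl
  have hcs : ContDiff ℝ ∞ (Complex.ofRealCLM ∘ ζ) := by fun_prop
  have h3 := congrArg (fun T : 𝓢'(Rn n, ℂ) => T (hcc.toSchwartzMap hcs)) h1
  simp only [TemperedDistribution.lineDerivOp_apply_apply, Lp.toTemperedDistribution_apply,
    neg_apply, SchwartzMap.lineDerivOp_apply_eq_fderiv] at h3
  have hf : ∀ x, fderiv ℝ (hcc.toSchwartzMap hcs) x e = ((fderiv ℝ ζ x e : ℝ) : ℂ) := by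
    intro x
    have : HasFDerivAt (hcc.toSchwartzMap hcs) (Complex.ofRealCLM.comp (fderiv ℝ ζ x)) x :=
      Complex.ofRealCLM.hasFDerivAt.comp x
        (hζ.differentiable (by simp)).differentiableAt.hasFDerivAt
    rw [this.fderiv]
    rfl
  simp only [hf, neg_smul, integral_neg] at h3
  have h4 : ∀ x, hcc.toSchwartzMap hcs x = ((ζ x : ℝ) : ℂ) := fun x => rfl
  simp only [h4, smul_eq_mul] at h3
  simp only [Complex.real_smul, h3, neg_neg]

theorem isLaplacian_of_fourier_ae_eq {γ w : L2 n}
    (h : ((𝓕 w : L2 n) : Rn n → ℂ) =ᵐ[volume]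
      fun ξ => (((-(2 * Real.pi * ‖ξ‖) ^ 2 : ℝ)) : ℂ) * (𝓕 γ : L2 n) ξ) : IsLaplacian n γ w := by
  rw [IsLaplacian, TemperedDistribution.laplacian_eq_fourierMultiplierCLM,
    TemperedDistribution.fourierMultiplierCLM_apply]
  have h2 : TemperedDistribution.smulLeftCLM ℂ (fun x : Rn n => ((‖x‖ ^ 2 : ℝ) : ℂ))
      (𝓕 (γ : 𝓢'(Rn n, ℂ))) = (-(2 * Real.pi : ℂ) ^ 2)⁻¹ • 𝓕 (w : 𝓢'(Rn n, ℂ)) := by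
    ext u
    rw [Lp.fourier_toTemperedDistribution_eq, Lp.fourier_toTemperedDistribution_eq, smul_apply,
      Lp.toTemperedDistribution_apply,
      smulLeftCLM_toTemperedDistribution_apply (by fun_prop), smul_eq_mul, ← integral_const_mul]
    refine integral_congr_ae ?_
    filter_upwards [h] with x hx
    have : (Real.pi : ℂ) ≠ 0 := by exact_mod_cast Real.pi_ne_zero
    rw [hx, smul_eq_mul]
    push_cast
    field_simp
  have h5 : (-(2 * Real.pi : ℂ) ^ 2) ≠ 0 := by
    have : (Real.pi : ℂ) ≠ 0 := by exact_mod_cast Real.pi_ne_zero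
    simp [this]
  have h3 : ∀ T : 𝓢'(Rn n, ℂ), (-(2 * Real.pi) ^ 2 : ℝ) • T = (-(2 * Real.pi : ℂ) ^ 2) • T := by
    intro T
    ext u
    simp
  rw [h2, FourierTransform.fourierInv_smul, FourierTransform.fourierInv_fourier_eq, h3, smul_smul,
    mul_inv_cancel₀ h5, one_smul]

theorem MemHs.memLp_fourier {s : ℝ} {γ : L2 n} (h : MemHs n s γ) :
    MemLp (fun ξ => (((1 + ‖ξ‖ ^ 2) ^ (s / 2) : ℝ) : ℂ) * (𝓕 γ : L2 n) ξ) 2 volume := by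
  obtain ⟨g, hg⟩ := TemperedDistribution.memSobolev_iff_exists_smulLeftCLM_fourier.1 h
  have hc : Continuous fun ξ : Rn n => (((1 + ‖ξ‖ ^ 2) ^ (s / 2) : ℝ) : ℂ) := by
    refine Complex.continuous_ofReal.comp (Continuous.rpow_const (by fun_prop) fun x => Or.inl ?_)
    positivity
  have e : (g : Rn n → ℂ) =ᵐ[volume]
      fun ξ => (((1 + ‖ξ‖ ^ 2) ^ (s / 2) : ℝ) : ℂ) * (𝓕 γ : L2 n) ξ := by
    refine ae_eq_of_forall_integral_schwartz (locallyIntegrable_continuous_mul hc _) g fun u => ?_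
    have := congrArg (fun T : 𝓢'(Rn n, ℂ) => T u) hg
    simp only [Lp.fourier_toTemperedDistribution_eq] at this
    rw [smulLeftCLM_toTemperedDistribution_apply (by fun_prop), Lp.toTemperedDistribution_apply] at this
    exact this
  exact (memLp_congr_ae e).1 (Lp.memLp g)

end TaubWave
end

/-! ### The half-space: weighted spaces and weak derivatives -/

noncomputable section
namespace TaubWave

variable {n : ℕ}

theorem isOpen_halfSpace : IsOpen (halfSpace n) := isOpen_lt continuous_const continuous_snd

theorem measurableSet_halfSpace : MeasurableSet (halfSpace n) := isOpen_halfSpace.measurableSet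

theorem volume_restrict_halfSpace : (volume : Measure (Rn n × ℝ)).restrict (halfSpace n)
    = (volume : Measure (Rn n)).prod (volume.restrict (Ioi 0)) := by
  have h := Measure.prod_restrict (μ := (volume : Measure (Rn n))) (ν := (volume : Measure ℝ)) univ
    (Ioi 0)
  rw [Measure.restrict_univ] at h
  rw [h, Measure.volume_eq_prod]
  congr 1
  ext p
  simp [halfSpace]

theorem weightedMeasure_absolutelyContinuous :
    weightedMeasure n ≪ volume.restrict (halfSpace n) :=
  withDensity_absolutelyContinuous _ _

theorem absolutelyContinuous_weightedMeasure :
    volume.restrict (halfSpace n) ≪ weightedMeasure n := by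
  refine withDensity_absolutelyContinuous' (by fun_prop) ?_
  filter_upwards [ae_restrict_mem measurableSet_halfSpace] with p hp
  have hp' : 0 < p.2 := hp
  simpa using hp'

theorem lintegral_weightedMeasure {f : Rn n × ℝ → ENNReal} (hf : AEMeasurable f (weightedMeasure n)) :
    ∫⁻ p, f p ∂(weightedMeasure n)
      = ∫⁻ p in halfSpace n, ENNReal.ofReal (p.2 ^ (1 : ℝ)) * f p := by
  simp only [Real.rpow_one]
  exact lintegral_withDensity_eq_lintegral_mul₀' (by fun_prop) hf

theorem integral_weightedMeasure (f : Rn n × ℝ → ℂ) :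
    ∫ p, f p ∂(weightedMeasure n) = ∫ p in halfSpace n, ((p.2 ^ (1 : ℝ) : ℝ) : ℂ) * f p := by
  refine (integral_withDensity_eq_integral_toReal_smul (by fun_prop) (by simp) f).trans ?_
  refine setIntegral_congr_fun measurableSet_halfSpace fun p hp => ?_
  simp only [ENNReal.toReal_ofReal (le_of_lt hp), Complex.real_smul, Real.rpow_one]

theorem ae_eq_weighted_iff {f g : Rn n × ℝ → ℂ} :
    f =ᵐ[weightedMeasure n] g ↔ f =ᵐ[volume.restrict (halfSpace n)] g :=
  ⟨fun h => absolutelyContinuous_weightedMeasure.ae_eq h,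
    fun h => weightedMeasure_absolutelyContinuous.ae_eq h⟩

/-- `f` is square integrable on the half-space with the weight `z ^ r`. -/
def WeightedSq (n : ℕ) (r : ℝ) (f : Rn n × ℝ → ℂ) : Prop :=
  AEStronglyMeasurable f (volume.restrict (halfSpace n)) ∧
    ∫⁻ p in halfSpace n, ENNReal.ofReal (p.2 ^ r) * ‖f p‖ₑ ^ 2 < ⊤

theorem WeightedSq.congr {r : ℝ} {f g : Rn n × ℝ → ℂ} (h : WeightedSq n r f)
    (hfg : f =ᵐ[volume.restrict (halfSpace n)] g) : WeightedSq n r g := by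
  refine ⟨h.1.congr hfg, ?_⟩
  have e : (fun p => ENNReal.ofReal (p.2 ^ r) * ‖f p‖ₑ ^ 2)
      =ᵐ[volume.restrict (halfSpace n)] fun p => ENNReal.ofReal (p.2 ^ r) * ‖g p‖ₑ ^ 2 :=
    hfg.mono fun p hp => by simp only [hp]
  rw [← lintegral_congr_ae e]
  exact h.2

theorem WeightedSq.smul {r : ℝ} {f : Rn n × ℝ → ℂ} (h : WeightedSq n r f) (c : ℂ) :
    WeightedSq n r (c • f) := by
  refine ⟨h.1.const_smul c, ?_⟩
  have : ∀ p : Rn n × ℝ, ENNReal.ofReal (p.2 ^ r) * ‖(c • f) p‖ₑ ^ 2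
      = ‖c‖ₑ ^ 2 * (ENNReal.ofReal (p.2 ^ r) * ‖f p‖ₑ ^ 2) := fun p => by
    rw [Pi.smul_apply, enorm_smul]
    ring
  simp only [this]
  rw [lintegral_const_mul' _ _ (by simp)]
  exact ENNReal.mul_lt_top (by simp) h.2

theorem enorm_add_sq_le (x y : ℂ) : ‖x + y‖ₑ ^ 2 ≤ 2 * (‖x‖ₑ ^ 2 + ‖y‖ₑ ^ 2) := by
  have h := ENNReal.rpow_add_le_mul_rpow_add_rpow ‖x‖ₑ ‖y‖ₑ (p := 2) (by norm_num)
  have h2 : ‖x + y‖ₑ ^ 2 ≤ (‖x‖ₑ + ‖y‖ₑ) ^ 2 := by gcongr; exact enorm_add_le x y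
  refine h2.trans ?_
  norm_num at h
  exact h

theorem WeightedSq.add {r : ℝ} {f g : Rn n × ℝ → ℂ} (hf : WeightedSq n r f)
    (hg : WeightedSq n r g) : WeightedSq n r (f + g) := by
  refine ⟨hf.1.add hg.1, ?_⟩
  have : ∀ p : Rn n × ℝ, ENNReal.ofReal (p.2 ^ r) * ‖(f + g) p‖ₑ ^ 2
      ≤ 2 * (ENNReal.ofReal (p.2 ^ r) * ‖f p‖ₑ ^ 2) + 2 * (ENNReal.ofReal (p.2 ^ r) * ‖g p‖ₑ ^ 2) :=
    fun p => by
    refine (mul_le_mul_right (enorm_add_sq_le (f p) (g p)) _).trans (le_of_eq ?_)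
    ring
  refine (lintegral_mono this).trans_lt ?_
  rw [lintegral_add_left' (by
      have := hf.1.enorm
      fun_prop), lintegral_const_mul' _ _ (by simp),
    lintegral_const_mul' _ _ (by simp)]
  exact ENNReal.add_lt_top.2 ⟨ENNReal.mul_lt_top (by simp) hf.2, ENNReal.mul_lt_top (by simp) hg.2⟩

/-- On a compact subset of the open half-space the continuous weight `z ^ r` has a positive minimum.
-/
theorem WeightedSq.memL2loc {r : ℝ} {f : Rn n × ℝ → ℂ} (h : WeightedSq n r f) : MemL2loc n f := by
  intro K hK hKs
  rcases K.eq_empty_or_nonempty with rfl | hne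
  · simp
  have hKm := hK.measurableSet
  have hcont : ContinuousOn (fun p : Rn n × ℝ => p.2 ^ r) K :=
    continuousOn_snd.rpow_const fun p hp => Or.inl (ne_of_gt (hKs hp))
  obtain ⟨p₀, hp₀, hmin⟩ := hK.exists_isMinOn hne hcont
  have hc : 0 < p₀.2 ^ r := Real.rpow_pos_of_pos (hKs hp₀) r
  rw [memLp_two_iff_lintegral]
  refine ⟨h.1.mono_set hKs, ?_⟩
  have h1 : ENNReal.ofReal (p₀.2 ^ r) * ∫⁻ p in K, ‖f p‖ₑ ^ 2 < ⊤ := by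
    rw [← lintegral_const_mul' _ _ (by simp)]
    refine lt_of_le_of_lt ?_ h.2
    refine le_trans ?_ (lintegral_mono_set hKs)
    refine setLIntegral_mono' hKm fun p hp => ?_
    have : p₀.2 ^ r ≤ p.2 ^ r := hmin hp
    exact mul_le_mul_left (ENNReal.ofReal_le_ofReal this) _
  exact lt_top_iff_ne_top.2 fun h2 => by
    rw [h2, ENNReal.mul_top (by simpa using hc)] at h1
    exact h1.ne rfl

theorem MemL2loc.locallyIntegrableOn {f : Rn n × ℝ → ℂ} (h : MemL2loc n f) :
    LocallyIntegrableOn f (halfSpace n) := by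
  rw [locallyIntegrableOn_iff isOpen_halfSpace.isLocallyClosed]
  intro K hKs hK
  have : IsFiniteMeasure (volume.restrict K) := ⟨by simpa using hK.measure_lt_top⟩
  exact (h K hK hKs).integrable one_le_two

theorem weightedSq_coe (φ : H n) : WeightedSq n 1 φ := by
  refine ⟨(Lp.aestronglyMeasurable φ).mono_ac absolutelyContinuous_weightedMeasure, ?_⟩
  have h := (memLp_two_iff_lintegral.1 (Lp.memLp φ)).2
  rwa [lintegral_weightedMeasure ((Lp.aestronglyMeasurable φ).enorm.pow_const 2)] at h

theorem WeightedSq.memLp {f : Rn n × ℝ → ℂ} (h : WeightedSq n 1 f) :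
    MemLp f 2 (weightedMeasure n) := by
  have h1 := h.1.mono_ac weightedMeasure_absolutelyContinuous
  rw [memLp_two_iff_lintegral]
  refine ⟨h1, ?_⟩
  rw [lintegral_weightedMeasure (h1.enorm.pow_const 2)]
  exact h.2

theorem WeightedSq.integrable_mul {r : ℝ} {f g : Rn n × ℝ → ℂ} (hf : WeightedSq n r f)
    (hg : WeightedSq n r g) :
    IntegrableOn (fun p => ((p.2 ^ r : ℝ) : ℂ) * (f p * star (g p))) (halfSpace n) := by
  have hm : Measurable fun p : Rn n × ℝ => p.2 ^ r := by fun_prop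
  refine ⟨(Complex.measurable_ofReal.comp hm).aestronglyMeasurable.mul
    (hf.1.mul (continuous_star.comp_aestronglyMeasurable hg.1)), ?_⟩
  rw [HasFiniteIntegral]
  refine lt_of_le_of_lt (lintegral_mono_ae (g := fun p => ENNReal.ofReal (p.2 ^ r) * ‖f p‖ₑ ^ 2
    + ENNReal.ofReal (p.2 ^ r) * ‖g p‖ₑ ^ 2) ?_) ?_
  · filter_upwards [ae_restrict_mem measurableSet_halfSpace] with p hp
    have hp' : 0 ≤ p.2 ^ r := Real.rpow_nonneg (le_of_lt hp) r
    rw [enorm_mul, enorm_mul, show ‖star (g p)‖ₑ = ‖g p‖ₑ from by simp [enorm_eq_nnnorm], ← mul_add]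
    have e : ‖((p.2 ^ r : ℝ) : ℂ)‖ₑ = ENNReal.ofReal (p.2 ^ r) := by
      rw [← ofReal_norm, Complex.norm_real, Real.norm_of_nonneg hp']
    rw [e]
    gcongr
    rcases le_total ‖f p‖ₑ ‖g p‖ₑ with h | h
    · refine le_trans ?_ le_add_self
      rw [sq]
      gcongr
    · refine le_trans ?_ le_self_add
      rw [sq]
      gcongr
  · rw [lintegral_add_left' (by
      have := hf.1.enorm
      fun_prop)]
    exact ENNReal.add_lt_top.2 ⟨hf.2, hg.2⟩

theorem inner_H_eq (η ψ : H n) :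
    inner ℂ η ψ = ∫ p in halfSpace n, ((p.2 ^ (1 : ℝ) : ℝ) : ℂ) * (ψ p * star (η p)) := by
  rw [MeasureTheory.L2.inner_def, integral_weightedMeasure]
  rfl

theorem norm_sq_H_eq (φ : H n) :
    ‖φ‖ₑ ^ 2 = ∫⁻ p in halfSpace n, ENNReal.ofReal (p.2 ^ (1 : ℝ)) * ‖φ p‖ₑ ^ 2 := by
  have h : ‖φ‖ₑ ^ 2 = ∫⁻ p, ‖φ p‖ₑ ^ 2 ∂(weightedMeasure n) := by
    rw [Lp.enorm_def, eLpNorm_two_eq, ← ENNReal.rpow_natCast, ← ENNReal.rpow_mul]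
    norm_num
  rw [h, lintegral_weightedMeasure ((Lp.aestronglyMeasurable φ).enorm.pow_const 2)]

/-! ### Weak derivatives -/

theorem integrableOn_smul_of_tsupport_subset {f : Rn n × ℝ → ℂ}
    (hf : LocallyIntegrableOn f (halfSpace n)) {ζ : Rn n × ℝ → ℝ}
    (hζ : Continuous ζ) (hc : HasCompactSupport ζ) (hs : tsupport ζ ⊆ halfSpace n) :
    Integrable (fun p => ζ p • f p) volume := by
  have h1 : IntegrableOn (fun p => ζ p • f p) (tsupport ζ) :=
    (hf.integrableOn_compact_subset hs hc).continuousOn_smul hζ.continuousOn hc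
  refine (integrableOn_iff_integrable_of_support_subset ?_).1 h1
  exact (Function.support_smul_subset_left _ _).trans (subset_tsupport ζ)

theorem setIntegral_smul_of_tsupport_subset (f : Rn n × ℝ → ℂ) {ζ : Rn n × ℝ → ℝ}
    (hs : tsupport ζ ⊆ halfSpace n) : ∫ p in halfSpace n, ζ p • f p = ∫ p, ζ p • f p :=
  setIntegral_eq_integral_of_forall_compl_eq_zero fun x hx => by
    rw [image_eq_zero_of_notMem_tsupport fun h' => hx (hs h'), zero_smul]

theorem fderiv_test {ζ : Rn n × ℝ → ℝ} (hζ : ContDiff ℝ ∞ ζ) (hc : HasCompactSupport ζ)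
    (hs : tsupport ζ ⊆ halfSpace n) (e : Rn n × ℝ) :
    ContDiff ℝ ∞ (fun p => fderiv ℝ ζ p e) ∧ HasCompactSupport (fun p => fderiv ℝ ζ p e) ∧
      tsupport (fun p => fderiv ℝ ζ p e) ⊆ halfSpace n := by
  refine ⟨(hζ.fderiv_right (m := ∞) (by simp)).clm_apply contDiff_const, ?_, ?_⟩
  · exact hc.fderiv_apply ℝ e
  · exact (tsupport_fderiv_apply_subset ℝ e).trans hs

theorem IsWeakDeriv.ae_eq {e : Rn n × ℝ} {f g g' : Rn n × ℝ → ℂ} (h : IsWeakDeriv n e f g)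
    (h' : IsWeakDeriv n e f g') : g =ᵐ[volume.restrict (halfSpace n)] g' := by
  have h1 := isOpen_halfSpace.ae_eq_zero_of_integral_contDiff_smul_eq_zero (μ := volume)
    (h.2.1.sub h'.2.1) (fun ζ hζ hc hs => ?_)
  · rw [EventuallyEq, ae_restrict_iff' measurableSet_halfSpace]
    filter_upwards [h1] with p hp hp'
    exact sub_eq_zero.1 (hp hp')
  · have h2 := (h.2.2 ζ hζ hc hs).symm.trans (h'.2.2 ζ hζ hc hs)
    rw [setIntegral_smul_of_tsupport_subset _ hs, setIntegral_smul_of_tsupport_subset _ hs,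
      neg_inj] at h2
    simp only [Pi.sub_apply, smul_sub]
    rw [integral_sub (integrableOn_smul_of_tsupport_subset h.2.1 hζ.continuous hc hs)
      (integrableOn_smul_of_tsupport_subset h'.2.1 hζ.continuous hc hs), h2, sub_self]

theorem LocallyIntegrableOn.congr_halfSpace {f f' : Rn n × ℝ → ℂ}
    (h : LocallyIntegrableOn f (halfSpace n)) (hf : f =ᵐ[volume.restrict (halfSpace n)] f') :
    LocallyIntegrableOn f' (halfSpace n) := by
  rw [locallyIntegrableOn_iff isOpen_halfSpace.isLocallyClosed] at h ⊢
  intro K hKs hK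
  exact (h K hKs hK).congr_fun_ae (ae_restrict_of_ae_restrict_of_subset hKs hf)

theorem IsWeakDeriv.congr {e : Rn n × ℝ} {f f' g g' : Rn n × ℝ → ℂ} (h : IsWeakDeriv n e f g)
    (hf : f =ᵐ[volume.restrict (halfSpace n)] f') (hg : g =ᵐ[volume.restrict (halfSpace n)] g') :
    IsWeakDeriv n e f' g' := by
  refine ⟨LocallyIntegrableOn.congr_halfSpace h.1 hf, LocallyIntegrableOn.congr_halfSpace h.2.1 hg,
    fun ζ hζ hc hs => ?_⟩
  have e1 : (fun p => (fderiv ℝ ζ p e) • f p) =ᵐ[volume.restrict (halfSpace n)]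
      fun p => (fderiv ℝ ζ p e) • f' p := hf.mono fun p hp => by simp only [hp]
  have e2 : (fun p => ζ p • g p) =ᵐ[volume.restrict (halfSpace n)]
      fun p => ζ p • g' p := hg.mono fun p hp => by simp only [hp]
  rw [← integral_congr_ae e1, ← integral_congr_ae e2]
  exact h.2.2 ζ hζ hc hs

theorem IsWeakDeriv.add {e : Rn n × ℝ} {f f' g g' : Rn n × ℝ → ℂ} (h : IsWeakDeriv n e f g)
    (h' : IsWeakDeriv n e f' g') : IsWeakDeriv n e (f + f') (g + g') := by
  refine ⟨h.1.add h'.1, h.2.1.add h'.2.1, fun ζ hζ hc hs => ?_⟩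
  obtain ⟨h1, h2, h3⟩ := fderiv_test hζ hc hs e
  simp only [Pi.add_apply, smul_add]
  rw [integral_add (integrableOn_smul_of_tsupport_subset h.1 h1.continuous h2 h3).integrableOn
      (integrableOn_smul_of_tsupport_subset h'.1 h1.continuous h2 h3).integrableOn,
    integral_add (integrableOn_smul_of_tsupport_subset h.2.1 hζ.continuous hc hs).integrableOn
      (integrableOn_smul_of_tsupport_subset h'.2.1 hζ.continuous hc hs).integrableOn,
    h.2.2 ζ hζ hc hs, h'.2.2 ζ hζ hc hs, neg_add]

theorem IsWeakDeriv.smul {e : Rn n × ℝ} {f g : Rn n × ℝ → ℂ} (h : IsWeakDeriv n e f g) (c : ℂ) :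
    IsWeakDeriv n e (c • f) (c • g) := by
  refine ⟨h.1.smul c, h.2.1.smul c, fun ζ hζ hc hs => ?_⟩
  simp only [Pi.smul_apply, smul_comm _ c]
  rw [integral_smul, integral_smul, h.2.2 ζ hζ hc hs, smul_neg]

theorem IsWeakDeriv.add_dir {e e' : Rn n × ℝ} {f g g' : Rn n × ℝ → ℂ} (h : IsWeakDeriv n e f g)
    (h' : IsWeakDeriv n e' f g') : IsWeakDeriv n (e + e') f (g + g') := by
  refine ⟨h.1, h.2.1.add h'.2.1, fun ζ hζ hc hs => ?_⟩
  obtain ⟨h1, h2, h3⟩ := fderiv_test hζ hc hs e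
  obtain ⟨h1', h2', h3'⟩ := fderiv_test hζ hc hs e'
  simp only [Pi.add_apply, smul_add, map_add, add_smul]
  rw [integral_add (integrableOn_smul_of_tsupport_subset h.1 h1.continuous h2 h3).integrableOn
      (integrableOn_smul_of_tsupport_subset h'.1 h1'.continuous h2' h3').integrableOn,
    integral_add (integrableOn_smul_of_tsupport_subset h.2.1 hζ.continuous hc hs).integrableOn
      (integrableOn_smul_of_tsupport_subset h'.2.1 hζ.continuous hc hs).integrableOn,
    h.2.2 ζ hζ hc hs, h'.2.2 ζ hζ hc hs, neg_add]

theorem IsWeakDeriv.smul_dir {e : Rn n × ℝ} {f g : Rn n × ℝ → ℂ} (h : IsWeakDeriv n e f g) (c : ℝ) :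
    IsWeakDeriv n (c • e) f ((c : ℂ) • g) := by
  refine ⟨h.1, h.2.1.smul (c : ℂ), fun ζ hζ hc hs => ?_⟩
  have e1 : ∀ p, (fderiv ℝ ζ p) (c • e) • f p = (c : ℂ) • ((fderiv ℝ ζ p) e • f p) := fun p => by
    simp only [map_smul, smul_eq_mul, Complex.real_smul, Complex.ofReal_mul]
    ring
  simp only [Pi.smul_apply, smul_comm _ (c : ℂ), e1]
  rw [integral_smul, integral_smul, h.2.2 ζ hζ hc hs, smul_neg]

theorem isWeakDeriv_weakDeriv {e : Rn n × ℝ} {f : Rn n × ℝ → ℂ} (h : ∃ g, IsWeakDeriv n e f g) :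
    IsWeakDeriv n e f (weakDeriv n e f) := by
  rw [weakDeriv, dif_pos h]
  exact h.choose_spec

theorem IsWeakDeriv.weakDeriv_ae_eq {e : Rn n × ℝ} {f g : Rn n × ℝ → ℂ} (h : IsWeakDeriv n e f g) :
    weakDeriv n e f =ᵐ[volume.restrict (halfSpace n)] g :=
  (isWeakDeriv_weakDeriv ⟨g, h⟩).ae_eq h

/-- `MemH1loc` asks for weak derivatives in all directions, whereas the form only involves the
coordinate directions; sums of the latter recover the former. -/
theorem exists_isWeakDeriv_sum {ι : Type*} (s : Finset ι) {e : ι → Rn n × ℝ} {f : Rn n × ℝ → ℂ}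
    (hf : LocallyIntegrableOn f (halfSpace n))
    (h : ∀ i ∈ s, ∃ g, MemL2loc n g ∧ IsWeakDeriv n (e i) f g) :
    ∃ g, MemL2loc n g ∧ IsWeakDeriv n (∑ i ∈ s, e i) f g := by
  classical
  induction s using Finset.induction_on with
  | empty =>
    refine ⟨0, fun K _ _ => MemLp.zero, hf, locallyIntegrableOn_zero, fun ζ hζ hc hs => ?_⟩
    simp
  | insert i s hi ih =>
    obtain ⟨g, hg, hg'⟩ := ih fun j hj => h j (Finset.mem_insert_of_mem hj)
    obtain ⟨k, hk, hk'⟩ := h i (Finset.mem_insert_self i s)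
    rw [Finset.sum_insert hi]
    exact ⟨k + g, fun K h1 h2 => (hk K h1 h2).add (hg K h1 h2), hk'.add_dir hg'⟩

/-- Elements of the energy space are the functions with weak derivatives in weighted spaces. -/
theorem mem_energySpace_iff {φ : H n} : φ ∈ energySpace n ↔
    (∃ g, IsWeakDeriv n (0, 1) φ g ∧ WeightedSq n 1 g) ∧
    ∀ i, ∃ g, IsWeakDeriv n (EuclideanSpace.single i 1, 0) φ g ∧
      WeightedSq n (-(1 / (n : ℝ))) g := by
  have hterm : ∀ p ∈ halfSpace n, ENNReal.ofReal
      (p.2 * ‖dz n φ p‖ ^ 2 + p.2 ^ (-(1 / (n : ℝ))) * ∑ i, ‖dx n i φ p‖ ^ 2)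
      = ENNReal.ofReal (p.2 ^ (1 : ℝ)) * ‖dz n φ p‖ₑ ^ 2
        + ∑ i, ENNReal.ofReal (p.2 ^ (-(1 / (n : ℝ)))) * ‖dx n i φ p‖ₑ ^ 2 := by
    intro p hp
    have hp0 : 0 ≤ p.2 := le_of_lt hp
    have hr : 0 ≤ p.2 ^ (-(1 / (n : ℝ))) := Real.rpow_nonneg hp0 _
    rw [Real.rpow_one, ENNReal.ofReal_add (by positivity) (by positivity), ENNReal.ofReal_mul hp0,
      Finset.mul_sum, ENNReal.ofReal_sum_of_nonneg (fun i _ => by positivity)]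
    congr 1
    · rw [ENNReal.ofReal_pow (norm_nonneg _), ofReal_norm]
    · refine Finset.sum_congr rfl fun i _ => ?_
      rw [ENNReal.ofReal_mul hr, ENNReal.ofReal_pow (norm_nonneg _), ofReal_norm]
  constructor
  · rintro ⟨hH, hb⟩
    have hd : ∀ e, IsWeakDeriv n e φ (weakDeriv n e φ) := fun e => by
      obtain ⟨g, -, hg⟩ := hH.2 e
      exact isWeakDeriv_weakDeriv ⟨g, hg⟩
    have hm : ∀ e, AEStronglyMeasurable (weakDeriv n e φ) (volume.restrict (halfSpace n)) :=
      fun e => (hd e).2.1.aestronglyMeasurable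
    rw [setLIntegral_congr_fun measurableSet_halfSpace hterm] at hb
    refine ⟨⟨_, hd _, hm _, lt_of_le_of_lt (lintegral_mono fun p => le_self_add) hb⟩,
      fun i => ⟨_, hd _, hm _, lt_of_le_of_lt (lintegral_mono fun p => ?_) hb⟩⟩
    refine le_trans ?_ le_add_self
    exact Finset.single_le_sum
      (f := fun i => ENNReal.ofReal (p.2 ^ (-(1 / (n : ℝ)))) * ‖dx n i φ p‖ₑ ^ 2)
      (fun _ _ => zero_le) (Finset.mem_univ i)
  · rintro ⟨⟨g, hg, hg2⟩, hx⟩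
    choose k hk hk2 using hx
    refine ⟨⟨(weightedSq_coe φ).memL2loc, fun e => ?_⟩, ?_⟩
    · have hloc := (weightedSq_coe φ).memL2loc.locallyIntegrableOn
      obtain ⟨G, hG, hG'⟩ := exists_isWeakDeriv_sum (Finset.univ : Finset (Fin n))
        (e := fun i => e.1 i • (EuclideanSpace.single i (1 : ℝ), (0 : ℝ))) hloc fun i _ =>
          ⟨_, ((hk2 i).smul (e.1 i : ℂ)).memL2loc, (hk i).smul_dir (e.1 i)⟩
      have he : e = ∑ i, e.1 i • (EuclideanSpace.single i (1 : ℝ), (0 : ℝ)) + e.2 • ((0 : Rn n), (1 : ℝ)) := by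
        refine Prod.ext ?_ ?_
        · simp only [Prod.fst_add, Prod.fst_sum, Prod.smul_fst, smul_zero, add_zero]
          ext j
          simp [Finset.sum_apply, Pi.single_apply]
        · simp [Prod.snd_sum]
      rw [he]
      exact ⟨_, fun K h1 h2 => (hG K h1 h2).add ((hg2.smul (e.2 : ℂ)).memL2loc K h1 h2),
        hG'.add_dir (hg.smul_dir e.2)⟩
    · rw [setLIntegral_congr_fun measurableSet_halfSpace hterm]
      have h1 := hg2.congr hg.weakDeriv_ae_eq.symm
      have h2 := fun i => (hk2 i).congr (hk i).weakDeriv_ae_eq.symm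
      have hw : ∀ r : ℝ, AEMeasurable (fun p : Rn n × ℝ => ENNReal.ofReal (p.2 ^ r))
          (volume.restrict (halfSpace n)) := fun r => by fun_prop
      have h1m : AEMeasurable (fun p => ENNReal.ofReal (p.2 ^ (1 : ℝ)) * ‖dz n φ p‖ₑ ^ 2)
          (volume.restrict (halfSpace n)) := (hw 1).mul (h1.1.enorm.pow_const 2)
      have h2m : ∀ i, AEMeasurable (fun p => ENNReal.ofReal (p.2 ^ (-(1 / (n : ℝ)))) *
          ‖dx n i φ p‖ₑ ^ 2) (volume.restrict (halfSpace n)) :=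
        fun i => (hw _).mul ((h2 i).1.enorm.pow_const 2)
      rw [lintegral_add_left' h1m, lintegral_finsetSum' _ fun i _ => h2m i]
      exact ENNReal.add_lt_top.2 ⟨h1.2, ENNReal.sum_lt_top.2 fun i _ => (h2 i).2⟩

end TaubWave
end

/-! ### The form, its domain and the operator -/

noncomputable section
namespace TaubWave

variable {n : ℕ}

/-- `g` and `k i` are the weak derivatives of `φ`, square integrable for the weights of the form. -/
def HasGradient (φ : H n) (g : Rn n × ℝ → ℂ) (k : Fin n → Rn n × ℝ → ℂ) : Prop :=
  (IsWeakDeriv n (0, 1) φ g ∧ WeightedSq n 1 g) ∧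
    ∀ i, IsWeakDeriv n (EuclideanSpace.single i 1, 0) φ (k i) ∧ WeightedSq n (-(1 / (n : ℝ))) (k i)

theorem HasGradient.mem_energySpace {φ : H n} {g : Rn n × ℝ → ℂ} {k : Fin n → Rn n × ℝ → ℂ}
    (h : HasGradient φ g k) : φ ∈ energySpace n :=
  mem_energySpace_iff.2 ⟨⟨g, h.1⟩, fun i => ⟨k i, h.2 i⟩⟩

theorem hasGradient_of_mem {φ : H n} (h : φ ∈ energySpace n) :
    HasGradient φ (dz n φ) (fun i => dx n i φ) := by
  obtain ⟨⟨g, hg, hg2⟩, hk⟩ := mem_energySpace_iff.1 h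
  refine ⟨⟨isWeakDeriv_weakDeriv ⟨g, hg⟩, hg2.congr hg.weakDeriv_ae_eq.symm⟩, fun i => ?_⟩
  obtain ⟨k, hk, hk2⟩ := hk i
  exact ⟨isWeakDeriv_weakDeriv ⟨k, hk⟩, hk2.congr hk.weakDeriv_ae_eq.symm⟩

theorem HasGradient.add {φ φ' : H n} {g g' : Rn n × ℝ → ℂ} {k k' : Fin n → Rn n × ℝ → ℂ}
    (h : HasGradient φ g k) (h' : HasGradient φ' g' k') : HasGradient (φ + φ') (g + g') (k + k') := by
  have e := (ae_eq_weighted_iff.1 (Lp.coeFn_add φ φ')).symm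
  exact ⟨⟨(h.1.1.add h'.1.1).congr e EventuallyEq.rfl, h.1.2.add h'.1.2⟩, fun i =>
    ⟨((h.2 i).1.add (h'.2 i).1).congr e EventuallyEq.rfl, (h.2 i).2.add (h'.2 i).2⟩⟩

theorem HasGradient.smul {φ : H n} {g : Rn n × ℝ → ℂ} {k : Fin n → Rn n × ℝ → ℂ}
    (h : HasGradient φ g k) (c : ℂ) : HasGradient (c • φ) (c • g) (c • k) := by
  have e := (ae_eq_weighted_iff.1 (Lp.coeFn_smul c φ)).symm
  exact ⟨⟨(h.1.1.smul c).congr e EventuallyEq.rfl, h.1.2.smul c⟩, fun i =>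
    ⟨((h.2 i).1.smul c).congr e EventuallyEq.rfl, (h.2 i).2.smul c⟩⟩

theorem form_eq {φ η : H n} {g g' : Rn n × ℝ → ℂ} {k k' : Fin n → Rn n × ℝ → ℂ}
    (h : HasGradient φ g k) (h' : HasGradient η g' k') :
    form n φ η = (∫ p in halfSpace n, ((p.2 ^ (1 : ℝ) : ℝ) : ℂ) * (g p * star (g' p)))
      + ∑ i, ∫ p in halfSpace n, ((p.2 ^ (-(1 / (n : ℝ))) : ℝ) : ℂ) * (k i p * star (k' i p)) := by
  have hk : ∀ i, IntegrableOn (fun p => ((p.2 ^ (-(1 / (n : ℝ))) : ℝ) : ℂ) *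
      (k i p * star (k' i p))) (halfSpace n) := fun i => (h.2 i).2.integrable_mul (h'.2 i).2
  rw [← integral_finsetSum _ fun i _ => hk i, ← integral_add (h.1.2.integrable_mul h'.1.2)
    (integrable_finsetSum _ fun i _ => hk i)]
  refine integral_congr_ae ?_
  filter_upwards [h.1.1.weakDeriv_ae_eq, h'.1.1.weakDeriv_ae_eq,
    ae_all_iff.2 fun i => (h.2 i).1.weakDeriv_ae_eq,
    ae_all_iff.2 fun i => (h'.2 i).1.weakDeriv_ae_eq] with p h1 h2 h3 h4
  simp only [dz, dx, h1, h2, h3, h4, Real.rpow_one, Finset.mul_sum]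

theorem form_add_right {φ η η' : H n} (hφ : φ ∈ energySpace n) (hη : η ∈ energySpace n)
    (hη' : η' ∈ energySpace n) : form n φ (η + η') = form n φ η + form n φ η' := by
  have h := hasGradient_of_mem hφ
  have h1 := hasGradient_of_mem hη
  have h2 := hasGradient_of_mem hη'
  rw [form_eq h h1, form_eq h h2, form_eq h (h1.add h2)]
  simp only [Pi.add_apply, star_add, mul_add]
  rw [integral_add (h.1.2.integrable_mul h1.1.2) (h.1.2.integrable_mul h2.1.2),
    Finset.sum_congr rfl fun i _ => integral_add ((h.2 i).2.integrable_mul (h1.2 i).2)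
      ((h.2 i).2.integrable_mul (h2.2 i).2), Finset.sum_add_distrib]
  ring

theorem form_smul_right {φ η : H n} (hφ : φ ∈ energySpace n) (hη : η ∈ energySpace n) (c : ℂ) :
    form n φ (c • η) = star c * form n φ η := by
  have h := hasGradient_of_mem hφ
  have h1 := hasGradient_of_mem hη
  rw [form_eq h h1, form_eq h (h1.smul c), mul_add, Finset.mul_sum, ← integral_const_mul]
  congr 1
  · refine integral_congr_ae (Eventually.of_forall fun p => ?_)
    simp only [Pi.smul_apply, smul_eq_mul, star_mul']
    ring
  · refine Finset.sum_congr rfl fun i _ => ?_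
    rw [← integral_const_mul]
    refine integral_congr_ae (Eventually.of_forall fun p => ?_)
    simp only [Pi.smul_apply, smul_eq_mul, star_mul']
    ring

theorem re_form_self_nonneg (φ : H n) : 0 ≤ (form n φ φ).re := by
  have e : form n φ φ = ((∫ p in halfSpace n, (p.2 * ‖dz n φ p‖ ^ 2 +
      p.2 ^ (-(1 / (n : ℝ))) * ∑ i, ‖dx n i φ p‖ ^ 2) : ℝ) : ℂ) := by
    rw [form, ← integral_complex_ofReal]
    refine integral_congr_ae (Eventually.of_forall fun p => ?_)
    have : ∀ w : ℂ, w * star w = ((‖w‖ ^ 2 : ℝ) : ℂ) := fun w => by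
      rw [← Complex.normSq_eq_norm_sq]
      exact Complex.mul_conj w
    simp only [this]
    push_cast
    rfl
  rw [e, Complex.ofReal_re]
  refine setIntegral_nonneg measurableSet_halfSpace fun p hp => ?_
  have hp0 : 0 ≤ p.2 := le_of_lt hp
  positivity

theorem norm_le_energyNorm (φ : H n) : ‖φ‖ ≤ energyNorm n φ :=
  Real.le_sqrt_of_sq_le (by linarith [re_form_self_nonneg φ])

/-! ### Test functions -/

theorem weightedSq_of_hasCompactSupport {θ : Rn n × ℝ → ℂ} (hθ : Continuous θ)
    (hc : HasCompactSupport θ) (hs : tsupport θ ⊆ halfSpace n) (r : ℝ) : WeightedSq n r θ := by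
  refine ⟨hθ.aestronglyMeasurable, ?_⟩
  have h1 : IntegrableOn (fun p : Rn n × ℝ => p.2 ^ r * ‖θ p‖ ^ 2) (tsupport θ) := by
    refine ContinuousOn.integrableOn_compact hc ?_
    exact (continuousOn_snd.rpow_const fun p hp => Or.inl (ne_of_gt (hs hp))).mul
      (hθ.norm.pow 2).continuousOn
  refine lt_of_le_of_lt ?_ h1.2
  have hm : MeasurableSet (tsupport θ) := (isClosed_tsupport θ).measurableSet
  rw [← lintegral_indicator hm, ← lintegral_indicator measurableSet_halfSpace]
  refine lintegral_mono fun p => ?_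
  by_cases hp : p ∈ tsupport θ
  · rw [indicator_of_mem hp, indicator_of_mem (hs hp)]
    have h2 : 0 ≤ p.2 ^ r := Real.rpow_nonneg (le_of_lt (hs hp)) r
    rw [enorm_mul, enorm_pow, enorm_norm, Real.enorm_of_nonneg h2]
  · have : θ p = 0 := image_eq_zero_of_notMem_tsupport hp
    refine (indicator_le_self _ _ p).trans ?_
    simp [this]

theorem isWeakDeriv_test {ζ : Rn n × ℝ → ℝ} (hζ : ContDiff ℝ ∞ ζ) (hc : HasCompactSupport ζ)
    (hs : tsupport ζ ⊆ halfSpace n) (e : Rn n × ℝ) :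
    IsWeakDeriv n e (fun p => (ζ p : ℂ)) (fun p => ((fderiv ℝ ζ p e : ℝ) : ℂ)) := by
  obtain ⟨h1, h2, h3⟩ := fderiv_test hζ hc hs e
  refine ⟨(Complex.continuous_ofReal.comp hζ.continuous).continuousOn.locallyIntegrableOn
      measurableSet_halfSpace, (Complex.continuous_ofReal.comp h1.continuous).continuousOn.locallyIntegrableOn
      measurableSet_halfSpace, fun θ hθ hθc hθs => ?_⟩
  obtain ⟨h1', h2', h3'⟩ := fderiv_test hθ hθc hθs e
  rw [setIntegral_smul_of_tsupport_subset _ hθs, setIntegral_smul_of_tsupport_subset _ h3']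
  simp only [Complex.real_smul, ← Complex.ofReal_mul]
  rw [integral_complex_ofReal, integral_complex_ofReal, ← Complex.ofReal_neg]
  congr 1
  have : (volume : Measure (Rn n × ℝ)).IsAddHaarMeasure := by
    rw [Measure.volume_eq_prod]
    infer_instance
  have := integral_mul_fderiv_eq_neg_fderiv_mul_of_integrable (𝕜 := ℝ) (μ := volume) (f := θ) (g := ζ)
    (v := e)
    ((h1'.continuous.mul hζ.continuous).integrable_of_hasCompactSupport h2'.mul_right)
    ((hθ.continuous.mul h1.continuous).integrable_of_hasCompactSupport h2.mul_left)
    ((hθ.continuous.mul hζ.continuous).integrable_of_hasCompactSupport hc.mul_left)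
    (fun x _ => (hθ.differentiable (by simp)).differentiableAt)
    (fun x _ => (hζ.differentiable (by simp)).differentiableAt)
  linarith

theorem weightedSq_test {ζ : Rn n × ℝ → ℝ} (hζ : Continuous ζ) (hc : HasCompactSupport ζ)
    (hs : tsupport ζ ⊆ halfSpace n) (r : ℝ) : WeightedSq n r (fun p => (ζ p : ℂ)) := by
  refine weightedSq_of_hasCompactSupport (Complex.continuous_ofReal.comp hζ)
    (hc.comp_left (g := fun x : ℝ => (x : ℂ)) Complex.ofReal_zero) ?_ r
  exact (tsupport_comp_subset (g := fun x : ℝ => (x : ℂ)) Complex.ofReal_zero ζ).trans hs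

theorem exists_test {ζ : Rn n × ℝ → ℝ} (hζ : ContDiff ℝ ∞ ζ) (hc : HasCompactSupport ζ)
    (hs : tsupport ζ ⊆ halfSpace n) : ∃ η : H n,
      (η : Rn n × ℝ → ℂ) =ᵐ[volume.restrict (halfSpace n)] (fun p => (ζ p : ℂ)) ∧
      HasGradient η (fun p => ((fderiv ℝ ζ p (0, 1) : ℝ) : ℂ))
        (fun i p => ((fderiv ℝ ζ p (EuclideanSpace.single i 1, 0) : ℝ) : ℂ)) := by
  have h := (weightedSq_test hζ.continuous hc hs 1).memLp
  have e := ae_eq_weighted_iff.1 h.coeFn_toLp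
  refine ⟨h.toLp _, e, ⟨(isWeakDeriv_test hζ hc hs _).congr e.symm EventuallyEq.rfl, ?_⟩, fun i =>
    ⟨(isWeakDeriv_test hζ hc hs _).congr e.symm EventuallyEq.rfl, ?_⟩⟩ <;>
  · obtain ⟨h1, h2, h3⟩ := fderiv_test hζ hc hs _
    exact weightedSq_test h1.continuous h2 h3 _

/-! ### The operator -/

/-- The energy space as a subspace. -/
def energySubmodule (n : ℕ) : Submodule ℂ (H n) where
  carrier := energySpace n
  add_mem' h h' := ((hasGradient_of_mem h).add (hasGradient_of_mem h')).mem_energySpace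
  zero_mem' := by
    obtain ⟨η, -, hη⟩ := exists_test (n := n) (ζ := 0) contDiff_const HasCompactSupport.zero (by simp)
    have := (hη.smul 0).mem_energySpace
    rwa [zero_smul] at this
  smul_mem' c _ h := ((hasGradient_of_mem h).smul c).mem_energySpace

/-- The bounded functional given by the form on the energy space extends to `H` by Hahn–Banach, and
the Riesz theorem represents the extension. -/
theorem exists_isImageA {φ : H n} (hφ : φ ∈ domainA n) : ∃ ψ, IsImageA n φ ψ := by
  obtain ⟨hE, C, hC, hb⟩ := hφ
  -- The form is conjugate linear in its second argument; conjugation makes it linear.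
  let L : energySubmodule n →ₗ[ℂ] ℂ :=
    { toFun := fun η => star (form n φ η)
      map_add' := fun η η' => by
        rw [Submodule.coe_add, form_add_right hE η.2 η'.2, star_add]
      map_smul' := fun c η => by
        rw [Submodule.coe_smul, form_smul_right hE η.2, star_mul', star_star]
        rfl }
  have hL : ∀ η, ‖L η‖ ≤ C * ‖η‖ := fun η => by
    have : ‖star (form n φ η)‖ = ‖form n φ η‖ := norm_star _
    exact this.le.trans (hb η η.2)
  obtain ⟨g, hg, -⟩ := exists_extension_norm_eq (𝕜 := ℂ) (energySubmodule n) (L.mkContinuous C hL)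
  refine ⟨(InnerProductSpace.toDual ℂ (H n)).symm g, ⟨hE, C, hC, hb⟩, fun η hη => ?_⟩
  have h1 : inner ℂ ((InnerProductSpace.toDual ℂ (H n)).symm g) η = star (form n φ η) := by
    rw [InnerProductSpace.toDual_symm_apply]
    exact hg ⟨η, hη⟩
  rw [← inner_conj_symm, h1]
  exact (star_star _).symm

/-- Test functions lie in the energy space, so `z (ψ - ψ')` vanishes as a distribution on the
half-space, and `z > 0` there. -/
theorem isImageA_unique {φ ψ ψ' : H n} (h : IsImageA n φ ψ) (h' : IsImageA n φ ψ') : ψ = ψ' := by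
  have h0 : ∀ η ∈ energySpace n, inner ℂ η (ψ - ψ') = 0 := fun η hη => by
    rw [inner_sub_right, ← h.2 η hη, ← h'.2 η hη, sub_self]
  have hw : WeightedSq n 1 (ψ - ψ' : H n) := weightedSq_coe _
  have hloc : LocallyIntegrableOn (fun p => ((p.2 ^ (1 : ℝ) : ℝ) : ℂ) * (ψ - ψ' : H n) p) (halfSpace n) := by
    refine (hw.memL2loc.locallyIntegrableOn).continuousOn_mul ?_ isOpen_halfSpace.isLocallyClosed
    simp only [Real.rpow_one]
    exact (Complex.continuous_ofReal.comp continuous_snd).continuousOn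
  have h1 := isOpen_halfSpace.ae_eq_zero_of_integral_contDiff_smul_eq_zero (μ := volume) hloc
    (fun ζ hζ hc hs => ?_)
  · have h2 : ((ψ - ψ' : H n) : Rn n × ℝ → ℂ) =ᵐ[weightedMeasure n] 0 := by
      rw [ae_eq_weighted_iff, EventuallyEq, ae_restrict_iff' measurableSet_halfSpace]
      filter_upwards [h1] with p hp hp'
      have hp0 : 0 < p.2 := hp'
      simpa [hp0.ne'] using hp hp'
    exact sub_eq_zero.1 ((Lp.eq_zero_iff_ae_eq_zero).2 h2)
  · obtain ⟨η, hη, hη'⟩ := exists_test hζ hc hs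
    rw [← setIntegral_smul_of_tsupport_subset _ hs, ← h0 η hη'.mem_energySpace, inner_H_eq]
    refine integral_congr_ae ?_
    filter_upwards [hη] with p hp
    rw [hp, Complex.real_smul]
    have : star (ζ p : ℂ) = ζ p := Complex.conj_ofReal _
    rw [this]
    ring

theorem existsUnique_isImageA {φ : H n} (hφ : φ ∈ domainA n) : ∃! ψ, IsImageA n φ ψ := by
  obtain ⟨ψ, h⟩ := exists_isImageA hφ
  exact ⟨ψ, h, fun ψ' h' => isImageA_unique h' h⟩

/-- The weak form of the equation `Aφ = ψ`. -/
theorem IsImageA.weak_eq {φ ψ : H n} (h : IsImageA n φ ψ) {g : Rn n × ℝ → ℂ}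
    {k : Fin n → Rn n × ℝ → ℂ} (hg : HasGradient φ g k) {ζ : Rn n × ℝ → ℝ} (hζ : ContDiff ℝ ∞ ζ)
    (hc : HasCompactSupport ζ) (hs : tsupport ζ ⊆ halfSpace n) :
    (∫ p in halfSpace n, (p.2 * fderiv ℝ ζ p (0, 1)) • g p)
      + ∑ i, ∫ p in halfSpace n, (p.2 ^ (-(1 / (n : ℝ))) *
        fderiv ℝ ζ p (EuclideanSpace.single i 1, 0)) • k i p
      = ∫ p in halfSpace n, (p.2 * ζ p) • ψ p := by
  obtain ⟨η, hη, hη'⟩ := exists_test hζ hc hs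
  have h1 := h.2 η hη'.mem_energySpace
  have hst : ∀ x : ℝ, star (x : ℂ) = x := Complex.conj_ofReal
  rw [form_eq hg hη', inner_H_eq] at h1
  simp only [hst] at h1
  have e : ∫ p in halfSpace n, ((p.2 ^ (1 : ℝ) : ℝ) : ℂ) * (ψ p * star (η p))
      = ∫ p in halfSpace n, (p.2 * ζ p) • ψ p := by
    refine integral_congr_ae ?_
    filter_upwards [hη] with p hp
    rw [hp, hst, Complex.real_smul, Real.rpow_one]
    push_cast
    ring
  rw [e] at h1
  rw [← h1]
  congr 1
  · refine integral_congr_ae (Eventually.of_forall fun p => ?_)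
    simp only [Complex.real_smul, Real.rpow_one]
    push_cast
    ring
  · refine Finset.sum_congr rfl fun i _ => integral_congr_ae (Eventually.of_forall fun p => ?_)
    simp only [Complex.real_smul]
    push_cast
    ring

end TaubWave
end

/-! ### Reduction of the equation to `L²(ℝⁿ)`-valued functions of `z` -/

noncomputable section
namespace TaubWave

variable {n : ℕ}

/-! ### Slices of weighted square integrable functions -/

theorem WeightedSq.lintegral_prod_lt_top {r : ℝ} {f : Rn n × ℝ → ℂ} (h : WeightedSq n r f) :
    ∫⁻ p, ENNReal.ofReal (p.2 ^ r) * ‖f p‖ₑ ^ 2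
      ∂((volume : Measure (Rn n)).prod (volume.restrict (Ioi 0))) < ⊤ := by
  rw [← volume_restrict_halfSpace]
  exact h.2

theorem WeightedSq.isSlices {r : ℝ} {f : Rn n × ℝ → ℂ} (h : WeightedSq n r f) :
    IsSlices (volume.restrict (Ioi 0)) f (slice f) := by
  have hm := h.1
  rw [volume_restrict_halfSpace] at hm
  refine isSlices_slice hm (ae_memLp_slice (ρ := fun z => ENNReal.ofReal (z ^ r)) hm (by fun_prop) ?_
    h.lintegral_prod_lt_top)
  filter_upwards [ae_restrict_mem measurableSet_Ioi] with z hz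
  simpa using Real.rpow_pos_of_pos hz r

theorem WeightedSq.lintegral_slice {r : ℝ} {f : Rn n × ℝ → ℂ} (h : WeightedSq n r f) :
    ∫⁻ z in Ioi 0, ENNReal.ofReal (z ^ r) * ‖slice f z‖ₑ ^ 2
      = ∫⁻ p in halfSpace n, ENNReal.ofReal (p.2 ^ r) * ‖f p‖ₑ ^ 2 := by
  rw [volume_restrict_halfSpace]
  exact (h.isSlices.lintegral_eq (ρ := fun z => ENNReal.ofReal (z ^ r)) (by fun_prop)).symm

theorem locallyIntegrableOn_of_lintegral_rpow {E : Type*} [NormedAddCommGroup E] {X : ℝ → E} {r : ℝ}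
    (hX : AEStronglyMeasurable X (volume.restrict (Ioi 0)))
    (h : ∫⁻ z in Ioi 0, ENNReal.ofReal (z ^ r) * ‖X z‖ₑ ^ 2 < ⊤) :
    LocallyIntegrableOn X (Ioi 0) := by
  rw [locallyIntegrableOn_iff isOpen_Ioi.isLocallyClosed]
  intro K hKs hK
  rcases K.eq_empty_or_nonempty with rfl | hne
  · simp
  have hcont : ContinuousOn (fun z : ℝ => z ^ r) K :=
    continuousOn_id.rpow_const fun p hp => Or.inl (ne_of_gt (hKs hp))
  obtain ⟨p₀, hp₀, hmin⟩ := hK.exists_isMinOn hne hcont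
  have hc : 0 < p₀ ^ r := Real.rpow_pos_of_pos (hKs hp₀) r
  have : IsFiniteMeasure (volume.restrict K) := ⟨by simpa using hK.measure_lt_top⟩
  refine MemLp.integrable (q := 2) one_le_two (memLp_two_iff_lintegral.2 ⟨hX.mono_set hKs, ?_⟩)
  have h1 : ENNReal.ofReal (p₀ ^ r) * ∫⁻ z in K, ‖X z‖ₑ ^ 2 < ⊤ := by
    rw [← lintegral_const_mul' _ _ (by simp)]
    refine lt_of_le_of_lt ?_ h
    refine le_trans ?_ (lintegral_mono_set hKs)
    refine setLIntegral_mono' hK.measurableSet fun p hp => ?_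
    have : p₀ ^ r ≤ p ^ r := hmin hp
    exact mul_le_mul_left (ENNReal.ofReal_le_ofReal this) _
  exact lt_top_iff_ne_top.2 fun h2 => by
    rw [h2, ENNReal.mul_top (by simpa using hc)] at h1
    exact h1.ne rfl

theorem WeightedSq.locallyIntegrableOn_slice {r : ℝ} {f : Rn n × ℝ → ℂ} (h : WeightedSq n r f) :
    LocallyIntegrableOn (slice f) (Ioi 0) :=
  locallyIntegrableOn_of_lintegral_rpow (r := r) h.isSlices.2.1 (by rw [h.lintegral_slice]; exact h.2)

theorem IsSlices.smul {τ : Measure ℝ} [SFinite τ] {f : Rn n × ℝ → ℂ} {X : ℝ → L2 n}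
    (h : IsSlices τ f X) {θ : ℝ → ℝ} (hθ : Measurable θ) :
    IsSlices τ (fun p => θ p.2 • f p) (fun z => θ z • X z) := by
  refine ⟨(hθ.comp measurable_snd).aestronglyMeasurable.smul h.1,
    hθ.aestronglyMeasurable.smul h.2.1, ?_⟩
  filter_upwards [h.2.2] with z hz
  filter_upwards [hz, Lp.coeFn_smul (θ z) (X z)] with x h1 h2
  rw [h2, Pi.smul_apply, h1]

/-- Integration against a product test function. -/
theorem setIntegral_prod_smul {f : Rn n × ℝ → ℂ} {X : ℝ → L2 n}
    (hfX : IsSlices (volume.restrict (Ioi 0)) f X) {θ : ℝ → ℝ} (hθ : Measurable θ)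
    (hX : IntegrableOn (fun z => θ z • X z) (Ioi 0)) {h : Rn n → ℝ}
    (hh : Continuous h) (hc : HasCompactSupport h) :
    ∫ p in halfSpace n, (θ p.2 * h p.1) • f p
      = ∫ x, h x • (∫ z in Ioi 0, θ z • X z : L2 n) x := by
  have hs := hfX.smul hθ
  have hK : volume (tsupport h) ≠ ⊤ := hc.measure_ne_top
  have hmK : MeasurableSet (tsupport h) := (isClosed_tsupport h).measurableSet
  have h1 := hs.integrableOn_prod hX hK
  have hprod : ((volume : Measure (Rn n)).restrict (tsupport h)).prod (volume.restrict (Ioi (0 : ℝ)))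
      = ((volume : Measure (Rn n)).prod (volume.restrict (Ioi 0))).restrict (tsupport h ×ˢ univ) := by
    rw [← Measure.prod_restrict, Measure.restrict_univ]
  obtain ⟨C, hC⟩ := hh.bounded_above_of_compact_support hc
  have h2 : Integrable (fun p : Rn n × ℝ => h p.1 • (θ p.2 • f p))
      ((volume : Measure (Rn n)).prod (volume.restrict (Ioi 0))) := by
    have h3 : Integrable (fun p : Rn n × ℝ => h p.1 • (θ p.2 • f p))
        (((volume : Measure (Rn n)).restrict (tsupport h)).prod (volume.restrict (Ioi 0))) :=
      h1.bdd_smul C (hh.comp continuous_fst).aestronglyMeasurable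
        (Eventually.of_forall fun p => hC p.1)
    rw [hprod] at h3
    refine (integrableOn_iff_integrable_of_support_subset (s := tsupport h ×ˢ univ) ?_).1 h3
    intro p hp
    refine ⟨subset_tsupport h fun h0 => hp ?_, mem_univ _⟩
    simp [h0]
  rw [volume_restrict_halfSpace]
  have e : (fun p : Rn n × ℝ => (θ p.2 * h p.1) • f p) = fun p => h p.1 • (θ p.2 • f p) := by
    ext p
    rw [smul_smul, mul_comm]
  rw [e, integral_prod _ h2]
  refine integral_congr_ae ?_
  filter_upwards [hs.coeFn_integral hX] with x hx
  rw [hx, ← integral_smul]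

/-! ### Product test functions -/

theorem prod_test {θ : ℝ → ℝ} (hθ : ContDiff ℝ ∞ θ) (hθc : HasCompactSupport θ)
    (hθs : tsupport θ ⊆ Ioi 0) {h : Rn n → ℝ} (hh : ContDiff ℝ ∞ h) (hc : HasCompactSupport h) :
    ContDiff ℝ ∞ (fun p : Rn n × ℝ => θ p.2 * h p.1) ∧
    HasCompactSupport (fun p : Rn n × ℝ => θ p.2 * h p.1) ∧
    tsupport (fun p : Rn n × ℝ => θ p.2 * h p.1) ⊆ halfSpace n ∧
    ∀ p e, fderiv ℝ (fun p : Rn n × ℝ => θ p.2 * h p.1) p e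
      = e.2 * deriv θ p.2 * h p.1 + θ p.2 * fderiv ℝ h p.1 e.1 := by
  have hsub : tsupport (fun p : Rn n × ℝ => θ p.2 * h p.1) ⊆ tsupport h ×ˢ tsupport θ := by
    refine closure_minimal (fun p hp => ?_) ((isClosed_tsupport h).prod (isClosed_tsupport θ))
    exact ⟨subset_tsupport h fun h0 => hp (by simp [h0]), subset_tsupport θ fun h0 => hp (by simp [h0])⟩
  refine ⟨(hθ.comp contDiff_snd).mul (hh.comp contDiff_fst), ?_, hsub.trans fun p hp => hθs hp.2,
    fun p e => ?_⟩
  · exact (hc.prod hθc).of_isClosed_subset (isClosed_tsupport _) hsub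
  · have h1 : HasFDerivAt (fun p : Rn n × ℝ => θ p.2)
        ((ContinuousLinearMap.toSpanSingleton ℝ (deriv θ p.2)).comp (ContinuousLinearMap.snd ℝ (Rn n) ℝ)) p :=
      ((hθ.differentiable (by simp)).differentiableAt.hasDerivAt.hasFDerivAt).comp p hasFDerivAt_snd
    have h2 : HasFDerivAt (fun p : Rn n × ℝ => h p.1)
        ((fderiv ℝ h p.1).comp (ContinuousLinearMap.fst ℝ (Rn n) ℝ)) p :=
      ((hh.differentiable (by simp)).differentiableAt.hasFDerivAt).comp p hasFDerivAt_fst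
    have h3 : HasFDerivAt (fun p : Rn n × ℝ => θ p.2 * h p.1) _ p := h1.mul h2
    rw [h3.fderiv]
    simp
    ring

theorem eq_of_forall_integral_test {Y Z : L2 n}
    (h : ∀ ζ : Rn n → ℝ, ContDiff ℝ ∞ ζ → HasCompactSupport ζ → ∫ x, ζ x • Y x = ∫ x, ζ x • Z x) :
    Y = Z :=
  Lp.ext (ae_eq_of_integral_contDiff_smul_eq ((Lp.memLp Y).locallyIntegrable one_le_two)
    ((Lp.memLp Z).locallyIntegrable one_le_two) h)

theorem deriv_test {θ : ℝ → ℝ} (hθ : ContDiff ℝ ∞ θ) (hθc : HasCompactSupport θ)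
    (hθs : tsupport θ ⊆ Ioi 0) :
    ContDiff ℝ ∞ (deriv θ) ∧ HasCompactSupport (deriv θ) ∧ tsupport (deriv θ) ⊆ Ioi 0 :=
  ⟨(contDiff_infty_iff_deriv.1 hθ).2, hθc.deriv, tsupport_deriv_subset.trans hθs⟩

theorem rpow_mul_test {θ : ℝ → ℝ} (hθ : ContDiff ℝ ∞ θ) (hθc : HasCompactSupport θ)
    (hθs : tsupport θ ⊆ Ioi 0) (r : ℝ) :
    ContDiff ℝ ∞ (fun z => z ^ r * θ z) ∧ HasCompactSupport (fun z => z ^ r * θ z) ∧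
      tsupport (fun z => z ^ r * θ z) ⊆ Ioi 0 := by
  refine ⟨contDiff_iff_contDiffAt.2 fun z => ?_, hθc.mul_left, tsupport_mul_subset_right.trans hθs⟩
  by_cases hz : z ∈ tsupport θ
  · exact (Real.contDiffAt_rpow_const_of_ne (ne_of_gt (hθs hz))).mul hθ.contDiffAt
  · have : (fun z => z ^ r * θ z) =ᶠ[𝓝 z] fun _ => 0 := by
      filter_upwards [notMem_tsupport_iff_eventuallyEq.1 hz] with y hy
      simp [hy]
    exact contDiffAt_const.congr_of_eventuallyEq this

theorem WeightedSq.integrableOn_test {r : ℝ} {f : Rn n × ℝ → ℂ} (h : WeightedSq n r f) {θ : ℝ → ℝ}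
    (hθ : Continuous θ) (hθc : HasCompactSupport θ) (hθs : tsupport θ ⊆ Ioi 0) :
    IntegrableOn (fun z => θ z • slice f z) (Ioi 0) :=
  integrableOn_smul_of_locallyIntegrableOn h.locallyIntegrableOn_slice hθ hθc hθs

/-- The weak derivative in `z` tested with `θ(z) h(x)`: as `h` is arbitrary, the identity holds
between elements of `L²(ℝⁿ)`. -/
theorem HasGradient.integral_deriv_smul {φ : H n} {g : Rn n × ℝ → ℂ} {k : Fin n → Rn n × ℝ → ℂ}
    (hg : HasGradient φ g k) {θ : ℝ → ℝ} (hθ : ContDiff ℝ ∞ θ) (hθc : HasCompactSupport θ)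
    (hθs : tsupport θ ⊆ Ioi 0) :
    ∫ z in Ioi 0, deriv θ z • slice φ z = -∫ z in Ioi 0, θ z • slice g z := by
  obtain ⟨hd, hdc, hds⟩ := deriv_test hθ hθc hθs
  refine eq_of_forall_integral_test fun h hh hc => ?_
  have hφ := weightedSq_coe φ
  obtain ⟨h1, h2, h3, h4⟩ := prod_test hθ hθc hθs hh hc
  have := hg.1.1.2.2 _ h1 h2 h3
  simp only [h4, one_mul, map_zero, mul_zero, add_zero] at this
  rw [setIntegral_prod_smul hφ.isSlices hd.continuous.measurable
      (hφ.integrableOn_test hd.continuous hdc hds) hh.continuous hc,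
    setIntegral_prod_smul hg.1.2.isSlices hθ.continuous.measurable
      (hg.1.2.integrableOn_test hθ.continuous hθc hθs) hh.continuous hc, ← integral_neg] at this
  rw [this]
  refine integral_congr_ae ?_
  filter_upwards [Lp.coeFn_neg (∫ z in Ioi 0, θ z • slice g z : L2 n)] with x hx
  rw [hx, Pi.neg_apply, smul_neg]

theorem inner_single_one (ξ : Rn n) (i : Fin n) :
    inner ℝ ξ (EuclideanSpace.single i (1 : ℝ)) = ξ i := by
  rw [EuclideanSpace.inner_single_right]
  simp

theorem HasGradient.fourier_integral {φ : H n} {g : Rn n × ℝ → ℂ} {k : Fin n → Rn n × ℝ → ℂ}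
    (hg : HasGradient φ g k) {θ : ℝ → ℝ} (hθ : ContDiff ℝ ∞ θ) (hθc : HasCompactSupport θ)
    (hθs : tsupport θ ⊆ Ioi 0) (i : Fin n) :
    ((𝓕 (∫ z in Ioi 0, θ z • slice (k i) z : L2 n) : L2 n) : Rn n → ℂ) =ᵐ[volume]
      fun ξ => (2 * Real.pi * Complex.I * (ξ i : ℝ)) *
        (𝓕 (∫ z in Ioi 0, θ z • slice φ z : L2 n) : L2 n) ξ := by
  have hφ := weightedSq_coe φ
  have := fourier_ae_eq_of_weak_divergence (ι := Unit) (e := fun _ => EuclideanSpace.single i (1 : ℝ))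
    (Y := fun _ => ∫ z in Ioi 0, θ z • slice φ z) (Z := ∫ z in Ioi 0, θ z • slice (k i) z)
    fun h hh hc => ?_
  · simpa [inner_single_one] using this
  · obtain ⟨h1, h2, h3, h4⟩ := prod_test hθ hθc hθs hh hc
    have := (hg.2 i).1.2.2 _ h1 h2 h3
    simp only [h4, zero_mul, zero_add] at this
    rw [setIntegral_prod_smul (h := fun x => fderiv ℝ h x (EuclideanSpace.single i 1)) hφ.isSlices
        hθ.continuous.measurable (hφ.integrableOn_test hθ.continuous hθc hθs)
        ((hh.continuous_fderiv (by simp)).clm_apply continuous_const) (hc.fderiv_apply ℝ _),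
      setIntegral_prod_smul (hg.2 i).2.isSlices hθ.continuous.measurable
        ((hg.2 i).2.integrableOn_test hθ.continuous hθc hθs) hh.continuous hc] at this
    simpa using this

/-- The square of the frequency. -/
def freqSq (ξ : Rn n) : ℝ := (2 * Real.pi * ‖ξ‖) ^ 2

theorem freqSq_nonneg (ξ : Rn n) : 0 ≤ freqSq ξ := sq_nonneg _

theorem continuous_freqSq : Continuous (freqSq : Rn n → ℝ) := by
  unfold freqSq
  fun_prop

theorem sum_freq_sq (ξ : Rn n) : ∑ i, (2 * Real.pi * Complex.I * (ξ i : ℝ)) ^ 2 = -((freqSq ξ : ℝ) : ℂ) := by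
  have h : freqSq ξ = ∑ i, (2 * Real.pi) ^ 2 * ξ i ^ 2 := by
    rw [freqSq, mul_pow, EuclideanSpace.real_norm_sq_eq, Finset.mul_sum]
  rw [h, Complex.ofReal_sum, ← Finset.sum_neg_distrib]
  refine Finset.sum_congr rfl fun i _ => ?_
  push_cast
  rw [mul_pow, mul_pow, mul_pow, Complex.I_sq]
  ring

/-- The equation `Aφ = ψ`, Fourier transformed and tested in `z`. -/
theorem IsImageA.fourier_integral {φ ψ : H n} (h : IsImageA n φ ψ) {g : Rn n × ℝ → ℂ}
    {k : Fin n → Rn n × ℝ → ℂ} (hg : HasGradient φ g k) {θ : ℝ → ℝ} (hθ : ContDiff ℝ ∞ θ)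
    (hθc : HasCompactSupport θ) (hθs : tsupport θ ⊆ Ioi 0) :
    ((𝓕 ((∫ z in Ioi 0, (z * deriv θ z) • slice g z) - ∫ z in Ioi 0, (z * θ z) • slice ψ z : L2 n) : L2 n)
      : Rn n → ℂ) =ᵐ[volume] fun ξ => -((freqSq ξ : ℝ) : ℂ) *
        (𝓕 (∫ z in Ioi 0, (z ^ (-(1 / (n : ℝ))) * θ z) • slice φ z : L2 n) : L2 n) ξ := by
  obtain ⟨hd, hdc, hds⟩ := deriv_test hθ hθc hθs
  obtain ⟨hr, hrc, hrs⟩ := rpow_mul_test hθ hθc hθs (-(1 / (n : ℝ)))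
  have hψ := weightedSq_coe ψ
  have hzd : HasCompactSupport fun z => z * deriv θ z := hdc.mul_left
  have hzds : tsupport (fun z => z * deriv θ z) ⊆ Ioi 0 := tsupport_mul_subset_right.trans hds
  have hzdc : Continuous fun z => z * deriv θ z := continuous_id.mul hd.continuous
  have hzθ : HasCompactSupport fun z => z * θ z := hθc.mul_left
  have hzθs : tsupport (fun z => z * θ z) ⊆ Ioi 0 := tsupport_mul_subset_right.trans hθs
  have hzθc : Continuous fun z => z * θ z := continuous_id.mul hθ.continuous
  -- For fixed `θ`, the weak equation says that the horizontal field with components `Y i` has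
  -- divergence `Z`. The transform of each `Y i` is in turn `2πi ξ_i` times that of a `z`-integral
  -- of `φ`, and the squares of these symbols add up to `-|2πξ|²`.
  have key := fourier_ae_eq_of_weak_divergence (e := fun i => EuclideanSpace.single i (1 : ℝ))
    (Y := fun i => ∫ z in Ioi 0, (z ^ (-(1 / (n : ℝ))) * θ z) • slice (k i) z)
    (Z := (∫ z in Ioi 0, (z * deriv θ z) • slice g z) - ∫ z in Ioi 0, (z * θ z) • slice ψ z)
    fun f hf hc => ?_
  · have hb := fun i => hg.fourier_integral hr hrc hrs i
    filter_upwards [key, ae_all_iff.2 hb] with ξ h1 h2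
    rw [h1, ← sum_freq_sq, Finset.sum_mul]
    refine Finset.sum_congr rfl fun i _ => ?_
    rw [h2, inner_single_one]
    ring
  · obtain ⟨h1, h2, h3, h4⟩ := prod_test hθ hθc hθs hf hc
    have hw := h.weak_eq hg h1 h2 h3
    simp only [h4, one_mul, zero_mul, zero_add, map_zero, mul_zero, add_zero, ← mul_assoc] at hw
    rw [setIntegral_prod_smul hg.1.2.isSlices hzdc.measurable
        (hg.1.2.integrableOn_test hzdc hzd hzds) hf.continuous hc,
      setIntegral_prod_smul hψ.isSlices hzθc.measurable
        (hψ.integrableOn_test hzθc hzθ hzθs) hf.continuous hc,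
      Finset.sum_congr rfl fun i _ => setIntegral_prod_smul
        (θ := fun z => z ^ (-(1 / (n : ℝ))) * θ z)
        (h := fun x => fderiv ℝ f x (EuclideanSpace.single i 1)) (hg.2 i).2.isSlices
        hr.continuous.measurable ((hg.2 i).2.integrableOn_test hr.continuous hrc hrs)
        ((hf.continuous_fderiv (by simp)).clm_apply continuous_const) (hc.fderiv_apply ℝ _)] at hw
    have hf2 : MemLp f 2 volume := hf.continuous.memLp_of_hasCompactSupport hc
    have e : ∫ x, f x • ((∫ z in Ioi 0, (z * deriv θ z) • slice g z)
        - ∫ z in Ioi 0, (z * θ z) • slice ψ z : L2 n) x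
        = (∫ x, f x • (∫ z in Ioi 0, (z * deriv θ z) • slice g z : L2 n) x)
          - ∫ x, f x • (∫ z in Ioi 0, (z * θ z) • slice ψ z : L2 n) x := by
      rw [← integral_sub (integrable_smul_L2 hf2 _) (integrable_smul_L2 hf2 _)]
      refine integral_congr_ae ?_
      filter_upwards [Lp.coeFn_sub (∫ z in Ioi 0, (z * deriv θ z) • slice g z : L2 n)
        (∫ z in Ioi 0, (z * θ z) • slice ψ z : L2 n)] with x hx
      rw [hx, Pi.sub_apply, smul_sub]
    rw [e, ← hw]
    ring

end TaubWave
end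

noncomputable section
namespace TaubWave

variable {n : ℕ}

/-! ### Multiplication operators and the Fourier transform on `L²(ℝⁿ)` -/

/-- Multiplication by a bounded function. -/
def mulOp (m : Rn n → ℂ) (hm : MemLp m ⊤ volume) : L2 n →L[ℂ] L2 n :=
  (ContinuousLinearMap.mul ℂ ℂ).holderL volume ⊤ 2 2 (hm.toLp m)

theorem coeFn_mulOp {m : Rn n → ℂ} (hm : MemLp m ⊤ volume) (f : L2 n) :
    (mulOp m hm f : Rn n → ℂ) =ᵐ[volume] fun ξ => m ξ * f ξ := by
  have h := (ContinuousLinearMap.mul ℂ ℂ).coeFn_holder (r := 2) (hm.toLp m) f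
  filter_upwards [h, hm.coeFn_toLp] with x h1 h2
  rw [← h2]
  exact h1

theorem memLp_top_of_continuous_of_norm_le {m : Rn n → ℂ} (hm : Continuous m) {C : ℝ}
    (hC : ∀ ξ, ‖m ξ‖ ≤ C) : MemLp m ⊤ volume :=
  memLp_top_of_bound hm.aestronglyMeasurable C (Eventually.of_forall hC)

/-- The Fourier transform as a continuous linear map. -/
def fourierL (n : ℕ) : L2 n →L[ℂ] L2 n :=
  (Lp.fourierTransformₗᵢ (Rn n) ℂ).toContinuousLinearEquiv.toContinuousLinearMap

theorem fourierL_apply (f : L2 n) : fourierL n f = 𝓕 f := rfl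

theorem fourier_setIntegral_smul {X : ℝ → L2 n} {θ : ℝ → ℝ}
    (h : IntegrableOn (fun z => θ z • X z) (Ioi 0)) :
    (𝓕 (∫ z in Ioi 0, θ z • X z : L2 n) : L2 n) = ∫ z in Ioi 0, θ z • (𝓕 (X z) : L2 n) := by
  have := (fourierL n).integral_comp_comm h
  rw [← fourierL_apply, ← this]
  refine integral_congr_ae (Eventually.of_forall fun z => ?_)
  exact ((fourierL n).restrictScalars ℝ).map_smul (θ z) (X z)

theorem enorm_fourier (f : L2 n) : ‖(𝓕 f : L2 n)‖ₑ = ‖f‖ₑ := by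
  rw [← ofReal_norm, ← ofReal_norm, Lp.norm_fourier_eq]

theorem IsSlices.mulOp {τ : Measure ℝ} [SFinite τ] {f : Rn n × ℝ → ℂ} {X : ℝ → L2 n}
    (h : IsSlices τ f X) {m : Rn n → ℂ} (hc : Continuous m) (hm : MemLp m ⊤ volume) :
    IsSlices τ (fun p => m p.1 * f p) (fun z => mulOp m hm (X z)) := by
  refine ⟨(hc.comp continuous_fst).aestronglyMeasurable.mul h.1,
    (TaubWave.mulOp m hm).continuous.comp_aestronglyMeasurable h.2.1, ?_⟩
  filter_upwards [h.2.2] with z hz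
  filter_upwards [hz, coeFn_mulOp hm (X z)] with x h1 h2
  rw [h2, h1]

theorem IsSlices.sub {τ : Measure ℝ} [SFinite τ] {f g : Rn n × ℝ → ℂ} {X Y : ℝ → L2 n}
    (h : IsSlices τ f X) (h' : IsSlices τ g Y) :
    IsSlices τ (fun p => f p - g p) (fun z => X z - Y z) := by
  refine ⟨h.1.sub h'.1, h.2.1.sub h'.2.1, ?_⟩
  filter_upwards [h.2.2, h'.2.2] with z hz hz'
  filter_upwards [hz, hz', Lp.coeFn_sub (X z) (Y z)] with x h1 h2 h3
  rw [h3, Pi.sub_apply, h1, h2]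

/-- A jointly measurable version of the partial Fourier transform. -/
theorem WeightedSq.exists_fourier {r : ℝ} {f : Rn n × ℝ → ℂ} (h : WeightedSq n r f) :
    ∃ F : Rn n × ℝ → ℂ, StronglyMeasurable F ∧
      IsSlices (volume.restrict (Ioi 0)) F (fun z => 𝓕 (slice f z)) ∧
      LocallyIntegrableOn (fun z => (𝓕 (slice f z) : L2 n)) (Ioi 0) ∧
      ∫⁻ p, ENNReal.ofReal (p.2 ^ r) * ‖F p‖ₑ ^ 2
        ∂((volume : Measure (Rn n)).prod (volume.restrict (Ioi 0)))
      = ∫⁻ p in halfSpace n, ENNReal.ofReal (p.2 ^ r) * ‖f p‖ₑ ^ 2 := by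
  have hm : AEStronglyMeasurable (fun z => (𝓕 (slice f z) : L2 n)) (volume.restrict (Ioi 0)) :=
    (fourierL n).continuous.comp_aestronglyMeasurable h.isSlices.2.1
  obtain ⟨F, hF, hFs⟩ := exists_isSlices hm
  have e : ∫⁻ z in Ioi 0, ENNReal.ofReal (z ^ r) * ‖(𝓕 (slice f z) : L2 n)‖ₑ ^ 2
      = ∫⁻ p in halfSpace n, ENNReal.ofReal (p.2 ^ r) * ‖f p‖ₑ ^ 2 := by
    simp only [enorm_fourier]
    exact h.lintegral_slice
  refine ⟨F, hF, hFs, locallyIntegrableOn_of_lintegral_rpow (r := r) hm (by rw [e]; exact h.2), ?_⟩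
  rw [← e]
  exact hFs.lintegral_eq (ρ := fun z => ENNReal.ofReal (z ^ r)) (by fun_prop)

/-! ### Pointwise primitives -/

theorem locallyIntegrableOn_Ioi_of_forall {f : ℝ → ℂ}
    (h : ∀ k : ℕ, IntegrableOn f (Icc (1 / ((k : ℝ) + 1)) (k + 1))) :
    LocallyIntegrableOn f (Ioi 0) := by
  intro z hz
  obtain ⟨k, hk⟩ := exists_nat_gt (max z (1 / z))
  have hz0 : (0 : ℝ) < z := hz
  have hk1 : 1 / z < (k : ℝ) + 1 := (le_max_right _ _).trans_lt (hk.trans (by linarith))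
  refine ⟨_, mem_nhdsWithin_of_mem_nhds (Icc_mem_nhds ?_ ?_), h k⟩
  · rw [div_lt_comm₀ (by positivity) hz0]
    exact hk1
  · exact (le_max_left _ _).trans_lt (hk.trans (by linarith))

theorem restrict_Icc_le {α β : ℝ} (hα : 0 < α) :
    (volume : Measure ℝ).restrict (Icc α β) ≪ volume.restrict (Ioi 0) :=
  (Measure.restrict_mono (fun _ hz => hα.trans_le hz.1) le_rfl).absolutelyContinuous

theorem IsSlices.ae_locallyIntegrableOn {f : Rn n × ℝ → ℂ} {X : ℝ → L2 n}
    (h : IsSlices (volume.restrict (Ioi 0)) f X) (hX : LocallyIntegrableOn X (Ioi 0)) :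
    ∀ᵐ ξ ∂(volume : Measure (Rn n)), LocallyIntegrableOn (fun z => f (ξ, z)) (Ioi 0) := by
  have h1 : ∀ k : ℕ, ∀ᵐ ξ ∂(volume : Measure (Rn n)),
      IntegrableOn (fun z => f (ξ, z)) (Icc (1 / ((k : ℝ) + 1)) (k + 1)) := fun k => by
    have hk : (0 : ℝ) < 1 / ((k : ℝ) + 1) := by positivity
    exact (h.mono (restrict_Icc_le hk)).ae_integrable
      (hX.integrableOn_compact_subset (fun z hz => hk.trans_le hz.1) isCompact_Icc)
  filter_upwards [ae_all_iff.2 h1] with ξ hξ using locallyIntegrableOn_Ioi_of_forall hξ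

theorem IsSlices.coeFn_intervalIntegral {f : Rn n × ℝ → ℂ} {X : ℝ → L2 n}
    (h : IsSlices (volume.restrict (Ioi 0)) f X) (hX : LocallyIntegrableOn X (Ioi 0)) {z : ℝ}
    (hz : 0 < z) : ((∫ s in (1 : ℝ)..z, X s : L2 n) : Rn n → ℂ) =ᵐ[volume]
      fun ξ => ∫ s in (1 : ℝ)..z, f (ξ, s) := by
  have h1 : ∀ α β : ℝ, 0 < α → ((∫ s in Ioc α β, X s : L2 n) : Rn n → ℂ) =ᵐ[volume]
      fun ξ => ∫ s in Ioc α β, f (ξ, s) := by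
    intro α β hα
    have hi : IntegrableOn X (Ioc α β) :=
      (hX.integrableOn_compact_subset (fun z hz => hα.trans_le hz.1) isCompact_Icc).mono_set
        Ioc_subset_Icc_self
    exact (h.mono ((Measure.restrict_mono Ioc_subset_Icc_self le_rfl).absolutelyContinuous.trans
      (restrict_Icc_le hα))).coeFn_integral hi
  simp only [intervalIntegral]
  filter_upwards [h1 1 z one_pos, h1 z 1 hz, Lp.coeFn_sub (∫ s in Ioc 1 z, X s : L2 n)
    (∫ s in Ioc z 1, X s : L2 n)] with ξ h2 h3 h4
  rw [h4, Pi.sub_apply, h2, h3]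

theorem stronglyMeasurable_primitive {f : Rn n × ℝ → ℂ} (hf : StronglyMeasurable f) :
    StronglyMeasurable fun p : Rn n × ℝ => ∫ s in (1 : ℝ)..p.2, f (p.1, s) := by
  have hg : StronglyMeasurable fun q : (Rn n × ℝ) × ℝ => f (q.1.1, q.2) :=
    hf.comp_measurable (by fun_prop)
  have h1 : MeasurableSet {q : (Rn n × ℝ) × ℝ | 1 < q.2 ∧ q.2 ≤ q.1.2} :=
    (measurableSet_lt measurable_const measurable_snd).inter
      (measurableSet_le measurable_snd (by fun_prop))
  have h2 : MeasurableSet {q : (Rn n × ℝ) × ℝ | q.1.2 < q.2 ∧ q.2 ≤ 1} :=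
    (measurableSet_lt (by fun_prop) measurable_snd).inter
      (measurableSet_le measurable_snd measurable_const)
  have h3 := ((hg.indicator h1).integral_prod_right' (ν := volume)).sub
    ((hg.indicator h2).integral_prod_right' (ν := volume))
  refine (congrArg StronglyMeasurable ?_).mpr h3
  ext p
  simp only [intervalIntegral, Pi.sub_apply]
  rw [← integral_indicator measurableSet_Ioc, ← integral_indicator measurableSet_Ioc]
  rfl

/-- Here an identity in `L²(ℝⁿ)` for almost every `z` becomes a scalar identity in `z` for almost
every `ξ`. The exchange of the two quantifiers rests on the joint measurability of both sides. -/
theorem ae_ae_eq_primitive {f g : Rn n × ℝ → ℂ} {X Y : ℝ → L2 n} (hf : StronglyMeasurable f)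
    (hg : StronglyMeasurable g) (hfX : IsSlices (volume.restrict (Ioi 0)) f X)
    (hgY : IsSlices (volume.restrict (Ioi 0)) g Y) (hY : LocallyIntegrableOn Y (Ioi 0)) {c : L2 n}
    (h : ∀ᵐ z ∂(volume.restrict (Ioi (0 : ℝ))), X z = c + ∫ s in (1 : ℝ)..z, Y s) :
    ∀ᵐ ξ ∂(volume : Measure (Rn n)), ∀ᵐ z ∂(volume.restrict (Ioi (0 : ℝ))),
      f (ξ, z) = c ξ + ∫ s in (1 : ℝ)..z, g (ξ, s) := by
  have hm : MeasurableSet {p : Rn n × ℝ | f (p.1, p.2) = c p.1 + ∫ s in (1 : ℝ)..p.2, g (p.1, s)} :=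
    measurableSet_eq_fun hf.measurable (((Lp.stronglyMeasurable c).measurable.comp measurable_fst).add
      (stronglyMeasurable_primitive hg).measurable)
  rw [Measure.ae_ae_comm (p := fun ξ z => f (ξ, z) = c ξ + ∫ s in (1 : ℝ)..z, g (ξ, s)) hm]
  filter_upwards [h, hfX.2.2, ae_restrict_mem measurableSet_Ioi] with z h1 h2 hz
  filter_upwards [h2, hgY.coeFn_intervalIntegral hY hz, Lp.coeFn_add c (∫ s in (1 : ℝ)..z, Y s)]
    with ξ h3 h4 h5
  rw [← h3, h1, h5, Pi.add_apply, h4]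

theorem ae_integrableOn_of_lintegral_lt_top {f : Rn n × ℝ → ℂ} (hf : StronglyMeasurable f) {r : ℝ}
    (h : ∫⁻ p, ENNReal.ofReal (p.2 ^ r) * ‖f p‖ₑ ^ 2
      ∂((volume : Measure (Rn n)).prod (volume.restrict (Ioi 0))) < ⊤) :
    ∀ᵐ ξ ∂(volume : Measure (Rn n)), IntegrableOn (fun s => s ^ r * ‖f (ξ, s)‖ ^ 2) (Ioi 0) := by
  have hm : Measurable fun p : Rn n × ℝ => ENNReal.ofReal (p.2 ^ r) * ‖f p‖ₑ ^ 2 := by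
    have := hf.measurable
    fun_prop
  rw [lintegral_prod _ hm.aemeasurable] at h
  have hfx : ∀ ξ, Measurable fun s => f (ξ, s) := fun ξ => hf.measurable.comp measurable_prodMk_left
  filter_upwards [ae_lt_top' (Measurable.lintegral_prod_right' hm).aemeasurable h.ne] with ξ hξ
  refine ⟨?_, ?_⟩
  · have := hfx ξ
    exact Measurable.aestronglyMeasurable (by fun_prop)
  · rw [HasFiniteIntegral]
    refine lt_of_le_of_lt (lintegral_mono_ae ?_) hξ
    filter_upwards [ae_restrict_mem measurableSet_Ioi] with s hs
    rw [enorm_mul, enorm_pow, enorm_norm, Real.enorm_of_nonneg (Real.rpow_nonneg (le_of_lt hs) r)]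

/-- Tonelli. Together with Plancherel it makes the radial norm, as a function of `ξ`, an `L²`
majorant whose norm is the norm in `H`. -/
theorem lintegral_radialNorm_sq {f : Rn n × ℝ → ℂ} (hf : StronglyMeasurable f)
    (h : ∫⁻ p, ENNReal.ofReal (p.2 ^ (1 : ℝ)) * ‖f p‖ₑ ^ 2
      ∂((volume : Measure (Rn n)).prod (volume.restrict (Ioi 0))) < ⊤) :
    ∫⁻ ξ : Rn n, ‖radialNorm fun s => f (ξ, s)‖ₑ ^ 2
      = ∫⁻ p, ENNReal.ofReal (p.2 ^ (1 : ℝ)) * ‖f p‖ₑ ^ 2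
      ∂((volume : Measure (Rn n)).prod (volume.restrict (Ioi 0))) := by
  have hm : Measurable fun p : Rn n × ℝ => ENNReal.ofReal (p.2 ^ (1 : ℝ)) * ‖f p‖ₑ ^ 2 := by
    have := hf.measurable
    fun_prop
  rw [lintegral_prod _ hm.aemeasurable]
  refine lintegral_congr_ae ?_
  filter_upwards [ae_integrableOn_of_lintegral_lt_top hf h] with ξ hξ
  simp only [Real.rpow_one] at hξ ⊢
  have h0 : 0 ≤ᵐ[volume.restrict (Ioi 0)] fun s => s * ‖f (ξ, s)‖ ^ 2 := by
    filter_upwards [ae_restrict_mem measurableSet_Ioi] with s hs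
    exact mul_nonneg (le_of_lt hs) (sq_nonneg _)
  rw [← enorm_pow, radialNorm, Real.sq_sqrt (integral_nonneg_of_ae h0),
    Real.enorm_of_nonneg (integral_nonneg_of_ae h0), ofReal_integral_eq_lintegral_ofReal hξ h0]
  refine setLIntegral_congr_fun measurableSet_Ioi fun s hs => ?_
  rw [ENNReal.ofReal_mul (le_of_lt hs), ENNReal.ofReal_pow (norm_nonneg _), ofReal_norm]

theorem measurable_radialNorm {f : Rn n × ℝ → ℂ} (hf : StronglyMeasurable f) :
    Measurable fun ξ : Rn n => radialNorm fun s => f (ξ, s) := by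
  have h1 : StronglyMeasurable fun p : Rn n × ℝ => p.2 * ‖f p‖ ^ 2 := by
    have := hf.measurable
    exact Measurable.stronglyMeasurable (by fun_prop)
  exact (h1.integral_prod_right' (ν := volume.restrict (Ioi 0))).measurable.sqrt

theorem radialNorm_congr {f g : ℝ → ℂ} (h : f =ᵐ[volume.restrict (Ioi 0)] g) :
    radialNorm f = radialNorm g := by
  rw [radialNorm, radialNorm]
  congr 1
  exact integral_congr_ae (h.mono fun s hs => by simp only [hs])

end TaubWave
end

/-! ### The radial equation at almost every frequency -/

noncomputable section
namespace TaubWave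

variable {n : ℕ}

theorem locallyIntegrableOn_mulOp {X : ℝ → L2 n} (hX : LocallyIntegrableOn X (Ioi 0))
    {m : Rn n → ℂ} (hm : MemLp m ⊤ volume) :
    LocallyIntegrableOn (fun z => mulOp m hm (X z)) (Ioi 0) := by
  rw [locallyIntegrableOn_iff isOpen_Ioi.isLocallyClosed] at hX ⊢
  exact fun K hKs hK => (mulOp m hm).integrable_comp (hX K hKs hK)

theorem setIntegral_smul_mulOp {X : ℝ → L2 n} {θ : ℝ → ℝ}
    (h : IntegrableOn (fun z => θ z • X z) (Ioi 0)) {m : Rn n → ℂ} (hm : MemLp m ⊤ volume) :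
    ∫ z in Ioi 0, θ z • mulOp m hm (X z) = mulOp m hm (∫ z in Ioi 0, θ z • X z) := by
  rw [← (mulOp m hm).integral_comp_comm h]
  refine integral_congr_ae (Eventually.of_forall fun z => ?_)
  exact (((mulOp m hm).restrictScalars ℝ).map_smul (θ z) (X z)).symm

/-- The partial Fourier transform of an element of the energy space is a primitive. -/
theorem HasGradient.exists_fourier_primitive {φ : H n} {g : Rn n × ℝ → ℂ}
    {k : Fin n → Rn n × ℝ → ℂ} (hg : HasGradient φ g k) : ∃ c : L2 n,
      ∀ᵐ z ∂(volume.restrict (Ioi (0 : ℝ))), (𝓕 (slice φ z) : L2 n)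
        = c + ∫ s in (1 : ℝ)..z, (𝓕 (slice g s) : L2 n) := by
  have hφ := weightedSq_coe φ
  obtain ⟨-, -, -, hFl, -⟩ := hφ.exists_fourier
  obtain ⟨-, -, -, hGl, -⟩ := hg.1.2.exists_fourier
  refine exists_ae_eq_const_add_integral hFl hGl fun θ hθ hθc hθs => ?_
  obtain ⟨hd, hdc, hds⟩ := deriv_test hθ hθc hθs
  rw [← fourier_setIntegral_smul (hφ.integrableOn_test hd.continuous hdc hds),
    ← fourier_setIntegral_smul (hg.1.2.integrableOn_test hθ.continuous hθc hθs),
    hg.integral_deriv_smul hθ hθc hθs, ← fourierL_apply, ← fourierL_apply, map_neg]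

/-- The reciprocal `1 / (1 + |2πξ|²)`. -/
def resolventSymbol (ξ : Rn n) : ℂ := ((1 / (1 + freqSq ξ) : ℝ) : ℂ)

theorem continuous_resolventSymbol : Continuous (resolventSymbol : Rn n → ℂ) := by
  refine Complex.continuous_ofReal.comp (continuous_const.div
    (continuous_const.add continuous_freqSq) fun ξ => ?_)
  linarith [freqSq_nonneg ξ]

theorem memLp_resolventSymbol : MemLp (resolventSymbol : Rn n → ℂ) ⊤ volume := by
  refine memLp_top_of_continuous_of_norm_le continuous_resolventSymbol (C := 1) fun ξ => ?_
  have := freqSq_nonneg ξ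
  rw [resolventSymbol, Complex.norm_real, Real.norm_of_nonneg (by positivity),
    div_le_one (by positivity)]
  linarith

theorem memLp_freqSq_mul_resolventSymbol :
    MemLp (fun ξ : Rn n => ((freqSq ξ : ℝ) : ℂ) * resolventSymbol ξ) ⊤ volume := by
  refine memLp_top_of_continuous_of_norm_le ((Complex.continuous_ofReal.comp continuous_freqSq).mul
    continuous_resolventSymbol) (C := 1) fun ξ => ?_
  have := freqSq_nonneg ξ
  rw [resolventSymbol, ← Complex.ofReal_mul, Complex.norm_real, Real.norm_of_nonneg (by positivity),
    mul_one_div, div_le_one (by positivity)]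
  linarith

theorem resolventSymbol_mul (ξ : Rn n) : ((1 + freqSq ξ : ℝ) : ℂ) * resolventSymbol ξ = 1 := by
  have := freqSq_nonneg ξ
  rw [resolventSymbol, ← Complex.ofReal_mul, mul_one_div_cancel (by positivity), Complex.ofReal_one]

/-- The symbol `|2πξ|²` is unbounded on `L²(ℝⁿ)`. Dividing the equation by `1 + |2πξ|²` leaves only
bounded multipliers, and the du Bois-Reymond lemma for `L²`-valued functions applies. -/
theorem IsImageA.exists_fourier_flux {φ ψ : H n} (h : IsImageA n φ ψ) {g : Rn n × ℝ → ℂ}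
    {k : Fin n → Rn n × ℝ → ℂ} (hg : HasGradient φ g k) : ∃ c : L2 n,
      ∀ᵐ z ∂(volume.restrict (Ioi (0 : ℝ))),
        mulOp _ memLp_resolventSymbol (z • (𝓕 (slice g z) : L2 n))
        = c + ∫ s in (1 : ℝ)..z, (mulOp _ memLp_freqSq_mul_resolventSymbol
            (s ^ (-(1 / (n : ℝ))) • (𝓕 (slice φ s) : L2 n))
          - mulOp _ memLp_resolventSymbol (s • (𝓕 (slice ψ s) : L2 n))) := by
  have hφ := weightedSq_coe φ
  have hψ := weightedSq_coe ψ
  obtain ⟨-, -, -, hFl, -⟩ := hφ.exists_fourier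
  obtain ⟨-, -, -, hGl, -⟩ := hg.1.2.exists_fourier
  obtain ⟨-, -, -, hPl, -⟩ := hψ.exists_fourier
  have hGz : LocallyIntegrableOn (fun z => z • (𝓕 (slice g z) : L2 n)) (Ioi 0) :=
    hGl.continuousOn_smul isOpen_Ioi.isLocallyClosed continuousOn_id
  have hPz : LocallyIntegrableOn (fun z => z • (𝓕 (slice ψ z) : L2 n)) (Ioi 0) :=
    hPl.continuousOn_smul isOpen_Ioi.isLocallyClosed continuousOn_id
  have hFz : LocallyIntegrableOn (fun z => z ^ (-(1 / (n : ℝ))) • (𝓕 (slice φ z) : L2 n)) (Ioi 0) :=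
    hFl.continuousOn_smul isOpen_Ioi.isLocallyClosed
      (continuousOn_id.rpow_const fun z hz => Or.inl (ne_of_gt hz))
  refine exists_ae_eq_const_add_integral (locallyIntegrableOn_mulOp hGz _)
    ((locallyIntegrableOn_mulOp hFz _).sub (locallyIntegrableOn_mulOp hPz _)) fun θ hθ hθc hθs => ?_
  obtain ⟨hd, hdc, hds⟩ := deriv_test hθ hθc hθs
  obtain ⟨hr, hrc, hrs⟩ := rpow_mul_test hθ hθc hθs (-(1 / (n : ℝ)))
  have iG := integrableOn_smul_of_locallyIntegrableOn hGz hd.continuous hdc hds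
  have iF := integrableOn_smul_of_locallyIntegrableOn hFz hθ.continuous hθc hθs
  have iP := integrableOn_smul_of_locallyIntegrableOn hPz hθ.continuous hθc hθs
  have iF' := integrableOn_smul_of_locallyIntegrableOn
    (locallyIntegrableOn_mulOp hFz memLp_freqSq_mul_resolventSymbol) hθ.continuous hθc hθs
  have iP' := integrableOn_smul_of_locallyIntegrableOn
    (locallyIntegrableOn_mulOp hPz memLp_resolventSymbol) hθ.continuous hθc hθs
  simp only [smul_sub]
  rw [integral_sub iF' iP', setIntegral_smul_mulOp iG, setIntegral_smul_mulOp iF,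
    setIntegral_smul_mulOp iP]
  have key := h.fourier_integral hg hθ hθc hθs
  have e1 : ∫ z in Ioi 0, deriv θ z • z • (𝓕 (slice g z) : L2 n)
      = 𝓕 (∫ z in Ioi 0, (z * deriv θ z) • slice g z : L2 n) := by
    rw [fourier_setIntegral_smul (hg.1.2.integrableOn_test (θ := fun z => z * deriv θ z) (continuous_id.mul hd.continuous)
      hdc.mul_left (tsupport_mul_subset_right.trans hds))]
    simp only [smul_smul, mul_comm]
  have e2 : ∫ z in Ioi 0, θ z • z • (𝓕 (slice ψ z) : L2 n)
      = 𝓕 (∫ z in Ioi 0, (z * θ z) • slice ψ z : L2 n) := by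
    rw [fourier_setIntegral_smul (hψ.integrableOn_test (θ := fun z => z * θ z) (continuous_id.mul hθ.continuous)
      hθc.mul_left (tsupport_mul_subset_right.trans hθs))]
    simp only [smul_smul, mul_comm]
  have e3 : ∫ z in Ioi 0, θ z • z ^ (-(1 / (n : ℝ))) • (𝓕 (slice φ z) : L2 n)
      = 𝓕 (∫ z in Ioi 0, (z ^ (-(1 / (n : ℝ))) * θ z) • slice φ z : L2 n) := by
    rw [fourier_setIntegral_smul (hφ.integrableOn_test hr.continuous hrc hrs)]
    simp only [smul_smul, mul_comm]
  rw [e1, e2, e3]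
  set A : L2 n := ∫ z in Ioi 0, (z * deriv θ z) • slice g z
  set B : L2 n := ∫ z in Ioi 0, (z * θ z) • slice ψ z
  set C : L2 n := ∫ z in Ioi 0, (z ^ (-(1 / (n : ℝ))) * θ z) • slice φ z
  rw [← fourierL_apply, map_sub] at key
  rw [← fourierL_apply, ← fourierL_apply, ← fourierL_apply]
  refine Lp.ext ?_
  filter_upwards [key, Lp.coeFn_sub (fourierL n A) (fourierL n B),
    coeFn_mulOp memLp_resolventSymbol (fourierL n A), coeFn_mulOp memLp_resolventSymbol (fourierL n B),
    coeFn_mulOp memLp_freqSq_mul_resolventSymbol (fourierL n C),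
    Lp.coeFn_neg (mulOp _ memLp_freqSq_mul_resolventSymbol (fourierL n C)
      - mulOp _ memLp_resolventSymbol (fourierL n B)),
    Lp.coeFn_sub (mulOp _ memLp_freqSq_mul_resolventSymbol (fourierL n C))
      (mulOp _ memLp_resolventSymbol (fourierL n B))] with ξ h1 h2 h3 h4 h5 h6 h7
  rw [h3, h6, Pi.neg_apply, h7, Pi.sub_apply, h4, h5]
  rw [h2, Pi.sub_apply, sub_eq_iff_eq_add, ← fourierL_apply] at h1
  rw [h1]
  ring

theorem interval_congr_Ioi {f g : ℝ → ℂ} (h : f =ᵐ[volume.restrict (Ioi 0)] g) {x y : ℝ}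
    (hx : 0 < x) (hy : 0 < y) : ∫ s in x..y, f s = ∫ s in x..y, g s := by
  refine intervalIntegral.integral_congr_ae ?_
  rw [EventuallyEq, ae_restrict_iff' measurableSet_Ioi] at h
  filter_upwards [h] with s hs hsm
  exact hs (lt_trans (lt_min hx hy) (by rw [uIoc, mem_Ioc] at hsm; exact hsm.1))

/-- The partial Fourier transform of `φ ∈ D`: for almost every frequency a solution of a Bessel type
equation. -/
theorem IsImageA.exists_radialSolution {φ ψ : H n} (h : IsImageA n φ ψ) :
    ∃ U W P : Rn n × ℝ → ℂ, StronglyMeasurable U ∧ StronglyMeasurable W ∧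
      (∀ᵐ ξ ∂(volume : Measure (Rn n)), RadialSolution (1 - 1 / (n : ℝ)) (freqSq ξ)
        (fun z => U (ξ, z)) (fun z => W (ξ, z)) (fun z => P (ξ, z))) ∧
      (∀ᵐ z ∂(volume.restrict (Ioi (0 : ℝ))), ((𝓕 (slice φ z) : L2 n) : Rn n → ℂ) =ᵐ[volume]
        fun ξ => U (ξ, z)) ∧
      (∀ᵐ z ∂(volume.restrict (Ioi (0 : ℝ))), ((𝓕 (slice (dz n φ) z) : L2 n) : Rn n → ℂ) =ᵐ[volume]
        fun ξ => z⁻¹ • W (ξ, z)) ∧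
      MemLp (fun ξ : Rn n => (radialNorm fun s => P (ξ, s)) + radialNorm fun s => U (ξ, s)) 2 volume ∧
      eLpNorm (fun ξ : Rn n => (radialNorm fun s => P (ξ, s)) + radialNorm fun s => U (ξ, s)) 2 volume
        ≤ ENNReal.ofReal (‖ψ‖ + ‖φ‖) := by
  have hg := hasGradient_of_mem h.1.1
  obtain ⟨c, hc⟩ := hg.exists_fourier_primitive
  obtain ⟨b, hb⟩ := h.exists_fourier_flux hg
  obtain ⟨F, hF, hFs, hFl, hFi⟩ := (weightedSq_coe φ).exists_fourier
  obtain ⟨P, hP, hPs, hPl, hPi⟩ := (weightedSq_coe ψ).exists_fourier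
  obtain ⟨G, hG, hGs, hGl, hGi⟩ := hg.1.2.exists_fourier
  have hFi' := hFi.trans_lt (weightedSq_coe φ).2
  have hPi' := hPi.trans_lt (weightedSq_coe ψ).2
  have hGi' := hGi.trans_lt hg.1.2.2
  set K : Rn n × ℝ → ℂ := fun p => ((freqSq p.1 : ℝ) : ℂ) * resolventSymbol p.1 *
    (p.2 ^ (-(1 / (n : ℝ))) • F p) - resolventSymbol p.1 * (p.2 • P p)
  have hR : Measurable (resolventSymbol : Rn n → ℂ) := continuous_resolventSymbol.measurable
  have hfm : Measurable fun ξ : Rn n => ((freqSq ξ : ℝ) : ℂ) :=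
    (Complex.continuous_ofReal.comp continuous_freqSq).measurable
  have hKm : StronglyMeasurable K := by
    have h1 := hF.measurable
    have h2 := hP.measurable
    have h3 : Measurable fun p : Rn n × ℝ => resolventSymbol p.1 := hR.comp measurable_fst
    have h4 : Measurable fun p : Rn n × ℝ => ((freqSq p.1 : ℝ) : ℂ) := hfm.comp measurable_fst
    have h5 : Measurable fun p : Rn n × ℝ => p.2 ^ (-(1 / (n : ℝ))) := by fun_prop
    exact (((h4.mul h3).mul (h5.smul h1)).sub (h3.mul (measurable_snd.smul h2))).stronglyMeasurable
  have hL : StronglyMeasurable fun p : Rn n × ℝ => resolventSymbol p.1 * (p.2 • G p) :=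
    ((hR.comp measurable_fst).mul (measurable_snd.smul hG.measurable)).stronglyMeasurable
  have hGz : LocallyIntegrableOn (fun z => z • (𝓕 (slice (dz n φ) z) : L2 n)) (Ioi 0) :=
    hGl.continuousOn_smul isOpen_Ioi.isLocallyClosed continuousOn_id
  have hPz : LocallyIntegrableOn (fun z => z • (𝓕 (slice ψ z) : L2 n)) (Ioi 0) :=
    hPl.continuousOn_smul isOpen_Ioi.isLocallyClosed continuousOn_id
  have hFz : LocallyIntegrableOn (fun z => z ^ (-(1 / (n : ℝ))) • (𝓕 (slice φ z) : L2 n)) (Ioi 0) :=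
    hFl.continuousOn_smul isOpen_Ioi.isLocallyClosed
      (continuousOn_id.rpow_const fun z hz => Or.inl (ne_of_gt hz))
  have hKl := (locallyIntegrableOn_mulOp hFz memLp_freqSq_mul_resolventSymbol).sub
    (locallyIntegrableOn_mulOp hPz memLp_resolventSymbol)
  have hKs : IsSlices (volume.restrict (Ioi 0)) K
      (fun s => mulOp _ memLp_freqSq_mul_resolventSymbol (s ^ (-(1 / (n : ℝ))) • (𝓕 (slice φ s) : L2 n))
        - mulOp _ memLp_resolventSymbol (s • (𝓕 (slice ψ s) : L2 n))) := (((hFs.smul (θ := fun z => z ^ (-(1 / (n : ℝ)))) (by fun_prop)).mulOp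
    ((Complex.continuous_ofReal.comp continuous_freqSq).mul continuous_resolventSymbol)
    memLp_freqSq_mul_resolventSymbol).sub
    ((hPs.smul (θ := fun z => z) measurable_id).mulOp continuous_resolventSymbol memLp_resolventSymbol))
  have hLs := (hGs.smul (θ := fun z => z) measurable_id).mulOp continuous_resolventSymbol
    memLp_resolventSymbol
  have hu := ae_ae_eq_primitive hF hG hFs hGs hGl hc
  have hw := ae_ae_eq_primitive hL hKm hLs hKs hKl hb
  -- The representatives `F` of `φ̂` and `z G` of `z ∂_z φ̂` are replaced by primitives, continuous
  -- in `z` for almost every `ξ`. The factor in `W` undoes the division by `1 + |2πξ|²`.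
  set U : Rn n × ℝ → ℂ := fun p => c p.1 + ∫ s in (1 : ℝ)..p.2, G (p.1, s)
  set W : Rn n × ℝ → ℂ := fun p => ((1 + freqSq p.1 : ℝ) : ℂ) *
    (b p.1 + ∫ s in (1 : ℝ)..p.2, K (p.1, s))
  have hU : StronglyMeasurable U :=
    (((Lp.stronglyMeasurable c).measurable.comp measurable_fst).add
      (stronglyMeasurable_primitive hG).measurable).stronglyMeasurable
  have hWm : Measurable fun p : Rn n × ℝ => ((1 + freqSq p.1 : ℝ) : ℂ) :=
    (Complex.continuous_ofReal.comp (continuous_const.add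
      (continuous_freqSq.comp continuous_fst))).measurable
  have hW : StronglyMeasurable W :=
    (hWm.mul (((Lp.stronglyMeasurable b).measurable.comp measurable_fst).add
      (stronglyMeasurable_primitive hKm).measurable)).stronglyMeasurable
  have hUF : ∀ᵐ ξ ∂(volume : Measure (Rn n)), (fun z => F (ξ, z)) =ᵐ[volume.restrict (Ioi 0)]
      fun z => U (ξ, z) := hu
  have hWG : ∀ᵐ ξ ∂(volume : Measure (Rn n)), (fun z => G (ξ, z)) =ᵐ[volume.restrict (Ioi 0)]
      fun z => z⁻¹ • W (ξ, z) := by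
    filter_upwards [hw] with ξ hξ
    filter_upwards [hξ, ae_restrict_mem measurableSet_Ioi] with z h1 hz
    simp only [W]
    rw [← h1, ← mul_assoc, resolventSymbol_mul, one_mul, smul_smul, inv_mul_cancel₀ (ne_of_gt hz),
      one_smul]
  have hrad : ∀ᵐ ξ ∂(volume : Measure (Rn n)), radialNorm (fun s => U (ξ, s))
      = radialNorm fun s => F (ξ, s) := hUF.mono fun ξ hξ => (radialNorm_congr hξ).symm
  have hN : ∀ᵐ ξ ∂(volume : Measure (Rn n)), (radialNorm fun s => P (ξ, s)) +
      (radialNorm fun s => U (ξ, s)) = (radialNorm fun s => P (ξ, s)) + radialNorm fun s => F (ξ, s) :=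
    hrad.mono fun ξ hξ => by rw [hξ]
  have hmem : ∀ {f : Rn n × ℝ → ℂ} (φ : H n), StronglyMeasurable f →
      ∫⁻ p, ENNReal.ofReal (p.2 ^ (1 : ℝ)) * ‖f p‖ₑ ^ 2
        ∂((volume : Measure (Rn n)).prod (volume.restrict (Ioi 0)))
      = ∫⁻ p in halfSpace n, ENNReal.ofReal (p.2 ^ (1 : ℝ)) * ‖φ p‖ₑ ^ 2 →
      eLpNorm (fun ξ : Rn n => radialNorm fun s => f (ξ, s)) 2 volume = ENNReal.ofReal ‖φ‖ := by
    intro f φ hf hfφ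
    rw [eLpNorm_two_eq, lintegral_radialNorm_sq hf (hfφ.trans_lt (weightedSq_coe φ).2), hfφ,
      ← norm_sq_H_eq, ← ENNReal.rpow_natCast, ← ENNReal.rpow_mul, ofReal_norm]
    norm_num
  have hbound : eLpNorm (fun ξ : Rn n => (radialNorm fun s => P (ξ, s)) +
      radialNorm fun s => F (ξ, s)) 2 volume ≤ ENNReal.ofReal (‖ψ‖ + ‖φ‖) := by
    rw [ENNReal.ofReal_add (norm_nonneg _) (norm_nonneg _), ← hmem ψ hP hPi, ← hmem φ hF hFi]
    exact eLpNorm_add_le (measurable_radialNorm hP).aestronglyMeasurable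
      (measurable_radialNorm hF).aestronglyMeasurable one_le_two
  refine ⟨U, W, P, hU, hW, ?_, ?_, ?_, ?_, ?_⟩
  · filter_upwards [hUF, hWG, hGs.ae_locallyIntegrableOn hGl, hKs.ae_locallyIntegrableOn hKl,
      ae_integrableOn_of_lintegral_lt_top hF hFi', ae_integrableOn_of_lintegral_lt_top hG hGi',
      ae_integrableOn_of_lintegral_lt_top hP hPi'] with ξ h1 h2 h3 h4 h5 h6 h7
    simp only [Real.rpow_one] at h5 h6 h7
    have hcw : ContinuousOn (fun z => ((1 + freqSq ξ : ℝ) : ℂ) * (b ξ + ∫ s in (1 : ℝ)..z, K (ξ, s)))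
        (Ioi 0) := ContinuousOn.mul continuousOn_const
      (ContinuousOn.add continuousOn_const (continuousOn_primitive h4))
    have hcu : ContinuousOn (fun z => c ξ + ∫ s in (1 : ℝ)..z, G (ξ, s)) (Ioi 0) :=
      ContinuousOn.add continuousOn_const (continuousOn_primitive h3)
    refine ⟨hcu, hcw,
      fun z hz => ?_, fun z hz => ?_, ?_, h7, ?_, ?_⟩
    · have : U (ξ, 1) = c ξ := by simp [U]
      rw [this, ← interval_congr_Ioi h2 one_pos hz]
    · have : W (ξ, 1) = ((1 + freqSq ξ : ℝ) : ℂ) * b ξ := by simp [W]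
      rw [this]
      simp only [W]
      rw [mul_add, ← intervalIntegral.integral_const_mul]
      congr 1
      refine interval_congr_Ioi ?_ one_pos hz
      filter_upwards [h1] with s hs
      rw [← hs]
      simp only [K]
      rw [mul_sub, ← mul_assoc, ← mul_assoc, ← mul_assoc, resolventSymbol_mul, one_mul,
        mul_comm ((1 + freqSq ξ : ℝ) : ℂ) (freqSq ξ : ℂ), mul_assoc (freqSq ξ : ℂ),
        resolventSymbol_mul, mul_one, mul_smul, Complex.real_smul (x := freqSq ξ)]
      congr 4
      ring
    · exact (hP.measurable.comp measurable_prodMk_left).aestronglyMeasurable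
    · refine h5.congr ?_
      filter_upwards [h1] with s hs
      rw [hs]
    · refine h6.congr ?_
      filter_upwards [h2, ae_restrict_mem measurableSet_Ioi] with s hs hs0
      have hs0' : (0 : ℝ) < s := hs0
      rw [hs, norm_smul, Real.norm_of_nonneg (by positivity)]
      field_simp
  · have hm : MeasurableSet {p : Rn n × ℝ | F (p.1, p.2) = U (p.1, p.2)} :=
      measurableSet_eq_fun hF.measurable hU.measurable
    have := (Measure.ae_ae_comm (p := fun ξ z => F (ξ, z) = U (ξ, z)) hm).1 hUF
    filter_upwards [this, hFs.2.2] with z h1 h2 using h2.trans h1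
  · have hm : MeasurableSet {p : Rn n × ℝ | G (p.1, p.2) = p.2⁻¹ • W (p.1, p.2)} :=
      measurableSet_eq_fun hG.measurable ((measurable_snd.inv).smul hW.measurable)
    have := (Measure.ae_ae_comm (p := fun ξ z => G (ξ, z) = z⁻¹ • W (ξ, z)) hm).1 hWG
    filter_upwards [this, hGs.2.2] with z h1 h2 using h2.trans h1
  · refine (memLp_congr_ae hN).2 ⟨((measurable_radialNorm hP).add
      (measurable_radialNorm hF)).aestronglyMeasurable, hbound.trans_lt ENNReal.ofReal_lt_top⟩
  · rw [eLpNorm_congr_ae hN]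
    exact hbound

end TaubWave
end

/-! ### From almost every frequency to `L²(ℝⁿ)` -/

noncomputable section
namespace TaubWave

variable {n : ℕ}

/-! ### Dominated convergence in `L²(ℝⁿ)` -/

/-- Dominated convergence for `‖F i - g‖ ^ 2` with majorant `(2 N) ^ 2`. The bound is needed with
both orders of the quantifiers: pointwise in `ξ` to pass to the limit `g`, and for fixed `i` under
the integral. -/
theorem tendsto_L2_of_dominated {ι : Type*} {l : Filter ι} [l.IsCountablyGenerated] [l.NeBot]
    {f : ι → L2 n} {F : ι → Rn n → ℂ} {g : L2 n} {N : Rn n → ℝ} (hN : MemLp N 2 volume)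
    (hF : ∀ᶠ i in l, (f i : Rn n → ℂ) =ᵐ[volume] F i) (hb : ∀ᵐ ξ, ∀ᶠ i in l, ‖F i ξ‖ ≤ N ξ)
    (hb' : ∀ᶠ i in l, ∀ᵐ ξ, ‖F i ξ‖ ≤ N ξ)
    (hlim : ∀ᵐ ξ, Tendsto (fun i => F i ξ) l (𝓝 (g ξ))) : Tendsto f l (𝓝 g) := by
  have hg : ∀ᵐ ξ, ‖g ξ‖ ≤ N ξ := by
    filter_upwards [hb, hlim] with ξ h1 h2
    exact le_of_tendsto h2.norm h1
  rw [tendsto_iff_edist_tendsto_0]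
  have h1 : Tendsto (fun i => ∫⁻ ξ, ‖f i ξ - g ξ‖ₑ ^ 2) l (𝓝 0) := by
    have h2 : Tendsto (fun i => ∫⁻ ξ, ‖F i ξ - g ξ‖ₑ ^ 2) l (𝓝 (∫⁻ _ : Rn n, 0)) := by
      refine tendsto_lintegral_filter_of_dominated_convergence'
        (fun ξ => (ENNReal.ofReal 2 * ‖N ξ‖ₑ) ^ 2) ?_ ?_ ?_ ?_
      · filter_upwards [hF] with i hi
        exact (((Lp.aestronglyMeasurable (f i)).congr hi).sub
          (Lp.aestronglyMeasurable g)).enorm.pow_const 2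
      · filter_upwards [hb'] with i hi
        filter_upwards [hi, hg] with ξ h3 h4
        gcongr
        have h5 : ‖F i ξ - g ξ‖ ≤ 2 * N ξ := (norm_sub_le _ _).trans (by linarith)
        have hN0 : 0 ≤ N ξ := (norm_nonneg _).trans h4
        rw [← ofReal_norm, ← ofReal_norm, Real.norm_of_nonneg hN0,
          ← ENNReal.ofReal_mul zero_le_two]
        exact ENNReal.ofReal_le_ofReal h5
      · have := (memLp_two_iff_lintegral.1 hN).2
        simp only [mul_pow]
        rw [lintegral_const_mul' _ _ (by simp)]
        exact (ENNReal.mul_lt_top (by simp) this).ne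
      · filter_upwards [hlim] with ξ hξ
        have h3 : Tendsto (fun i => ‖F i ξ - g ξ‖ₑ) l (𝓝 0) := by
          have := (hξ.sub_const (g ξ)).enorm
          simpa using this
        simpa [Function.comp_def] using ((ENNReal.continuous_pow 2).tendsto 0).comp h3
    rw [lintegral_zero] at h2
    refine h2.congr' ?_
    filter_upwards [hF] with i hi
    refine lintegral_congr_ae ?_
    filter_upwards [hi] with ξ hξ
    rw [hξ]
  have h2 := h1.ennrpow_const (1 / 2 : ℝ)
  rw [ENNReal.zero_rpow_of_pos (by norm_num)] at h2
  refine h2.congr fun i => ?_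
  rw [Lp.edist_def, eLpNorm_two_eq]
  rfl

theorem memLp_of_norm_le_mul {f : Rn n → ℂ} {N : Rn n → ℝ} (hf : AEStronglyMeasurable f volume)
    (hN : MemLp N 2 volume) {C : ℝ} (h : ∀ᵐ ξ, ‖f ξ‖ ≤ C * N ξ) : MemLp f 2 volume :=
  (hN.const_mul C).mono' hf h

theorem norm_le_of_norm_le_mul {f : L2 n} {N : Rn n → ℝ} {B C : ℝ} (hB : 0 ≤ B) (hC : 0 ≤ C)
    (hN : eLpNorm N 2 volume ≤ ENNReal.ofReal B) (h : ∀ᵐ ξ, ‖f ξ‖ ≤ C * N ξ) : ‖f‖ ≤ C * B := by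
  have h1 : ∀ᵐ ξ, ‖f ξ‖ ≤ C * ‖N ξ‖ := h.mono fun ξ hξ =>
    hξ.trans (mul_le_mul_of_nonneg_left (le_abs_self _) hC)
  have h2 := (eLpNorm_le_mul_eLpNorm_of_ae_le_mul h1 2).trans
    (mul_le_mul_right hN (ENNReal.ofReal C))
  rw [← ENNReal.ofReal_mul hC, ← Lp.enorm_def, ← ofReal_norm] at h2
  exact (ENNReal.ofReal_le_ofReal_iff (mul_nonneg hC hB)).1 h2

theorem memLp_slice_of_le {f : Rn n × ℝ → ℂ} (hf : StronglyMeasurable f) {N : Rn n → ℝ}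
    (hN : MemLp N 2 volume) {b C : ℝ} (hb : ∀ᵐ ξ, ∀ z, 0 < z → z ≤ b → ‖f (ξ, z)‖ ≤ C * N ξ) {z : ℝ}
    (hz : 0 < z) (hzb : z ≤ b) : MemLp (fun ξ => f (ξ, z)) 2 volume :=
  memLp_of_norm_le_mul (hf.comp_measurable measurable_prodMk_right).aestronglyMeasurable hN
    (hb.mono fun _ h => h z hz hzb)

theorem continuousOn_slice {f : Rn n × ℝ → ℂ} (hf : StronglyMeasurable f) {N : Rn n → ℝ}
    (hN : MemLp N 2 volume) (hc : ∀ᵐ ξ, ContinuousOn (fun z => f (ξ, z)) (Ioi 0))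
    (hb : ∀ b > 0, ∃ C, ∀ᵐ ξ, ∀ z, 0 < z → z ≤ b → ‖f (ξ, z)‖ ≤ C * N ξ) :
    ContinuousOn (slice f) (Ioi 0) := by
  intro z hz
  have hz0 : (0 : ℝ) < z := hz
  obtain ⟨C, hC⟩ := hb (z + 1) (by linarith)
  have hmem := fun {y : ℝ} (h : 0 < y) (h' : y ≤ z + 1) => coeFn_slice (memLp_slice_of_le hf hN hC h h')
  have hev : ∀ᶠ y in 𝓝[Ioi 0] z, 0 < y ∧ y ≤ z + 1 := by
    filter_upwards [self_mem_nhdsWithin, mem_nhdsWithin_of_mem_nhds (Iic_mem_nhds (by linarith : z < z + 1))]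
      with y h1 h2 using ⟨h1, h2⟩
  have : (𝓝[Ioi 0] z).NeBot := mem_closure_iff_nhdsWithin_neBot.1 (subset_closure hz)
  refine tendsto_L2_of_dominated (F := fun y ξ => f (ξ, y)) (hN.const_mul C) ?_ ?_ ?_ ?_
  · filter_upwards [hev] with y hy using hmem hy.1 hy.2
  · filter_upwards [hC] with ξ hξ
    filter_upwards [hev] with y hy using hξ y hy.1 hy.2
  · filter_upwards [hev] with y hy
    filter_upwards [hC] with ξ hξ using hξ y hy.1 hy.2
  · filter_upwards [hc, hmem hz0 (by linarith)] with ξ h1 h2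
    rw [h2]
    exact h1 z hz

/-- A pointwise limit dominated by an `L²` function is a strong limit. Measurability of `l` follows
from the countable sequence `z = 1 / (k + 1)`. -/
theorem exists_tendsto_slice {f : Rn n × ℝ → ℂ} (hf : StronglyMeasurable f) {N : Rn n → ℝ}
    (hN : MemLp N 2 volume) {l : Rn n → ℂ}
    (hl : ∀ᵐ ξ, Tendsto (fun z => f (ξ, z)) (𝓝[>] 0) (𝓝 (l ξ))) {b C : ℝ} (hb0 : 0 < b)
    (hb : ∀ᵐ ξ, ∀ z, 0 < z → z ≤ b → ‖f (ξ, z)‖ ≤ C * N ξ) :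
    ∃ g : L2 n, (g : Rn n → ℂ) =ᵐ[volume] l ∧ Tendsto (slice f) (𝓝[>] 0) (𝓝 g) ∧
      ∀ᵐ ξ, ‖g ξ‖ ≤ C * N ξ := by
  have hev : ∀ᶠ y in 𝓝[>] (0 : ℝ), 0 < y ∧ y ≤ b := by
    filter_upwards [self_mem_nhdsWithin, mem_nhdsWithin_of_mem_nhds (Iic_mem_nhds hb0)]
      with y h1 h2 using ⟨h1, h2⟩
  have hlb : ∀ᵐ ξ, ‖l ξ‖ ≤ C * N ξ := by
    filter_upwards [hb, hl] with ξ h1 h2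
    refine le_of_tendsto h2.norm ?_
    filter_upwards [hev] with y hy using h1 y hy.1 hy.2
  have hseq : Tendsto (fun k : ℕ => 1 / ((k : ℝ) + 1)) atTop (𝓝[>] 0) := by
    refine tendsto_nhdsWithin_iff.2 ⟨tendsto_one_div_add_atTop_nhds_zero_nat,
      Eventually.of_forall fun k => ?_⟩
    exact mem_Ioi.2 (by positivity)
  have hlm : AEStronglyMeasurable l volume :=
    aestronglyMeasurable_of_tendsto_ae atTop (f := fun (k : ℕ) ξ => f (ξ, 1 / ((k : ℝ) + 1)))
      (fun k => (hf.comp_measurable measurable_prodMk_right).aestronglyMeasurable)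
      (hl.mono fun ξ hξ => hξ.comp hseq)
  have hlp := memLp_of_norm_le_mul hlm hN hlb
  refine ⟨hlp.toLp l, hlp.coeFn_toLp, ?_, ?_⟩
  · refine tendsto_L2_of_dominated (F := fun y ξ => f (ξ, y)) (hN.const_mul C) ?_ ?_ ?_ ?_
    · filter_upwards [hev] with y hy using coeFn_slice (memLp_slice_of_le hf hN hb hy.1 hy.2)
    · filter_upwards [hb] with ξ hξ
      filter_upwards [hev] with y hy using hξ y hy.1 hy.2
    · filter_upwards [hev] with y hy
      filter_upwards [hb] with ξ hξ using hξ y hy.1 hy.2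
    · filter_upwards [hl, hlp.coeFn_toLp] with ξ h1 h2
      rw [h2]
      exact h1
  · filter_upwards [hlb, hlp.coeFn_toLp] with ξ h1 h2
    rw [h2]
    exact h1

/-- The inverse Fourier transform as a continuous linear map. -/
def fourierInvL (n : ℕ) : L2 n →L[ℂ] L2 n :=
  (Lp.fourierTransformₗᵢ (Rn n) ℂ).symm.toContinuousLinearEquiv.toContinuousLinearMap

theorem fourierInvL_fourier (f : L2 n) : fourierInvL n (𝓕 f) = f :=
  (Lp.fourierTransformₗᵢ (Rn n) ℂ).symm_apply_apply f

theorem fourier_fourierInvL (f : L2 n) : 𝓕 (fourierInvL n f) = f :=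
  (Lp.fourierTransformₗᵢ (Rn n) ℂ).apply_symm_apply f

theorem norm_fourierInvL (f : L2 n) : ‖fourierInvL n f‖ = ‖f‖ :=
  (Lp.fourierTransformₗᵢ (Rn n) ℂ).symm.norm_map f

theorem fourierInvL_real_smul (c : ℝ) (f : L2 n) : fourierInvL n (c • f) = c • fourierInvL n f :=
  ((fourierInvL n).restrictScalars ℝ).map_smul c f

theorem isTraceFamily_fourierInvL {r : ℝ} {f : Rn n × ℝ → ℂ} (hf : WeightedSq n r f)
    {V : ℝ → L2 n} (hV : ContinuousOn V (Ioi 0))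
    (h : ∀ᵐ z ∂(volume.restrict (Ioi (0 : ℝ))), (𝓕 (slice f z) : L2 n) = V z) :
    IsTraceFamily n f (fun z => fourierInvL n (V z)) := by
  refine ⟨(fourierInvL n).continuous.comp_continuousOn hV, ?_⟩
  filter_upwards [h, hf.isSlices.2.2] with z h1 h2
  rw [← h1, fourierInvL_fourier]
  exact h2

end TaubWave
end

/-! ### Boundary regularity of elements of the domain -/

noncomputable section
namespace TaubWave

variable {n : ℕ}

theorem one_sub_one_div_mem (hn : 2 ≤ n) :
    1 / 2 ≤ 1 - 1 / (n : ℝ) ∧ 1 - 1 / (n : ℝ) < 1 := by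
  have h : (2 : ℝ) ≤ n := by exact_mod_cast hn
  have h1 : 1 / (n : ℝ) ≤ 1 / 2 := one_div_le_one_div_of_le two_pos h
  have h2 : 0 < 1 / (n : ℝ) := by positivity
  constructor <;> linarith

/-- Every estimate at a fixed frequency is a constant times `N ξ`, with a constant independent of
`ξ`, and `N` has `L²` norm at most `‖ψ‖ + ‖φ‖`. All traces and limits are therefore formed on the
Fourier side and transported back by the inverse transform. -/
theorem IsImageA.boundary_regularity (hn : 2 ≤ n) {φ ψ : H n} (h : IsImageA n φ ψ) :
    ∃ (v : ℝ → L2 n) (γ w m : L2 n),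
      IsTraceFamily n (dz n φ) v ∧ IsBoundaryTrace n φ γ ∧
      (∀ z : ℝ, 0 < z → z ≤ 1 / 2 → ‖(z ^ (1 / (n : ℝ))) • v z‖
        ≤ RadialSolution.fluxConst (1 - 1 / (n : ℝ)) (1 / 2) * (‖ψ‖ + energyNorm n φ)) ∧
      (IsLaplacian n γ w ∧
        ‖w‖ ≤ RadialSolution.fluxConst (1 - 1 / (n : ℝ)) (1 / 2) * (‖ψ‖ + energyNorm n φ)) ∧
      Tendsto (fun z : ℝ => -(((1 - 1 / (n : ℝ)) * z ^ (1 / (n : ℝ))) • v z)) (𝓝[>] 0) (𝓝 w) ∧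
      IsFractionalLaplacian n ((n : ℝ) / ((n : ℝ) - 1)) γ m := by
  obtain ⟨ha, ha1⟩ := one_sub_one_div_mem hn
  obtain ⟨a, hadef⟩ : ∃ a, a = 1 - 1 / (n : ℝ) := ⟨_, rfl⟩
  obtain ⟨U, W, P, hU, hW, hrad, hFU, hGW, hN, hNle⟩ := h.exists_radialSolution
  rw [← hadef] at ha ha1 hrad ⊢
  have ha0 : 0 < a := by linarith
  set N : Rn n → ℝ := fun ξ => (radialNorm fun s => P (ξ, s)) + radialNorm fun s => U (ξ, s)
  have hUb : ∀ b > 0, ∀ᵐ ξ, ∀ z, 0 < z → z ≤ b → ‖U (ξ, z)‖ ≤ (b + 2) * N ξ := fun b hb => by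
    filter_upwards [hrad] with ξ hξ z hz hzb using hξ.norm_u_le ha0 (freqSq_nonneg ξ) hb hz hzb
  have hWb : ∀ b > 0, ∀ᵐ ξ, ∀ z, 0 < z → z ≤ b → ‖z ^ (-a) • W (ξ, z)‖ ≤ RadialSolution.fluxConst a b * N ξ :=
    fun b hb => by
      filter_upwards [hrad] with ξ hξ z hz hzb
        using hξ.norm_rpow_smul_w_le ha0 ha1.le (freqSq_nonneg ξ) hb hz hzb
  -- The transform of `z ^ (1 / n) ∂_z φ`, since `∂_z φ` corresponds to `z⁻¹ W` and `1 / n - 1 =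
  -- -a`.
  set J : Rn n × ℝ → ℂ := fun p => p.2 ^ (-a) • W p
  have hJm : StronglyMeasurable J := by
    have h1 : Measurable fun p : Rn n × ℝ => p.2 ^ (-a) := by fun_prop
    exact (h1.smul hW.measurable).stronglyMeasurable
  have hUc : ContinuousOn (slice U) (Ioi 0) :=
    continuousOn_slice hU hN (hrad.mono fun ξ hξ => hξ.cont_u) fun b hb => ⟨_, hUb b hb⟩
  have hJc : ContinuousOn (slice J) (Ioi 0) := by
    refine continuousOn_slice hJm hN (hrad.mono fun ξ hξ => ?_) fun b hb => ⟨_, hWb b hb⟩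
    exact (continuousOn_id.rpow_const fun z hz => Or.inl (ne_of_gt hz)).smul hξ.cont_w
  set u₀ : Rn n → ℂ := fun ξ => limUnder (𝓝[>] 0) fun z => U (ξ, z)
  have hu₀ : ∀ᵐ ξ, Tendsto (fun z => U (ξ, z)) (𝓝[>] 0) (𝓝 (u₀ ξ)) := by
    filter_upwards [hrad] with ξ hξ
    exact tendsto_nhds_limUnder (hξ.exists_tendsto_u ha0 (freqSq_nonneg ξ))
  have hJ₀ : ∀ᵐ ξ, Tendsto (fun z => J (ξ, z)) (𝓝[>] 0) (𝓝 ((freqSq ξ / a) • u₀ ξ)) := by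
    filter_upwards [hrad, hu₀] with ξ h1 h2 using h1.tendsto_rpow_smul_w ha0 ha1 (freqSq_nonneg ξ) h2
  obtain ⟨G, hG, hGlim, -⟩ := exists_tendsto_slice hU hN hu₀ one_pos (hUb 1 one_pos)
  obtain ⟨K, hK, hKlim, hKb⟩ := exists_tendsto_slice hJm hN hJ₀ (by norm_num : (0 : ℝ) < 1 / 2)
    (hWb (1 / 2) (by norm_num))
  obtain ⟨M, hM⟩ : ∃ M : L2 n, (M : Rn n → ℂ) =ᵐ[volume]
      fun ξ => ((freqSq ξ ^ (1 / a) : ℝ) : ℂ) * u₀ ξ := by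
    have hm : MemLp (fun ξ => ((freqSq ξ ^ (1 / a) : ℝ) : ℂ) * u₀ ξ) 2 volume := by
      refine memLp_of_norm_le_mul ?_ hN (C := 1152 * Real.pi) ?_
      · refine Continuous.aestronglyMeasurable ?_ |>.mul ((Lp.aestronglyMeasurable G).congr hG)
        exact Complex.continuous_ofReal.comp
          (continuous_freqSq.rpow_const fun ξ => Or.inr (by positivity))
      · filter_upwards [hrad, hu₀] with ξ h1 h2
        rw [norm_mul, Complex.norm_real,
          Real.norm_of_nonneg (Real.rpow_nonneg (freqSq_nonneg ξ) _)]
        exact h1.rpow_mul_norm_limit_le ha ha1.le (freqSq_nonneg ξ) h2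
    exact ⟨hm.toLp _, hm.coeFn_toLp⟩
  have hB : 0 ≤ ‖ψ‖ + ‖φ‖ := by positivity
  have hBE : ‖ψ‖ + ‖φ‖ ≤ ‖ψ‖ + energyNorm n φ := by linarith [norm_le_energyNorm φ]
  have hfc : 0 < RadialSolution.fluxConst a (1 / 2) := RadialSolution.fluxConst_pos ha0 (by norm_num)
  have hexp : ∀ z : ℝ, 0 < z → z ^ (1 / (n : ℝ)) * z ^ (a - 1) = 1 := fun z hz => by
    rw [← Real.rpow_add hz, hadef]
    simp
  -- The trace of `∂_z φ` is recovered from `z⁻¹ W = z ^ (a - 1) J`. As `K` equals `(|2πξ|² / a)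
  -- u₀`, the transform of `Δγ` is `-a K`; the exponent `1 / a = n / (n - 1)` makes `M` the
  -- transform of the fractional Laplacian.
  refine ⟨fun z => fourierInvL n (z ^ (a - 1) • slice J z), fourierInvL n G,
    -(a • fourierInvL n K), fourierInvL n M, ?_, ?_, ?_, ⟨?_, ?_⟩, ?_, ?_⟩
  · refine isTraceFamily_fourierInvL (hasGradient_of_mem h.1.1).1.2
      ((continuousOn_id.rpow_const fun z hz => Or.inl (ne_of_gt hz)).smul hJc) ?_
    filter_upwards [hGW, ae_restrict_mem measurableSet_Ioi] with z h1 hz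
    have hz0 : (0 : ℝ) < z := hz
    refine Lp.ext ?_
    filter_upwards [h1, Lp.coeFn_smul (z ^ (a - 1)) (slice J z),
      coeFn_slice (memLp_slice_of_le hJm hN (hWb z hz0) hz0 le_rfl)] with ξ h2 h3 h4
    rw [h2, h3, Pi.smul_apply, h4]
    simp only [J]
    rw [smul_smul, ← Real.rpow_add hz0]
    congr 1
    rw [show a - 1 + -a = -1 by ring, Real.rpow_neg_one]
  · refine ⟨fun z => fourierInvL n (slice U z), isTraceFamily_fourierInvL (weightedSq_coe φ) hUc ?_,
      ((fourierInvL n).continuous.tendsto G).comp hGlim⟩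
    filter_upwards [hFU, ae_restrict_mem measurableSet_Ioi] with z h1 hz
    refine Lp.ext ?_
    filter_upwards [h1, coeFn_slice (memLp_slice_of_le hU hN (hUb z hz) hz le_rfl)] with ξ h2 h3
    rw [h2, h3]
  · intro z hz hz2
    rw [← fourierInvL_real_smul, norm_fourierInvL, smul_smul, hexp z hz, one_smul]
    refine (norm_le_of_norm_le_mul hB hfc.le hNle ?_).trans (mul_le_mul_of_nonneg_left hBE hfc.le)
    filter_upwards [hWb (1 / 2) (by norm_num),
      coeFn_slice (memLp_slice_of_le hJm hN (hWb _ (by norm_num)) hz hz2)] with ξ h1 h2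
    rw [h2]
    exact h1 z hz hz2
  · refine isLaplacian_of_fourier_ae_eq ?_
    rw [← fourierInvL_real_smul, ← map_neg, fourier_fourierInvL, fourier_fourierInvL]
    filter_upwards [Lp.coeFn_neg (a • K), Lp.coeFn_smul a K, hK, hG] with ξ h1 h2 h3 h4
    rw [h1, Pi.neg_apply, h2, Pi.smul_apply, h3, h4, smul_smul, mul_div_cancel₀ _ ha0.ne',
      Complex.real_smul]
    simp [freqSq]
  · rw [norm_neg, norm_smul, Real.norm_of_nonneg ha0.le, norm_fourierInvL]
    have h1 := (norm_le_of_norm_le_mul hB hfc.le hNle hKb).trans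
      (mul_le_mul_of_nonneg_left hBE hfc.le)
    exact (mul_le_of_le_one_left (norm_nonneg _) ha1.le).trans h1
  · have h1 := (((fourierInvL n).continuous.tendsto K).comp hKlim).const_smul a |>.neg
    refine h1.congr' ?_
    filter_upwards [self_mem_nhdsWithin] with z hz
    simp only [Function.comp_apply]
    rw [fourierInvL_real_smul, smul_smul, mul_assoc, hexp z hz, mul_one]
  · rw [IsFractionalLaplacian, fourier_fourierInvL, fourier_fourierInvL]
    filter_upwards [hM, hG] with ξ h1 h2
    rw [h1, h2, freqSq, ← Real.rpow_natCast, ← Real.rpow_mul (by positivity)]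
    have hn0 : (2 : ℝ) ≤ n := by exact_mod_cast hn
    congr 3
    rw [hadef]
    push_cast
    field_simp

end TaubWave
end

/-! ### Sharpness: construction of an extension of a boundary datum -/

noncomputable section
namespace TaubWave

variable {n : ℕ}

/-! ### The inverse partial Fourier transform -/

theorem IsSlices.slice_eq {τ : Measure ℝ} {f : Rn n × ℝ → ℂ} {X : ℝ → L2 n}
    (h : IsSlices τ f X) : ∀ᵐ z ∂τ, slice f z = X z := by
  filter_upwards [h.2.2] with z hz
  have hm : MemLp (fun x => f (x, z)) 2 volume := (memLp_congr_ae hz).1 (Lp.memLp (X z))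
  exact Lp.ext ((coeFn_slice hm).trans hz.symm)

theorem IsSlices.weightedSq {f : Rn n × ℝ → ℂ} {X : ℝ → L2 n}
    (h : IsSlices (volume.restrict (Ioi 0)) f X) {r : ℝ}
    (hX : ∫⁻ z in Ioi 0, ENNReal.ofReal (z ^ r) * ‖X z‖ₑ ^ 2 < ⊤) : WeightedSq n r f := by
  rw [WeightedSq, volume_restrict_halfSpace]
  refine ⟨h.1, ?_⟩
  rw [h.lintegral_eq (ρ := fun z => ENNReal.ofReal (z ^ r)) (by fun_prop)]
  exact hX

theorem WeightedSq.exists_fourierInv {r : ℝ} {f : Rn n × ℝ → ℂ} (h : WeightedSq n r f) :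
    ∃ F : Rn n × ℝ → ℂ, StronglyMeasurable F ∧ WeightedSq n r F ∧
      IsSlices (volume.restrict (Ioi 0)) F (fun z => fourierInvL n (slice f z)) := by
  obtain ⟨F, hF, hFs⟩ := exists_isSlices
    ((fourierInvL n).continuous.comp_aestronglyMeasurable h.isSlices.2.1)
  refine ⟨F, hF, hFs.weightedSq ?_, hFs⟩
  have e : ∀ Y : L2 n, ‖fourierInvL n Y‖ₑ = ‖Y‖ₑ := fun Y => by
    rw [← ofReal_norm, norm_fourierInvL, ofReal_norm]
  simp only [e]
  rw [h.lintegral_slice]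
  exact h.2

theorem WeightedSq.setIntegral_eq_inner {r : ℝ} {f g : Rn n × ℝ → ℂ} (hf : WeightedSq n r f)
    (hg : WeightedSq n r g) :
    ∫ p in halfSpace n, ((p.2 ^ r : ℝ) : ℂ) * (f p * star (g p))
      = ∫ z in Ioi 0, ((z ^ r : ℝ) : ℂ) * inner ℂ (slice g z) (slice f z) := by
  have hi := hf.integrable_mul hg
  rw [IntegrableOn, volume_restrict_halfSpace] at hi
  rw [volume_restrict_halfSpace, integral_prod_symm _ hi]
  refine integral_congr_ae ?_
  filter_upwards [hf.isSlices.2.2, hg.isSlices.2.2] with z h1 h2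
  rw [integral_const_mul, MeasureTheory.L2.inner_def]
  congr 1
  refine integral_congr_ae ?_
  filter_upwards [h1, h2] with x h3 h4
  rw [h3, h4]
  rfl

/-- Plancherel's theorem for the partial Fourier transform. -/
theorem WeightedSq.setIntegral_eq_fourier {r : ℝ} {f g F G : Rn n × ℝ → ℂ}
    (hf : WeightedSq n r f) (hg : WeightedSq n r g) (hF : WeightedSq n r F) (hG : WeightedSq n r G)
    (hfF : ∀ᵐ z ∂(volume.restrict (Ioi (0 : ℝ))), slice F z = 𝓕 (slice f z))
    (hgG : ∀ᵐ z ∂(volume.restrict (Ioi (0 : ℝ))), slice G z = 𝓕 (slice g z)) :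
    ∫ p in halfSpace n, ((p.2 ^ r : ℝ) : ℂ) * (f p * star (g p))
      = ∫ p in halfSpace n, ((p.2 ^ r : ℝ) : ℂ) * (F p * star (G p)) := by
  rw [hf.setIntegral_eq_inner hg, hF.setIntegral_eq_inner hG]
  refine integral_congr_ae ?_
  filter_upwards [hfF, hgG] with z h1 h2
  rw [h1, h2, Lp.inner_fourier_eq]

/-! ### Weak derivatives from slices -/

/-- By Fubini it suffices to integrate by parts on almost every vertical line, where `f` is a
constant plus a primitive of `g`; the constant integrates to 0 against the derivative of the test
function. -/
theorem isWeakDeriv_of_eq_primitive {r r' : ℝ} {f g : Rn n × ℝ → ℂ} {X Y : ℝ → L2 n}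
    (hf : StronglyMeasurable f) (hg : StronglyMeasurable g) (hfr : WeightedSq n r f)
    (hgr : WeightedSq n r' g) (hfX : IsSlices (volume.restrict (Ioi 0)) f X)
    (hgY : IsSlices (volume.restrict (Ioi 0)) g Y) (hY : LocallyIntegrableOn Y (Ioi 0)) {c : L2 n}
    (h : ∀ᵐ z ∂(volume.restrict (Ioi (0 : ℝ))), X z = c + ∫ s in (1 : ℝ)..z, Y s) :
    IsWeakDeriv n (0, 1) f g := by
  have hfl := hfr.memL2loc.locallyIntegrableOn
  have hgl := hgr.memL2loc.locallyIntegrableOn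
  refine ⟨hfl, hgl, fun ζ hζ hc hs => ?_⟩
  obtain ⟨hd, hdc, hds⟩ := fderiv_test hζ hc hs (0, 1)
  have h1 := (integrableOn_smul_of_tsupport_subset hfl hd.continuous hdc hds).integrableOn
    (s := halfSpace n)
  have h2 := (integrableOn_smul_of_tsupport_subset hgl hζ.continuous hc hs).integrableOn
    (s := halfSpace n)
  rw [IntegrableOn, volume_restrict_halfSpace] at h1 h2
  rw [volume_restrict_halfSpace, integral_prod _ h1, integral_prod _ h2, ← integral_neg]
  refine integral_congr_ae ?_
  filter_upwards [ae_ae_eq_primitive hf hg hfX hgY hY h, hgY.ae_locallyIntegrableOn hY] with x hx hgx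
  have hζx : ContDiff ℝ ∞ fun z => ζ (x, z) := by fun_prop
  have hcx : HasCompactSupport fun z => ζ (x, z) := by
    refine HasCompactSupport.intro (hc.image continuous_snd) fun z hz => ?_
    exact image_eq_zero_of_notMem_tsupport fun h' => hz ⟨(x, z), h', rfl⟩
  have hsx : tsupport (fun z => ζ (x, z)) ⊆ Ioi 0 := by
    have hcl : IsClosed {z : ℝ | (x, z) ∈ tsupport ζ} :=
      (isClosed_tsupport ζ).preimage (by fun_prop)
    exact (closure_minimal (t := {z : ℝ | (x, z) ∈ tsupport ζ})
      (fun z hz => subset_tsupport ζ hz) hcl).trans fun z hz => hs hz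
  have hder : ∀ z, deriv (fun z => ζ (x, z)) z = fderiv ℝ ζ (x, z) (0, 1) := fun z => by
    have h3 : HasDerivAt (fun z : ℝ => (x, z)) ((0 : Rn n), (1 : ℝ)) z :=
      (hasDerivAt_const z x).prodMk (hasDerivAt_id z)
    exact ((hζ.differentiable (by simp)).differentiableAt.hasFDerivAt.comp_hasDerivAt z h3).deriv
  obtain ⟨hd', hdc', hds'⟩ := deriv_test hζx hcx hsx
  have key := setIntegral_deriv_smul_primitive hgx hζx hcx hsx
  have hconst : ∫ z in Ioi 0, deriv (fun z => ζ (x, z)) z • c x = 0 := by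
    have h4 : ∫ z in Ioi 0, deriv (fun z => ζ (x, z)) z = 0 := by
      rw [setIntegral_eq_integral_of_forall_compl_eq_zero fun z hz =>
        image_eq_zero_of_notMem_tsupport fun h' => hz (hds' h')]
      exact integral_eq_zero_of_hasDerivAt_of_integrable
        (fun z => (hζx.differentiable (by simp)).differentiableAt.hasDerivAt)
        (hd'.continuous.integrable_of_hasCompactSupport hdc')
        (hζx.continuous.integrable_of_hasCompactSupport hcx)
    rw [integral_smul_const, h4, zero_smul]
  have i1 : IntegrableOn (fun z => deriv (fun z => ζ (x, z)) z • c x) (Ioi 0) :=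
    ((hd'.continuous.integrable_of_hasCompactSupport hdc').smul_const _).integrableOn
  have i2 := integrableOn_smul_of_locallyIntegrableOn
    ((continuousOn_primitive hgx).locallyIntegrableOn measurableSet_Ioi) hd'.continuous hdc' hds'
  rw [← key, ← zero_add (∫ z in Ioi 0, deriv (fun z => ζ (x, z)) z • ∫ s in (1 : ℝ)..z, g (x, s)),
    ← hconst, ← integral_add i1 i2]
  refine integral_congr_ae ?_
  filter_upwards [hx] with z hz
  rw [hz, smul_add, hder]

/-- Fubini in the other order: for almost every `z` the horizontal slices satisfy the weak identity
by `weak_lineDeriv_of_fourier_ae_eq`. -/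
theorem isWeakDeriv_of_fourier_slice {r r' : ℝ} {f g : Rn n × ℝ → ℂ} {e : Rn n}
    (hf : WeightedSq n r f) (hg : WeightedSq n r' g)
    (h : ∀ᵐ z ∂(volume.restrict (Ioi (0 : ℝ))), ((𝓕 (slice g z) : L2 n) : Rn n → ℂ) =ᵐ[volume]
      fun ξ => (2 * Real.pi * Complex.I * (inner ℝ ξ e : ℝ)) * (𝓕 (slice f z) : L2 n) ξ) :
    IsWeakDeriv n (e, 0) f g := by
  have hfl := hf.memL2loc.locallyIntegrableOn
  have hgl := hg.memL2loc.locallyIntegrableOn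
  refine ⟨hfl, hgl, fun ζ hζ hc hs => ?_⟩
  obtain ⟨hd, hdc, hds⟩ := fderiv_test hζ hc hs (e, 0)
  have h1 := (integrableOn_smul_of_tsupport_subset hfl hd.continuous hdc hds).integrableOn
    (s := halfSpace n)
  have h2 := (integrableOn_smul_of_tsupport_subset hgl hζ.continuous hc hs).integrableOn
    (s := halfSpace n)
  rw [IntegrableOn, volume_restrict_halfSpace] at h1 h2
  rw [volume_restrict_halfSpace, integral_prod_symm _ h1, integral_prod_symm _ h2, ← integral_neg]
  refine integral_congr_ae ?_
  filter_upwards [h, hf.isSlices.2.2, hg.isSlices.2.2] with z hz hfz hgz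
  have hζz : ContDiff ℝ ∞ fun x => ζ (x, z) := by fun_prop
  have hcz : HasCompactSupport fun x => ζ (x, z) := by
    refine HasCompactSupport.intro (hc.image continuous_fst) fun x hx => ?_
    exact image_eq_zero_of_notMem_tsupport fun h' => hx ⟨(x, z), h', rfl⟩
  have hder : ∀ x, fderiv ℝ (fun x => ζ (x, z)) x e = fderiv ℝ ζ (x, z) (e, 0) := fun x => by
    have h3 : HasFDerivAt (fun x : Rn n => (x, z)) (ContinuousLinearMap.inl ℝ (Rn n) ℝ) x :=
      hasFDerivAt_prodMk_left x z
    have h4 : HasFDerivAt (fun x => ζ (x, z))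
        ((fderiv ℝ ζ (x, z)).comp (ContinuousLinearMap.inl ℝ (Rn n) ℝ)) x :=
      (hζ.differentiable (by simp)).differentiableAt.hasFDerivAt.comp x h3
    rw [h4.fderiv]
    rfl
  have key := weak_lineDeriv_of_fourier_ae_eq hz hζz hcz
  have e1 : ∫ x, fderiv ℝ ζ (x, z) (e, 0) • f (x, z)
      = ∫ x, fderiv ℝ (fun x => ζ (x, z)) x e • slice f z x := by
    refine integral_congr_ae ?_
    filter_upwards [hfz] with x hx
    rw [hx, hder]
  have e2 : ∫ x, ζ (x, z) • g (x, z) = ∫ x, ζ (x, z) • slice g z x := by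
    refine integral_congr_ae ?_
    filter_upwards [hgz] with x hx
    rw [hx]
  rw [e1, e2]
  exact key

/-! ### The horizontal gradient on the Fourier side -/

theorem freq_sq_le (ξ : Rn n) (i : Fin n) : (2 * Real.pi * ξ i) ^ 2 ≤ freqSq ξ := by
  rw [freqSq, mul_pow, mul_pow _ ‖ξ‖, EuclideanSpace.real_norm_sq_eq]
  gcongr
  exact Finset.single_le_sum (f := fun i => ξ i ^ 2) (fun i _ => sq_nonneg _) (Finset.mem_univ i)

theorem norm_freq (ξ : Rn n) (i : Fin n) :
    ‖2 * Real.pi * Complex.I * (ξ i : ℝ)‖ = |2 * Real.pi * ξ i| := by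
  simp [abs_mul]

theorem memLp_freq_mul_resolventSymbol (i : Fin n) :
    MemLp (fun ξ : Rn n => (2 * Real.pi * Complex.I * (ξ i : ℝ)) * resolventSymbol ξ) ⊤ volume := by
  refine memLp_top_of_continuous_of_norm_le (Continuous.mul (by fun_prop)
    continuous_resolventSymbol) (C := 1) fun ξ => ?_
  have h1 := freqSq_nonneg ξ
  have h2 := freq_sq_le ξ i
  rw [norm_mul, norm_freq, resolventSymbol, Complex.norm_real, Real.norm_of_nonneg (by positivity),
    mul_one_div, div_le_one (by positivity)]
  nlinarith [sq_abs (2 * Real.pi * ξ i), sq_nonneg (|2 * Real.pi * ξ i| - 1)]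

/-- Removes the test function `θ` from `HasGradient.fourier_integral`. Both sides are first
multiplied by the resolvent symbol, so that the unbounded symbol `ξ_i` becomes a bounded multiplier,
and the factor is divided out at the end. -/
theorem HasGradient.fourier_slice {φ : H n} {g : Rn n × ℝ → ℂ} {k : Fin n → Rn n × ℝ → ℂ}
    (hg : HasGradient φ g k) (i : Fin n) :
    ∀ᵐ z ∂(volume.restrict (Ioi (0 : ℝ))), ((𝓕 (slice (k i) z) : L2 n) : Rn n → ℂ) =ᵐ[volume]
      fun ξ => (2 * Real.pi * Complex.I * (ξ i : ℝ)) * (𝓕 (slice φ z) : L2 n) ξ := by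
  have hφ := weightedSq_coe φ
  obtain ⟨-, -, -, hFl, -⟩ := hφ.exists_fourier
  obtain ⟨-, -, -, hKl, -⟩ := (hg.2 i).2.exists_fourier
  have hX := locallyIntegrableOn_mulOp hKl memLp_resolventSymbol
  have hY := locallyIntegrableOn_mulOp hFl (memLp_freq_mul_resolventSymbol i)
  have key := isOpen_Ioi.ae_eq_zero_of_integral_contDiff_smul_eq_zero (hX.sub hY)
    fun θ hθ hθc hθs => ?_
  · rw [ae_restrict_iff' measurableSet_Ioi]
    filter_upwards [key] with z hz hz0
    have h1 : mulOp _ memLp_resolventSymbol (𝓕 (slice (k i) z))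
        = mulOp _ (memLp_freq_mul_resolventSymbol i) (𝓕 (slice φ z)) := sub_eq_zero.1 (hz hz0)
    filter_upwards [coeFn_mulOp memLp_resolventSymbol (𝓕 (slice (k i) z) : L2 n),
      coeFn_mulOp (memLp_freq_mul_resolventSymbol i) (𝓕 (slice φ z) : L2 n)] with ξ h2 h3
    rw [h1, h3] at h2
    have h4 := congrArg (fun y => ((1 + freqSq ξ : ℝ) : ℂ) * y) h2
    rw [← mul_assoc _ (resolventSymbol ξ), resolventSymbol_mul, one_mul] at h4
    rw [← h4, mul_comm (2 * _ * _ * _) (resolventSymbol ξ), mul_assoc, ← mul_assoc,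
      resolventSymbol_mul, one_mul]
  · rw [← setIntegral_eq_integral_of_forall_compl_eq_zero (s := Ioi 0) fun x hx => by
      rw [image_eq_zero_of_notMem_tsupport fun h' => hx (hθs h'), zero_smul]]
    simp only [Pi.sub_apply, smul_sub]
    rw [integral_sub (integrableOn_smul_of_locallyIntegrableOn hX hθ.continuous hθc hθs)
      (integrableOn_smul_of_locallyIntegrableOn hY hθ.continuous hθc hθs),
      setIntegral_smul_mulOp (integrableOn_smul_of_locallyIntegrableOn hKl hθ.continuous hθc hθs),
      setIntegral_smul_mulOp (integrableOn_smul_of_locallyIntegrableOn hFl hθ.continuous hθc hθs),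
      ← fourier_setIntegral_smul ((hg.2 i).2.integrableOn_test hθ.continuous hθc hθs),
      ← fourier_setIntegral_smul (hφ.integrableOn_test hθ.continuous hθc hθs), sub_eq_zero]
    refine Lp.ext ?_
    filter_upwards [hg.fourier_integral hθ hθc hθs i,
      coeFn_mulOp memLp_resolventSymbol (𝓕 (∫ z in Ioi 0, θ z • slice (k i) z : L2 n) : L2 n),
      coeFn_mulOp (memLp_freq_mul_resolventSymbol i)
        (𝓕 (∫ z in Ioi 0, θ z • slice φ z : L2 n) : L2 n)] with ξ h1 h2 h3
    rw [h2, h3, h1]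
    ring

end TaubWave
end

noncomputable section
namespace TaubWave

/-! ### A compactly supported profile -/

/-- A smooth cutoff, equal to `1` on `(-∞, 1]` and to `0` on `[2, ∞)`. -/
def cutoff (s : ℝ) : ℝ := Real.smoothTransition (2 - s)

theorem contDiff_cutoff : ContDiff ℝ ∞ cutoff :=
  Real.smoothTransition.contDiff.comp (contDiff_const.sub contDiff_id)

theorem cutoff_of_le_one {s : ℝ} (hs : s ≤ 1) : cutoff s = 1 :=
  Real.smoothTransition.one_of_one_le (by linarith)

theorem cutoff_of_two_le {s : ℝ} (hs : 2 ≤ s) : cutoff s = 0 :=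
  Real.smoothTransition.zero_of_nonpos (by linarith)

theorem hasDerivAt_cutoff (s : ℝ) : HasDerivAt cutoff (deriv cutoff s) s :=
  (contDiff_cutoff.differentiable (by simp)).differentiableAt.hasDerivAt

theorem contDiff_deriv_cutoff : ContDiff ℝ ∞ (deriv cutoff) :=
  (contDiff_infty_iff_deriv.1 contDiff_cutoff).2

theorem hasDerivAt_deriv_cutoff (s : ℝ) : HasDerivAt (deriv cutoff) (deriv (deriv cutoff) s) s :=
  (contDiff_deriv_cutoff.differentiable (by simp)).differentiableAt.hasDerivAt

theorem continuous_deriv_deriv_cutoff : Continuous (deriv (deriv cutoff)) :=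
  contDiff_deriv_cutoff.continuous_deriv (by simp)

theorem deriv_cutoff_of_lt_one {s : ℝ} (hs : s < 1) : deriv cutoff s = 0 := by
  have : cutoff =ᶠ[𝓝 s] fun _ => 1 := by
    filter_upwards [Iio_mem_nhds hs] with y hy using cutoff_of_le_one (le_of_lt hy)
  rw [this.deriv_eq, deriv_const]

theorem deriv_cutoff_of_two_lt {s : ℝ} (hs : 2 < s) : deriv cutoff s = 0 := by
  have : cutoff =ᶠ[𝓝 s] fun _ => 0 := by
    filter_upwards [Ioi_mem_nhds hs] with y hy using cutoff_of_two_le (le_of_lt hy)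
  rw [this.deriv_eq, deriv_const]

theorem deriv_deriv_cutoff_of_lt_one {s : ℝ} (hs : s < 1) : deriv (deriv cutoff) s = 0 := by
  have : deriv cutoff =ᶠ[𝓝 s] fun _ => 0 := by
    filter_upwards [Iio_mem_nhds hs] with y hy using deriv_cutoff_of_lt_one hy
  rw [this.deriv_eq, deriv_const]

theorem deriv_deriv_cutoff_of_two_lt {s : ℝ} (hs : 2 < s) : deriv (deriv cutoff) s = 0 := by
  have : deriv cutoff =ᶠ[𝓝 s] fun _ => 0 := by
    filter_upwards [Ioi_mem_nhds hs] with y hy using deriv_cutoff_of_two_lt hy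
  rw [this.deriv_eq, deriv_const]

/-- The growing solution, cut off away from the boundary. -/
def profile (a θ s : ℝ) : ℝ := growing a θ s * cutoff s

/-- The flux `s k'` of the profile `k`. -/
def profileFlux (a θ s : ℝ) : ℝ := growingFlux a θ s * cutoff s + s * (growing a θ s * deriv cutoff s)

/-- The defect `θ s ^ (a - 1) k - (s k')'` of the profile `k`. -/
def profileSource (a θ s : ℝ) : ℝ :=
  -(2 * growingFlux a θ s * deriv cutoff s + growing a θ s * deriv cutoff s
    + s * (growing a θ s * deriv (deriv cutoff) s))

variable {a θ : ℝ}

theorem hasDerivAt_profile (ha : 0 < a) {s : ℝ} (hs : 0 < s) :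
    HasDerivAt (profile a θ) (profileFlux a θ s / s) s := by
  have e : profileFlux a θ s / s
      = growingFlux a θ s / s * cutoff s + growing a θ s * deriv cutoff s := by
    rw [profileFlux]
    field_simp
  rw [e]
  exact (hasDerivAt_growing ha hs).mul (hasDerivAt_cutoff s)

theorem hasDerivAt_profileFlux (ha : 0 < a) {s : ℝ} (hs : 0 < s) :
    HasDerivAt (profileFlux a θ) (θ * s ^ (a - 1) * profile a θ s - profileSource a θ s) s := by
  have e : θ * s ^ (a - 1) * profile a θ s - profileSource a θ s
      = (θ * s ^ (a - 1) * growing a θ s * cutoff s + growingFlux a θ s * deriv cutoff s)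
        + (1 * (growing a θ s * deriv cutoff s)
          + s * (growingFlux a θ s / s * deriv cutoff s + growing a θ s * deriv (deriv cutoff) s)) := by
    rw [profile, profileSource]
    field_simp
    ring
  rw [e]
  exact ((hasDerivAt_growingFlux ha hs).mul (hasDerivAt_cutoff s)).add
    ((hasDerivAt_id s).mul ((hasDerivAt_growing ha hs).mul (hasDerivAt_deriv_cutoff s)))

theorem continuous_growing_uncurry (ha : 0 < a) :
    Continuous fun q : ℝ × ℝ => growing a q.1 q.2 := by
  have h := continuous_besselSeries 0
  have h1 : Continuous fun q : ℝ × ℝ => q.2 ^ a := continuous_snd.rpow_const fun _ => Or.inr ha.le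
  unfold growing
  fun_prop

theorem continuous_growingFlux_uncurry (ha : 0 < a) :
    Continuous fun q : ℝ × ℝ => growingFlux a q.1 q.2 := by
  have h := continuous_besselSeries 1
  have h1 : Continuous fun q : ℝ × ℝ => q.2 ^ a := continuous_snd.rpow_const fun _ => Or.inr ha.le
  simp only [growingFlux_eq ha]
  fun_prop

theorem continuous_profile_uncurry (ha : 0 < a) :
    Continuous fun q : ℝ × ℝ => profile a q.1 q.2 :=
  (continuous_growing_uncurry ha).mul (contDiff_cutoff.continuous.comp continuous_snd)

theorem continuous_profileFlux_uncurry (ha : 0 < a) :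
    Continuous fun q : ℝ × ℝ => profileFlux a q.1 q.2 :=
  ((continuous_growingFlux_uncurry ha).mul (contDiff_cutoff.continuous.comp continuous_snd)).add
    (continuous_snd.mul ((continuous_growing_uncurry ha).mul
      (contDiff_deriv_cutoff.continuous.comp continuous_snd)))

theorem continuous_profileSource_uncurry (ha : 0 < a) :
    Continuous fun q : ℝ × ℝ => profileSource a q.1 q.2 := by
  have h0 := continuous_growing_uncurry ha
  have h1 := continuous_growingFlux_uncurry ha
  have h2 := contDiff_deriv_cutoff.continuous
  have h3 := continuous_deriv_deriv_cutoff
  unfold profileSource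
  fun_prop

theorem profile_of_two_lt {s : ℝ} (hs : 2 < s) : profile a θ s = 0 := by
  rw [profile, cutoff_of_two_le hs.le, mul_zero]

theorem profileFlux_of_two_lt {s : ℝ} (hs : 2 < s) : profileFlux a θ s = 0 := by
  rw [profileFlux, cutoff_of_two_le hs.le, deriv_cutoff_of_two_lt hs]
  simp

theorem profileSource_of_two_lt {s : ℝ} (hs : 2 < s) : profileSource a θ s = 0 := by
  rw [profileSource, deriv_deriv_cutoff_of_two_lt hs, deriv_cutoff_of_two_lt hs]
  simp

theorem profileSource_of_lt_one {s : ℝ} (hs : s < 1) : profileSource a θ s = 0 := by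
  rw [profileSource, deriv_deriv_cutoff_of_lt_one hs, deriv_cutoff_of_lt_one hs]
  simp

theorem profile_zero (ha : 0 < a) : profile a θ 0 = 1 := by
  rw [profile, cutoff_of_le_one zero_le_one, growing, Real.zero_rpow ha.ne']
  simp [besselSeries_zero_right]

/-- Bounds that are uniform for frequencies `θ ∈ [0, 1]`. -/
theorem exists_profile_bound (ha : 0 < a) (ha1 : a ≤ 1) : ∃ M : ℝ, 0 < M ∧ ∀ θ ∈ Icc (0 : ℝ) 1,
    ∀ s, 0 < s → |profile a θ s| ≤ M ∧ |profileFlux a θ s| ≤ M * s ^ a ∧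
      |profileSource a θ s| ≤ M := by
  have hK : IsCompact (Icc (0 : ℝ) 1 ×ˢ Icc (0 : ℝ) 2) := isCompact_Icc.prod isCompact_Icc
  -- The quotient `profileFlux / s ^ a`, written so that it is visibly continuous up to `s = 0`: the
  -- factor `s` of the second term becomes `s ^ (1 - a)`, and `a ≤ 1`. Compactness then bounds it.
  set J : ℝ × ℝ → ℝ := fun q => q.1 / a * besselSeries 1 (q.1 * q.2 ^ a / a ^ 2) * cutoff q.2
    + q.2 ^ (1 - a) * (growing a q.1 q.2 * deriv cutoff q.2)
  have hJ : Continuous J := by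
    have h := continuous_besselSeries 1
    have h1 : Continuous fun q : ℝ × ℝ => q.2 ^ a := continuous_snd.rpow_const fun _ => Or.inr ha.le
    have h2 : Continuous fun q : ℝ × ℝ => q.2 ^ (1 - a) :=
      continuous_snd.rpow_const fun _ => Or.inr (by linarith)
    have h3 := contDiff_cutoff.continuous
    have h4 := contDiff_deriv_cutoff.continuous
    have h5 := continuous_growing_uncurry ha
    fun_prop
  obtain ⟨M₁, h1⟩ := hK.exists_bound_of_continuousOn (continuous_profile_uncurry ha).continuousOn
  obtain ⟨M₂, h2⟩ := hK.exists_bound_of_continuousOn hJ.continuousOn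
  obtain ⟨M₃, h3⟩ := hK.exists_bound_of_continuousOn (continuous_profileSource_uncurry ha).continuousOn
  refine ⟨max 1 (max M₁ (max M₂ M₃)), by positivity, fun θ hθ s hs => ?_⟩
  have hM : M₁ ≤ max 1 (max M₁ (max M₂ M₃)) ∧ M₂ ≤ max 1 (max M₁ (max M₂ M₃)) ∧
    M₃ ≤ max 1 (max M₁ (max M₂ M₃)) := by simp
  have hsa : 0 < s ^ a := Real.rpow_pos_of_pos hs a
  rcases lt_or_ge 2 s with h | h
  · rw [profile_of_two_lt h, profileFlux_of_two_lt h, profileSource_of_two_lt h, abs_zero]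
    refine ⟨?_, ?_, ?_⟩ <;> positivity
  · have hq : (θ, s) ∈ Icc (0 : ℝ) 1 ×ˢ Icc (0 : ℝ) 2 := ⟨hθ, hs.le, h⟩
    refine ⟨(h1 _ hq).trans hM.1, ?_, (h3 _ hq).trans hM.2.2⟩
    have e : profileFlux a θ s = J (θ, s) * s ^ a := by
      have h5 : s ^ (1 - a) * s ^ a = s := by
        rw [← Real.rpow_add hs]
        simp
      simp only [J, profileFlux, growingFlux_eq ha]
      rw [add_mul, mul_right_comm (s ^ (1 - a)), h5]
      ring
    rw [e, abs_mul, abs_of_pos hsa]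
    exact mul_le_mul_of_nonneg_right ((h2 _ hq).trans hM.2.1) hsa.le

theorem hasDerivAt_profile_scaled (ha : 0 < a) {μ z : ℝ} (hμ : 0 < μ) (hz : 0 < z) :
    HasDerivAt (fun z => profile a θ (μ * z)) (z⁻¹ * profileFlux a θ (μ * z)) z := by
  have h := (hasDerivAt_profile (θ := θ) ha (mul_pos hμ hz)).comp z ((hasDerivAt_id z).const_mul μ)
  have e : z⁻¹ * profileFlux a θ (μ * z) = profileFlux a θ (μ * z) / (μ * z) * (μ * 1) := by
    field_simp
  rw [e]
  exact h

/-- Dilation by `μ` multiplies the frequency by `μ ^ a`, which is what allows a reduction to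
frequencies in `[0, 1]`. -/
theorem hasDerivAt_profileFlux_scaled (ha : 0 < a) {μ z : ℝ} (hμ : 0 < μ) (hz : 0 < z) :
    HasDerivAt (fun z => profileFlux a θ (μ * z))
      (θ * μ ^ a * z ^ (a - 1) * profile a θ (μ * z) - μ * profileSource a θ (μ * z)) z := by
  have h := (hasDerivAt_profileFlux (θ := θ) ha (mul_pos hμ hz)).comp z
    ((hasDerivAt_id z).const_mul μ)
  have e : θ * μ ^ a * z ^ (a - 1) * profile a θ (μ * z) - μ * profileSource a θ (μ * z)
      = (θ * (μ * z) ^ (a - 1) * profile a θ (μ * z) - profileSource a θ (μ * z)) * (μ * 1) := by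
    rw [Real.mul_rpow hμ.le hz.le, Real.rpow_sub_one hμ.ne']
    field_simp
  rw [e]
  exact h

/-! ### Integration by parts on the half-line -/

/-- Integration by parts on `[ε, b + 1]` leaves the boundary term `w(ε) u(ε)`, where `u` is the
continuous version of `h`. It tends to 0 because `w = O(s ^ a)` and `u` grows at most
logarithmically, so no boundary value of `h` is required. -/
theorem integral_smul_add_integral_deriv_smul_eq_zero {w w' : ℝ → ℝ} {G h : ℝ → ℂ} {c : ℂ} {b M : ℝ}
    (ha : 0 < a) (hb : 0 < b) (hw : ∀ s, 0 < s → HasDerivAt w (w' s) s)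
    (hw' : ContinuousOn w' (Ioi 0)) (hwz : ∀ s, b < s → w s = 0)
    (hwb : ∀ s, 0 < s → |w s| ≤ M * s ^ a) (hG : LocallyIntegrableOn G (Ioi 0))
    (hGi : IntegrableOn (fun s => s * ‖G s‖ ^ 2) (Ioi 0))
    (hh : ∀ᵐ z ∂(volume.restrict (Ioi (0 : ℝ))), h z = c + ∫ s in (1 : ℝ)..z, G s)
    (i1 : IntegrableOn (fun z => w z • G z) (Ioi 0))
    (i2 : IntegrableOn (fun z => w' z • h z) (Ioi 0)) :
    (∫ z in Ioi 0, w z • G z) + ∫ z in Ioi 0, w' z • h z = 0 := by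
  obtain ⟨u, hu⟩ : ∃ u : ℝ → ℂ, u = fun z => c + ∫ s in (1 : ℝ)..z, G s := ⟨_, rfl⟩
  have hgi : ∀ x y, 0 < x → 0 < y → IntervalIntegrable G volume x y := fun x y hx hy =>
    intervalIntegrable_of_locallyIntegrableOn hG hx hy
  have hw'z : ∀ s, b < s → w' s = 0 := fun s hs => by
    have : w =ᶠ[𝓝 s] fun _ => 0 := by
      filter_upwards [Ioi_mem_nhds hs] with y hy using hwz y hy
    exact (hw s (hb.trans hs)).unique ((hasDerivAt_const s 0).congr_of_eventuallyEq this)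
  have hsupp : ∀ f : ℝ → ℂ, (∀ s, b < s → f s = 0) → ∫ z in Ioi 0, f z = ∫ z in (0 : ℝ)..(b + 1), f z := by
    intro f hf
    rw [intervalIntegral.integral_of_le (by linarith)]
    refine setIntegral_eq_of_subset_of_forall_sdiff_eq_zero measurableSet_Ioi
      (fun x hx => hx.1) fun x hx => hf x ?_
    by_contra h'
    exact hx.2 ⟨hx.1, by linarith⟩
  set f : ℝ → ℂ := fun z => w z • G z + w' z • h z
  have hfi : IntegrableOn f (Ioi 0) := i1.add i2
  have key : ∀ ε ∈ Ioc (0 : ℝ) (b + 1), ∫ z in ε..(b + 1), f z = -(w ε • u ε) := by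
    intro ε hε
    have hsub : Icc ε (b + 1) ⊆ Ioi 0 := fun s hs => hε.1.trans_le hs.1
    have hc' := hw'.mono hsub
    have hc'u : ContinuousOn w' (uIcc ε (b + 1)) := by rwa [uIcc_of_le hε.2]
    have j1 : IntervalIntegrable (fun z => w z • G z) volume ε (b + 1) :=
      (intervalIntegrable_iff_integrableOn_Icc_of_le hε.2).2 (i1.mono_set hsub)
    have j2 : IntervalIntegrable (fun z => w' z • h z) volume ε (b + 1) :=
      (intervalIntegrable_iff_integrableOn_Icc_of_le hε.2).2 (i2.mono_set hsub)
    have e1 : ∫ z in ε..(b + 1), w' z • h z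
        = ∫ z in ε..(b + 1), (w' z • u ε + w' z • ∫ t in ε..z, G t) := by
      refine intervalIntegral.integral_congr_ae ?_
      rw [ae_restrict_iff' measurableSet_Ioi] at hh
      filter_upwards [hh] with s hs hsm
      rw [uIoc_of_le hε.2] at hsm
      have hs0 : 0 < s := hε.1.trans hsm.1
      rw [hs hs0, hu, ← smul_add, add_assoc, intervalIntegral.integral_add_adjacent_intervals
        (hgi _ _ one_pos hε.1) (hgi _ _ hε.1 hs0)]
    have e2 := integral_deriv_smul_primitive hε.2 (fun s hs => hw s (hsub hs)) hc'
      ((intervalIntegrable_iff_integrableOn_Ioc_of_le hε.2).1 (hgi _ _ hε.1 (by linarith)))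
    have hb1 : w (b + 1) = 0 := hwz _ (by linarith)
    have e3 : ∫ s in ε..(b + 1), w' s = -w ε := by
      rw [intervalIntegral.integral_eq_sub_of_hasDerivAt
        (fun s hs => hw s (hsub (by rwa [uIcc_of_le hε.2] at hs))) hc'u.intervalIntegrable, hb1,
        zero_sub]
    have k1 : IntervalIntegrable (fun z => w' z • u ε) volume ε (b + 1) :=
      (hc'u.smul continuousOn_const).intervalIntegrable
    have k2 : IntervalIntegrable (fun z => w' z • ∫ t in ε..z, G t) volume ε (b + 1) := by
      refine ContinuousOn.intervalIntegrable (hc'u.smul ?_)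
      exact intervalIntegral.continuousOn_primitive_interval' (hgi _ _ hε.1 (by linarith))
        left_mem_uIcc
    rw [intervalIntegral.integral_add j1 j2, e1, intervalIntegral.integral_add k1 k2,
      intervalIntegral.integral_smul_const, e2, e3, hb1]
    simp
  have hlim1 : Tendsto (fun ε => ∫ z in ε..(b + 1), f z) (𝓝[>] 0) (𝓝 (∫ z in (0 : ℝ)..(b + 1), f z)) := by
    have hii : IntegrableOn f (uIcc 0 (b + 1)) := by
      rw [uIcc_of_le (by linarith), integrableOn_Icc_iff_integrableOn_Ioc]
      exact hfi.mono_set fun x hx => hx.1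
    have := (intervalIntegral.continuousOn_primitive_interval_left hii) 0 left_mem_uIcc
    rw [uIcc_of_le (by linarith)] at this
    exact this.tendsto.mono_left (nhdsWithin_le_of_mem (Icc_mem_nhdsGT (by linarith)))
  have hlim2 : Tendsto (fun ε => -(w ε • u ε)) (𝓝[>] 0) (𝓝 0) := by
    have h1 : Tendsto (fun z : ℝ => z ^ a * ‖u z‖) (𝓝[>] 0) (𝓝 0) := by
      refine tendsto_rpow_mul_norm_of_eq_integral (w := fun s => s • G s) (fun z hz => ?_) ?_ ha
      · rw [hu]
        simp only [intervalIntegral.integral_same, add_zero]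
        congr 1
        refine intervalIntegral.integral_congr_ae (Eventually.of_forall fun s hs => ?_)
        rw [uIoc, mem_Ioc] at hs
        have : 0 < s := (lt_min one_pos hz).trans hs.1
        rw [smul_smul, inv_mul_cancel₀ this.ne', one_smul]
      · refine (integrableOn_congr_fun (fun s hs => ?_) measurableSet_Ioi).1 hGi
        have hs0 : (0 : ℝ) < s := hs
        simp only [norm_smul, Real.norm_of_nonneg hs0.le]
        field_simp
    refine squeeze_zero_norm' ?_ (by simpa using h1.const_mul M)
    filter_upwards [self_mem_nhdsWithin] with z hz
    rw [norm_neg, norm_smul, ← mul_assoc]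
    exact mul_le_mul_of_nonneg_right (hwb z hz) (norm_nonneg _)
  have hlim3 : Tendsto (fun ε => ∫ z in ε..(b + 1), f z) (𝓝[>] 0) (𝓝 0) := by
    refine hlim2.congr' ?_
    filter_upwards [Ioc_mem_nhdsGT (by linarith : (0 : ℝ) < b + 1)] with ε hε using (key ε hε).symm
  rw [← integral_add i1 i2, hsupp f fun s hs => by simp [f, hwz s hs, hw'z s hs]]
  exact tendsto_nhds_unique hlim1 hlim3

end TaubWave
end

noncomputable section
namespace TaubWave

variable {n : ℕ} {a : ℝ}

/-! ### Rescaled frequencies -/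

/-- The inverse length scale at frequency `ξ`. -/
def scale (a : ℝ) (ξ : Rn n) : ℝ := 1 + freqSq ξ ^ (1 / a)

/-- The frequency, rescaled to lie in `[0, 1]`. -/
def reducedFreq (a : ℝ) (ξ : Rn n) : ℝ := freqSq ξ / scale a ξ ^ a

theorem one_le_scale (ξ : Rn n) : 1 ≤ scale a ξ :=
  le_add_of_nonneg_right (Real.rpow_nonneg (freqSq_nonneg ξ) _)

theorem scale_pos (ξ : Rn n) : 0 < scale a ξ := one_pos.trans_le (one_le_scale ξ)

theorem continuous_scale (ha : 0 < a) : Continuous (scale a : Rn n → ℝ) :=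
  continuous_const.add (continuous_freqSq.rpow_const fun _ => Or.inr (by positivity))

theorem continuous_reducedFreq (ha : 0 < a) : Continuous (reducedFreq a : Rn n → ℝ) :=
  continuous_freqSq.div ((continuous_scale ha).rpow_const fun _ => Or.inr ha.le)
    fun ξ => (Real.rpow_pos_of_pos (scale_pos ξ) a).ne'

theorem reducedFreq_mul (ξ : Rn n) : reducedFreq a ξ * scale a ξ ^ a = freqSq ξ :=
  div_mul_cancel₀ _ (Real.rpow_pos_of_pos (scale_pos ξ) a).ne'

theorem freqSq_le_scale_rpow (ha : 0 < a) (ξ : Rn n) : freqSq ξ ≤ scale a ξ ^ a := by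
  have h : freqSq ξ = (freqSq ξ ^ (1 / a)) ^ a := by
    rw [← Real.rpow_mul (freqSq_nonneg ξ), one_div_mul_cancel ha.ne', Real.rpow_one]
  rw [h]
  exact Real.rpow_le_rpow (Real.rpow_nonneg (freqSq_nonneg ξ) _)
    (le_add_of_nonneg_left zero_le_one) ha.le

theorem reducedFreq_mem (ha : 0 < a) (ξ : Rn n) : reducedFreq a ξ ∈ Icc (0 : ℝ) 1 := by
  have h := Real.rpow_pos_of_pos (scale_pos (a := a) ξ) a
  exact ⟨div_nonneg (freqSq_nonneg ξ) h.le, (div_le_one h).2 (freqSq_le_scale_rpow ha ξ)⟩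

theorem freqSq_le_scale_sq (ha : 0 < a) (ha1 : a ≤ 1) (ξ : Rn n) : freqSq ξ ≤ scale a ξ ^ 2 := by
  refine (freqSq_le_scale_rpow ha ξ).trans ?_
  rw [← Real.rpow_natCast]
  exact Real.rpow_le_rpow_of_exponent_le (one_le_scale ξ) (by push_cast; linarith)

/-- The Sobolev exponent enters here: `scale` is at most a constant times `(1 + ‖ξ‖ ^ 2) ^ (1 / a)`,
the weight of order `2 / a`. -/
theorem memLp_scale_mul (ha : 0 < a) {γ : L2 n} (h : MemHs n (2 / a) γ) :
    MemLp (fun ξ => (scale a ξ : ℂ) * (𝓕 γ : L2 n) ξ) 2 volume := by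
  have h1 := h.memLp_fourier
  refine (h1.const_mul (((1 + (2 * Real.pi) ^ (2 * (1 / a)) : ℝ)) : ℂ)).mono
    ((Complex.continuous_ofReal.comp (continuous_scale ha)).aestronglyMeasurable.mul
      (Lp.aestronglyMeasurable _)) (Eventually.of_forall fun ξ => ?_)
  have h0 : 0 ≤ ‖ξ‖ ^ 2 := sq_nonneg _
  have h2 : 1 ≤ (1 + ‖ξ‖ ^ 2) ^ (1 / a) := Real.one_le_rpow (by linarith) (by positivity)
  have h3 : freqSq ξ ^ (1 / a) ≤ (2 * Real.pi) ^ (2 * (1 / a)) * (1 + ‖ξ‖ ^ 2) ^ (1 / a) := by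
    rw [Real.rpow_mul (by positivity), ← Real.mul_rpow (by positivity) (by positivity)]
    refine Real.rpow_le_rpow (freqSq_nonneg ξ) ?_ (by positivity)
    rw [freqSq, mul_pow, Real.rpow_two]
    gcongr
    linarith
  have e : 2 / a / 2 = 1 / a := by ring
  rw [e, ← mul_assoc, ← Complex.ofReal_mul, norm_mul, norm_mul, Complex.norm_real, Complex.norm_real,
    Real.norm_of_nonneg (scale_pos ξ).le, Real.norm_of_nonneg (by positivity)]
  refine mul_le_mul_of_nonneg_right ?_ (norm_nonneg _)
  rw [scale]
  linarith

/-! ### Weighted bounds -/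

theorem weightedSq_mul_of_lintegral_le {r : ℝ} {Γ : Rn n → ℂ} (hΓ : StronglyMeasurable Γ)
    {μ : Rn n → ℝ} (hμΓ : MemLp (fun ξ => (μ ξ : ℂ) * Γ ξ) 2 volume) {m : Rn n × ℝ → ℂ}
    (hm : StronglyMeasurable m) {M : ℝ} (hM : 0 ≤ M)
    (h : ∀ ξ, ∫⁻ z in Ioi 0, ENNReal.ofReal (z ^ r) * ‖m (ξ, z)‖ₑ ^ 2
      ≤ ENNReal.ofReal (M * μ ξ ^ 2)) : WeightedSq n r (fun p => Γ p.1 * m p) := by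
  have hs : StronglyMeasurable fun p : Rn n × ℝ => Γ p.1 * m p :=
    (hΓ.comp_measurable measurable_fst).mul hm
  refine ⟨hs.aestronglyMeasurable, ?_⟩
  have hw : Measurable fun p : Rn n × ℝ => ENNReal.ofReal (p.2 ^ r) := by fun_prop
  have hms : Measurable fun p : Rn n × ℝ => ENNReal.ofReal (p.2 ^ r) * ‖Γ p.1 * m p‖ₑ ^ 2 :=
    hw.mul (hs.enorm.pow_const 2)
  rw [volume_restrict_halfSpace, lintegral_prod _ hms.aemeasurable]
  refine lt_of_le_of_lt (lintegral_mono (g := fun ξ => ENNReal.ofReal M * ‖(μ ξ : ℂ) * Γ ξ‖ₑ ^ 2)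
    fun ξ => ?_) ?_
  · have e : ∀ z : ℝ, ENNReal.ofReal (z ^ r) * ‖Γ ξ * m (ξ, z)‖ₑ ^ 2
        = ‖Γ ξ‖ₑ ^ 2 * (ENNReal.ofReal (z ^ r) * ‖m (ξ, z)‖ₑ ^ 2) := fun z => by
      rw [enorm_mul]
      ring
    simp only [e]
    rw [lintegral_const_mul' _ _ (by simp), enorm_mul, mul_pow, mul_comm (‖Γ ξ‖ₑ ^ 2), ← mul_assoc]
    refine mul_le_mul_left ((h ξ).trans_eq ?_) _
    rw [ENNReal.ofReal_mul hM, ← ofReal_norm (μ ξ : ℂ), ← ENNReal.ofReal_pow (norm_nonneg _),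
      Complex.norm_real, Real.norm_eq_abs, sq_abs]
  · rw [lintegral_const_mul' _ _ (by simp)]
    exact ENNReal.mul_lt_top (by simp) (memLp_two_iff_lintegral.1 hμΓ).2

theorem lintegral_rpow_mul_le {f : ℝ → ℂ} {r q K b : ℝ} (hq : -1 < q) (hK : 0 ≤ K) (hb : 0 ≤ b)
    (h0 : ∀ z, b < z → f z = 0) (h : ∀ z, 0 < z → z ≤ b → z ^ r * ‖f z‖ ^ 2 ≤ K * z ^ q) :
    ∫⁻ z in Ioi 0, ENNReal.ofReal (z ^ r) * ‖f z‖ₑ ^ 2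
      ≤ ENNReal.ofReal (K * (b ^ (q + 1) / (q + 1))) := by
  have hi : IntegrableOn (fun z : ℝ => K * z ^ q) (Ioc 0 b) :=
    (intervalIntegrable_iff_integrableOn_Ioc_of_le hb).1
      ((intervalIntegral.intervalIntegrable_rpow' hq).const_mul K)
  have e : K * (b ^ (q + 1) / (q + 1)) = ∫ z in Ioc 0 b, K * z ^ q := by
    rw [← intervalIntegral.integral_of_le hb, intervalIntegral.integral_const_mul,
      integral_rpow (Or.inl hq), Real.zero_rpow (by linarith), sub_zero]
  rw [e, ofReal_integral_eq_lintegral_ofReal hi]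
  · rw [← lintegral_indicator measurableSet_Ioi, ← lintegral_indicator measurableSet_Ioc]
    refine lintegral_mono fun z => ?_
    by_cases hz : z ∈ Ioc 0 b
    · rw [indicator_of_mem (mem_Ioi.2 hz.1), indicator_of_mem hz, ← ofReal_norm,
        ← ENNReal.ofReal_pow (norm_nonneg _), ← ENNReal.ofReal_mul (Real.rpow_nonneg hz.1.le r)]
      exact ENNReal.ofReal_le_ofReal (h z hz.1 hz.2)
    · rw [indicator_of_notMem hz]
      by_cases hz0 : 0 < z
      · rw [indicator_of_mem (mem_Ioi.2 hz0), h0 z (by by_contra h'; exact hz ⟨hz0, by linarith⟩)]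
        simp
      · rw [indicator_of_notMem (by simpa using hz0)]
  · filter_upwards [ae_restrict_mem measurableSet_Ioc] with z hz
    have := Real.rpow_nonneg hz.1.le q
    positivity

/-! ### The extension of a boundary datum, on the Fourier side -/

/-- The profile at frequency `ξ`. -/
def extProfile (a : ℝ) (p : Rn n × ℝ) : ℝ :=
  profile a (reducedFreq a p.1) (scale a p.1 * p.2)

/-- The flux of the profile at frequency `ξ`. -/
def extFlux (a : ℝ) (p : Rn n × ℝ) : ℝ :=
  profileFlux a (reducedFreq a p.1) (scale a p.1 * p.2)

/-- The defect of the profile at frequency `ξ`. -/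
def extSource (a : ℝ) (p : Rn n × ℝ) : ℝ :=
  scale a p.1 * profileSource a (reducedFreq a p.1) (scale a p.1 * p.2)

theorem continuous_scaled (ha : 0 < a) :
    Continuous fun p : Rn n × ℝ => (reducedFreq a p.1, scale a p.1 * p.2) :=
  ((continuous_reducedFreq ha).comp continuous_fst).prodMk
    (((continuous_scale ha).comp continuous_fst).mul continuous_snd)

theorem continuous_extProfile (ha : 0 < a) : Continuous (extProfile a : Rn n × ℝ → ℝ) :=
  (continuous_profile_uncurry ha).comp (continuous_scaled ha)

theorem continuous_extFlux (ha : 0 < a) : Continuous (extFlux a : Rn n × ℝ → ℝ) :=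
  (continuous_profileFlux_uncurry ha).comp (continuous_scaled ha)

theorem continuous_extSource (ha : 0 < a) : Continuous (extSource a : Rn n × ℝ → ℝ) :=
  ((continuous_scale ha).comp continuous_fst).mul
    ((continuous_profileSource_uncurry ha).comp (continuous_scaled ha))

theorem hasDerivAt_extProfile (ha : 0 < a) (ξ : Rn n) {z : ℝ} (hz : 0 < z) :
    HasDerivAt (fun z => extProfile a (ξ, z)) (z⁻¹ * extFlux a (ξ, z)) z := by
  simp only [extProfile, extFlux]
  exact hasDerivAt_profile_scaled (θ := reducedFreq a ξ) ha (scale_pos (a := a) ξ) hz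

theorem hasDerivAt_extFlux (ha : 0 < a) (ξ : Rn n) {z : ℝ} (hz : 0 < z) :
    HasDerivAt (fun z => extFlux a (ξ, z))
      (freqSq ξ * z ^ (a - 1) * extProfile a (ξ, z) - extSource a (ξ, z)) z := by
  rw [← reducedFreq_mul (a := a) ξ]
  simp only [extProfile, extFlux, extSource]
  exact hasDerivAt_profileFlux_scaled (θ := reducedFreq a ξ) ha (scale_pos (a := a) ξ) hz

theorem two_lt_scale_mul {ξ : Rn n} {z : ℝ} (hz : 2 / scale a ξ < z) : 2 < scale a ξ * z := by
  rwa [div_lt_iff₀' (scale_pos ξ)] at hz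

theorem two_div_scale_le (ξ : Rn n) : 2 / scale a ξ ≤ 2 :=
  div_le_self zero_le_two (one_le_scale ξ)

/-- At each frequency the four weighted integrals in `z` are `O(scale ^ 2)`, by the uniform bounds
for the profile and its support in `scale * z ≤ 2`. The last one requires the full power `scale ^
2`. -/
theorem exists_weightedSq_ext (ha : 1 / 2 ≤ a) (ha1 : a ≤ 1) {Γ : Rn n → ℂ}
    (hΓ : StronglyMeasurable Γ) (hμΓ : MemLp (fun ξ => (scale a ξ : ℂ) * Γ ξ) 2 volume) :
    WeightedSq n 1 (fun p => Γ p.1 * (extProfile a p : ℂ)) ∧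
    WeightedSq n 1 (fun p => Γ p.1 * ((p.2⁻¹ * extFlux a p : ℝ) : ℂ)) ∧
    (∀ i, WeightedSq n (a - 1)
      (fun p => Γ p.1 * ((2 * Real.pi * Complex.I * (p.1 i : ℝ)) * (extProfile a p : ℂ)))) ∧
    WeightedSq n 1 (fun p => Γ p.1 * ((p.2⁻¹ * extSource a p : ℝ) : ℂ)) := by
  have ha0 : 0 < a := by linarith
  obtain ⟨M, hM, hb⟩ := exists_profile_bound ha0 ha1
  have hb' := fun (ξ : Rn n) {z : ℝ} (hz : 0 < z) =>
    hb _ (reducedFreq_mem ha0 ξ) (scale a ξ * z) (mul_pos (scale_pos ξ) hz)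
  have hsup : ∀ (ξ : Rn n) (z : ℝ), 2 / scale a ξ < z →
      extProfile a (ξ, z) = 0 ∧ extFlux a (ξ, z) = 0 ∧ extSource a (ξ, z) = 0 := fun ξ z hz => by
    have h2 := two_lt_scale_mul hz
    refine ⟨profile_of_two_lt h2, profileFlux_of_two_lt h2, ?_⟩
    rw [extSource, profileSource_of_two_lt h2, mul_zero]
  have hmz : Measurable fun p : Rn n × ℝ => p.2⁻¹ := by fun_prop
  have hpm : Measurable fun p : Rn n × ℝ => ((extProfile a p : ℝ) : ℂ) :=
    (Complex.continuous_ofReal.comp (continuous_extProfile ha0)).measurable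
  have hfm : Measurable fun p : Rn n × ℝ => ((p.2⁻¹ * extFlux a p : ℝ) : ℂ) :=
    Complex.measurable_ofReal.comp (hmz.mul (continuous_extFlux ha0).measurable)
  have hsm : Measurable fun p : Rn n × ℝ => ((p.2⁻¹ * extSource a p : ℝ) : ℂ) :=
    Complex.measurable_ofReal.comp (hmz.mul (continuous_extSource ha0).measurable)
  have hM2 : 0 ≤ M ^ 2 := sq_nonneg M
  refine ⟨?_, ?_, fun i => ?_, ?_⟩
  · refine weightedSq_mul_of_lintegral_le hΓ hμΓ hpm.stronglyMeasurable (M := 4 * M ^ 2)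
      (by positivity) fun ξ => ?_
    have hμ1 := one_le_scale (a := a) ξ
    refine (lintegral_rpow_mul_le (q := 0) (K := 2 * M ^ 2) (b := 2) (by norm_num) (by positivity)
      zero_le_two (fun z hz => ?_) fun z hz hz2 => ?_).trans (ENNReal.ofReal_le_ofReal ?_)
    · rw [(hsup ξ z ((two_div_scale_le ξ).trans_lt hz)).1, Complex.ofReal_zero]
    · rw [Complex.norm_real, Real.norm_eq_abs, Real.rpow_one, Real.rpow_zero, mul_one]
      exact mul_le_mul hz2 (pow_le_pow_left₀ (abs_nonneg _) (hb' ξ hz).1 2) (by positivity)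
        zero_le_two
    · norm_num
      nlinarith [mul_le_mul_of_nonneg_left (one_le_pow₀ hμ1 : 1 ≤ scale a ξ ^ 2) hM2]
  · refine weightedSq_mul_of_lintegral_le hΓ hμΓ hfm.stronglyMeasurable (M := 4 * M ^ 2)
      (by positivity) fun ξ => ?_
    have hμ1 := one_le_scale (a := a) ξ
    have hμ0 := scale_pos (a := a) ξ
    refine (lintegral_rpow_mul_le (q := 0) (K := 2 * M ^ 2 * scale a ξ) (b := 2 / scale a ξ)
      (by norm_num) (by positivity) (by positivity) (fun z hz => ?_) fun z hz hz2 => ?_).trans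
      (ENNReal.ofReal_le_ofReal ?_)
    · rw [(hsup ξ z hz).2.1, mul_zero, Complex.ofReal_zero]
    · have h1 := (hb' ξ hz).2.1
      have h2 : 0 < scale a ξ * z := mul_pos hμ0 hz
      have h3 : scale a ξ * z ≤ 2 := by rwa [le_div_iff₀' hμ0] at hz2
      -- As `0 ≤ 2 a - 1 ≤ 1` and `scale * z ≤ 2`, one factor `scale * z` is kept, to cancel `z⁻¹`,
      -- and the remaining power is at most 2.
      have h4 : ((scale a ξ * z) ^ a) ^ 2 ≤ 2 * (scale a ξ * z) := by
        rw [← Real.rpow_natCast, ← Real.rpow_mul h2.le,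
          show a * ((2 : ℕ) : ℝ) = (2 * a - 1) + 1 by push_cast; ring, Real.rpow_add_one h2.ne']
        refine mul_le_mul_of_nonneg_right ?_ h2.le
        calc (scale a ξ * z) ^ (2 * a - 1) ≤ 2 ^ (2 * a - 1) :=
              Real.rpow_le_rpow h2.le h3 (by linarith)
          _ ≤ 2 ^ (1 : ℝ) := Real.rpow_le_rpow_of_exponent_le one_le_two (by linarith)
          _ = 2 := Real.rpow_one 2
      have h5 : extFlux a (ξ, z) ^ 2 ≤ M ^ 2 * (2 * (scale a ξ * z)) := by
        rw [← sq_abs]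
        refine (pow_le_pow_left₀ (abs_nonneg _) h1 2).trans ?_
        rw [mul_pow]
        exact mul_le_mul_of_nonneg_left h4 hM2
      rw [Complex.norm_real, Real.norm_eq_abs, Real.rpow_one, Real.rpow_zero, mul_one, sq_abs,
        mul_pow]
      calc z * (z⁻¹ ^ 2 * extFlux a (ξ, z) ^ 2) = z⁻¹ * extFlux a (ξ, z) ^ 2 := by
            field_simp
        _ ≤ z⁻¹ * (M ^ 2 * (2 * (scale a ξ * z))) := by gcongr
        _ = 2 * M ^ 2 * scale a ξ := by field_simp
    · norm_num
      rw [mul_assoc (2 * M ^ 2), mul_div_cancel₀ _ hμ0.ne']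
      nlinarith [mul_le_mul_of_nonneg_left (one_le_pow₀ hμ1 : 1 ≤ scale a ξ ^ 2) hM2]
  · have hfq : Measurable fun p : Rn n × ℝ => 2 * Real.pi * Complex.I * ((p.1 i : ℝ) : ℂ) := by
      fun_prop
    refine weightedSq_mul_of_lintegral_le hΓ hμΓ (hfq.mul hpm).stronglyMeasurable
      (M := M ^ 2 * (2 ^ a / a)) (by positivity) fun ξ => ?_
    refine (lintegral_rpow_mul_le (q := a - 1) (K := M ^ 2 * scale a ξ ^ 2) (b := 2) (by linarith)
      (by positivity) zero_le_two (fun z hz => ?_) fun z hz hz2 => ?_).trans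
      (ENNReal.ofReal_le_ofReal ?_)
    · rw [(hsup ξ z ((two_div_scale_le ξ).trans_lt hz)).1, Complex.ofReal_zero, mul_zero]
    · rw [norm_mul, norm_freq, Complex.norm_real, Real.norm_eq_abs, mul_pow, sq_abs, mul_comm]
      refine mul_le_mul_of_nonneg_right ?_ (Real.rpow_nonneg hz.le _)
      rw [mul_comm]
      exact mul_le_mul (pow_le_pow_left₀ (abs_nonneg _) (hb' ξ hz).1 2)
        ((freq_sq_le ξ i).trans (freqSq_le_scale_sq ha0 ha1 ξ)) (sq_nonneg _) hM2
    · rw [sub_add_cancel]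
      exact le_of_eq (by ring)
  · refine weightedSq_mul_of_lintegral_le hΓ hμΓ hsm.stronglyMeasurable (M := 2 * M ^ 2)
      (by positivity) fun ξ => ?_
    have hμ0 := scale_pos (a := a) ξ
    refine (lintegral_rpow_mul_le (q := 0) (K := M ^ 2 * scale a ξ ^ 3) (b := 2 / scale a ξ)
      (by norm_num) (by positivity) (by positivity) (fun z hz => ?_) fun z hz hz2 => ?_).trans
      (ENNReal.ofReal_le_ofReal ?_)
    · rw [(hsup ξ z hz).2.2, mul_zero, Complex.ofReal_zero]
    · rw [Complex.norm_real, Real.norm_eq_abs, Real.rpow_one, Real.rpow_zero, mul_one, sq_abs,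
        mul_pow]
      have e : z * (z⁻¹ ^ 2 * extSource a (ξ, z) ^ 2) = z⁻¹ * extSource a (ξ, z) ^ 2 := by
        field_simp
      rw [e]
      -- The profile is an exact solution below `scale * z = 1`, so the source vanishes there;
      -- elsewhere `z⁻¹ ≤ scale`. This is what keeps `z⁻¹ extSource` square integrable up to the
      -- boundary.
      rcases lt_or_ge (scale a ξ * z) 1 with h1 | h1
      · rw [extSource, profileSource_of_lt_one h1]
        simp only [mul_zero, ne_eq, OfNat.ofNat_ne_zero, not_false_eq_true, zero_pow]
        positivity
      · have h2 : z⁻¹ ≤ scale a ξ := by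
          rw [inv_eq_one_div, div_le_iff₀ hz]
          exact h1
        have h3 : extSource a (ξ, z) ^ 2 ≤ scale a ξ ^ 2 * M ^ 2 := by
          rw [extSource, mul_pow]
          refine mul_le_mul_of_nonneg_left ?_ (sq_nonneg _)
          rw [← sq_abs]
          exact pow_le_pow_left₀ (abs_nonneg _) (hb' ξ hz).2.2 2
        calc z⁻¹ * extSource a (ξ, z) ^ 2 ≤ scale a ξ * (scale a ξ ^ 2 * M ^ 2) :=
              mul_le_mul h2 h3 (sq_nonneg _) hμ0.le
          _ = M ^ 2 * scale a ξ ^ 3 := by ring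
    · norm_num
      refine le_of_eq ?_
      field_simp

end TaubWave
end

noncomputable section
namespace TaubWave

variable {n : ℕ} {a : ℝ}

/-! ### Extension of boundary data -/

theorem exists_ext_bound (ha : 0 < a) (ha1 : a ≤ 1) (Γ : Rn n → ℂ) : ∃ M : ℝ, ∀ ξ z, 0 < z →
    ‖Γ ξ * (extProfile a (ξ, z) : ℂ)‖ ≤ M * ‖Γ ξ‖ := by
  obtain ⟨M, -, hb⟩ := exists_profile_bound ha ha1
  refine ⟨M, fun ξ z hz => ?_⟩
  rw [norm_mul, Complex.norm_real, Real.norm_eq_abs, mul_comm]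
  exact mul_le_mul_of_nonneg_right
    (hb _ (reducedFreq_mem ha ξ) _ (mul_pos (scale_pos ξ) hz)).1 (norm_nonneg _)

theorem continuousOn_inv_mul_extFlux (ha : 0 < a) (ξ : Rn n) :
    ContinuousOn (fun z => z⁻¹ * extFlux a (ξ, z)) (Ioi 0) :=
  (continuousOn_id.inv₀ fun _ hz => ne_of_gt hz).mul
    ((continuous_extFlux ha).comp (Continuous.prodMk_right ξ)).continuousOn

theorem ext_eq_primitive (ha : 0 < a) (Γ : ℂ) (ξ : Rn n) {z : ℝ} (hz : 0 < z) :
    Γ * (extProfile a (ξ, z) : ℂ) = Γ * (extProfile a (ξ, 1) : ℂ)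
      + ∫ s in (1 : ℝ)..z, Γ * ((s⁻¹ * extFlux a (ξ, s) : ℝ) : ℂ) := by
  have hsub : ∀ s ∈ uIcc 1 z, 0 < s := fun s hs => (lt_min one_pos hz).trans_le hs.1
  rw [intervalIntegral.integral_eq_sub_of_hasDerivAt
    (fun s hs => ((hasDerivAt_extProfile ha ξ (hsub s hs)).ofReal_comp.const_mul Γ))]
  · ring
  · refine ContinuousOn.intervalIntegrable (continuousOn_const.mul ?_)
    exact Complex.continuous_ofReal.comp_continuousOn
      ((continuousOn_inv_mul_extFlux ha ξ).mono hsub)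

theorem stronglyMeasurable_ext (ha : 0 < a) {Γ : Rn n → ℂ} (hΓ : StronglyMeasurable Γ) :
    StronglyMeasurable fun p : Rn n × ℝ => Γ p.1 * (extProfile a p : ℂ) :=
  (hΓ.comp_measurable measurable_fst).mul
    (Complex.continuous_ofReal.comp (continuous_extProfile ha)).stronglyMeasurable

theorem slice_ext_eq_primitive (ha : 0 < a) (ha1 : a ≤ 1) {Γ : Rn n → ℂ} (hΓ : StronglyMeasurable Γ)
    (hΓ2 : MemLp Γ 2 volume)
    (hV : WeightedSq n 1 (fun p => Γ p.1 * ((p.2⁻¹ * extFlux a p : ℝ) : ℂ))) {z : ℝ} (hz : 0 < z) :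
    slice (fun p => Γ p.1 * (extProfile a p : ℂ)) z
      = slice (fun p => Γ p.1 * (extProfile a p : ℂ)) 1
        + ∫ s in (1 : ℝ)..z, slice (fun p => Γ p.1 * ((p.2⁻¹ * extFlux a p : ℝ) : ℂ)) s := by
  obtain ⟨M, hM⟩ := exists_ext_bound ha ha1 Γ
  have hm : ∀ {y : ℝ}, 0 < y → MemLp (fun ξ => Γ ξ * (extProfile a (ξ, y) : ℂ)) 2 volume :=
    fun {y} hy => memLp_of_norm_le_mul
      ((stronglyMeasurable_ext ha hΓ).comp_measurable measurable_prodMk_right).aestronglyMeasurable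
      hΓ2.norm (C := M) (Eventually.of_forall fun ξ => hM ξ y hy)
  refine Lp.ext ?_
  filter_upwards [coeFn_slice (f := fun p => Γ p.1 * (extProfile a p : ℂ)) (hm hz),
    coeFn_slice (f := fun p => Γ p.1 * (extProfile a p : ℂ)) (hm one_pos),
    Lp.coeFn_add (slice (fun p => Γ p.1 * (extProfile a p : ℂ)) 1)
      (∫ s in (1 : ℝ)..z, slice (fun p => Γ p.1 * ((p.2⁻¹ * extFlux a p : ℝ) : ℂ)) s),
    hV.isSlices.coeFn_intervalIntegral hV.locallyIntegrableOn_slice hz] with ξ h1 h2 h3 h4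
  rw [h1, h3, Pi.add_apply, h2, h4]
  exact ext_eq_primitive ha (Γ ξ) ξ hz

/-- The weak form of the equation on the Fourier side, at a fixed frequency. -/
theorem integral_ext_eq_zero (ha : 1 / 2 ≤ a) (ha1 : a ≤ 1) (ξ : Rn n) {G h : ℝ → ℂ} {c : ℂ}
    (hG : LocallyIntegrableOn G (Ioi 0)) (hGi : IntegrableOn (fun s => s * ‖G s‖ ^ 2) (Ioi 0))
    (hh : ∀ᵐ z ∂(volume.restrict (Ioi (0 : ℝ))), h z = c + ∫ s in (1 : ℝ)..z, G s)
    (i1 : IntegrableOn (fun z => extFlux a (ξ, z) • G z) (Ioi 0))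
    (i2 : IntegrableOn (fun z => (freqSq ξ * z ^ (a - 1) * extProfile a (ξ, z)
      - extSource a (ξ, z)) • h z) (Ioi 0)) :
    (∫ z in Ioi 0, extFlux a (ξ, z) • G z) + ∫ z in Ioi 0, (freqSq ξ * z ^ (a - 1) *
      extProfile a (ξ, z) - extSource a (ξ, z)) • h z = 0 := by
  have ha0 : 0 < a := by linarith
  obtain ⟨M, hM, hb⟩ := exists_profile_bound ha0 ha1
  have hp := (continuous_extProfile ha0).comp (Continuous.prodMk_right ξ)
  have hs := (continuous_extSource ha0).comp (Continuous.prodMk_right ξ)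
  have hr : ContinuousOn (fun z : ℝ => freqSq ξ * z ^ (a - 1)) (Ioi 0) :=
    continuousOn_const.mul (continuousOn_id.rpow_const fun z hz => Or.inl (ne_of_gt hz))
  refine integral_smul_add_integral_deriv_smul_eq_zero (M := M * scale a ξ ^ a) ha0 two_pos
    (fun s hs => hasDerivAt_extFlux ha0 ξ hs) ((hr.mul hp.continuousOn).sub hs.continuousOn)
    (fun s hs => profileFlux_of_two_lt (two_lt_scale_mul ((two_div_scale_le ξ).trans_lt hs)))
    (fun s hs => ?_) hG hGi hh i1 i2
  rw [mul_assoc, ← Real.mul_rpow (scale_pos ξ).le hs.le]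
  exact (hb _ (reducedFreq_mem ha0 ξ) _ (mul_pos (scale_pos ξ) hs)).2.1

theorem integrable_of_integrable_mul_star {w : ℝ → ℝ} {G : ℝ → ℂ} {Γ : ℂ} (hΓ : Γ ≠ 0)
    (h : IntegrableOn (fun z => Γ * (w z * star (G z))) (Ioi 0)) :
    IntegrableOn (fun z => w z • G z) (Ioi 0) := by
  have h1 := Complex.conjCLE.toContinuousLinearMap.integrable_comp (h.const_mul Γ⁻¹)
  refine h1.congr (Eventually.of_forall fun z => ?_)
  simp [inv_mul_cancel_left₀ hΓ]

/-- The extension is weakly harmonic up to its defect. -/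
theorem integral_ext_eq_integral_source (ha : 1 / 2 ≤ a) (ha1 : a ≤ 1) {Γ : Rn n → ℂ}
    {F G : Rn n × ℝ → ℂ} {X Y : ℝ → L2 n} {c : L2 n} (hF : StronglyMeasurable F)
    (hG : StronglyMeasurable G) (hFX : IsSlices (volume.restrict (Ioi 0)) F X)
    (hGY : IsSlices (volume.restrict (Ioi 0)) G Y) (hY : LocallyIntegrableOn Y (Ioi 0))
    (h : ∀ᵐ z ∂(volume.restrict (Ioi (0 : ℝ))), X z = c + ∫ s in (1 : ℝ)..z, Y s)
    (hGi : ∫⁻ p, ENNReal.ofReal (p.2 ^ (1 : ℝ)) * ‖G p‖ₑ ^ 2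
      ∂((volume : Measure (Rn n)).prod (volume.restrict (Ioi 0))) < ⊤)
    (i1 : IntegrableOn (fun p => Γ p.1 * (extFlux a p * star (G p))) (halfSpace n))
    (i2 : IntegrableOn (fun p => Γ p.1 * ((freqSq p.1 * p.2 ^ (a - 1) * extProfile a p : ℝ)
      * star (F p))) (halfSpace n))
    (i3 : IntegrableOn (fun p => Γ p.1 * (extSource a p * star (F p))) (halfSpace n)) :
    (∫ p in halfSpace n, Γ p.1 * (extFlux a p * star (G p)))
      + ∫ p in halfSpace n, Γ p.1 * ((freqSq p.1 * p.2 ^ (a - 1) * extProfile a p : ℝ) * star (F p))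
      = ∫ p in halfSpace n, Γ p.1 * (extSource a p * star (F p)) := by
  have i4 : IntegrableOn (fun p => Γ p.1 * ((freqSq p.1 * p.2 ^ (a - 1) * extProfile a p
      - extSource a p : ℝ) * star (F p))) (halfSpace n) := by
    refine (i2.sub i3).congr (Eventually.of_forall fun p => ?_)
    simp only [Pi.sub_apply]
    push_cast
    ring
  rw [← sub_eq_zero, add_sub_assoc, ← integral_sub i2 i3]
  have e : ∀ p : Rn n × ℝ, Γ p.1 * ((freqSq p.1 * p.2 ^ (a - 1) * extProfile a p : ℝ) * star (F p))
      - Γ p.1 * (extSource a p * star (F p)) = Γ p.1 * ((freqSq p.1 * p.2 ^ (a - 1) * extProfile a p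
      - extSource a p : ℝ) * star (F p)) := fun p => by
    push_cast
    ring
  simp only [e]
  rw [← integral_add i1 i4]
  rw [IntegrableOn, volume_restrict_halfSpace] at i1 i4
  have i5 : Integrable (fun p : Rn n × ℝ => Γ p.1 * (extFlux a p * star (G p))
      + Γ p.1 * ((freqSq p.1 * p.2 ^ (a - 1) * extProfile a p - extSource a p : ℝ) * star (F p)))
      ((volume : Measure (Rn n)).prod (volume.restrict (Ioi 0))) := i1.add i4
  rw [volume_restrict_halfSpace, integral_prod _ i5]
  refine integral_eq_zero_of_ae ?_
  filter_upwards [ae_ae_eq_primitive hF hG hFX hGY hY h, hGY.ae_locallyIntegrableOn hY,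
    ae_integrableOn_of_lintegral_lt_top hG hGi, i1.prod_right_ae, i4.prod_right_ae]
    with ξ h1 h2 h3 h4 h5
  -- Frequencies with `Γ ξ = 0` contribute nothing; at the others division by `Γ ξ` recovers the
  -- integrability needed for the scalar identity.
  by_cases hΓ : Γ ξ = 0
  · simp [hΓ]
  simp only [Real.rpow_one] at h3
  have key := integral_ext_eq_zero ha ha1 ξ h2 h3 h1 (integrable_of_integrable_mul_star hΓ h4)
    (integrable_of_integrable_mul_star (w := fun z => freqSq ξ * z ^ (a - 1) * extProfile a (ξ, z)
      - extSource a (ξ, z)) hΓ h5)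
  -- The identity `key` is linear in the test function, whereas the form is conjugate linear in it.
  have h6 := congrArg (fun y => Γ ξ * (starRingEnd ℂ) y) key
  simp only [map_add, ← integral_conj, map_zero, mul_zero, mul_add, ← integral_const_mul] at h6
  rw [integral_add h4 h5]
  simpa using h6

/-- The extension is prescribed on the Fourier side as `γ̂` times the rescaled profile, and its
image under `A` as `γ̂` times `z⁻¹ extSource`. Plancherel moves the weak equation to the Fourier
side, where it is an integration by parts in `z` at almost every frequency. -/
theorem exists_extension (hn : 2 ≤ n) {γ : L2 n} (hγ : MemHs n (2 * (n : ℝ) / ((n : ℝ) - 1)) γ) :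
    ∃ φ ∈ domainA n, IsBoundaryTrace n φ γ := by
  obtain ⟨ha, ha1⟩ := one_sub_one_div_mem hn
  obtain ⟨a, hadef⟩ : ∃ a, a = 1 - 1 / (n : ℝ) := ⟨_, rfl⟩
  rw [← hadef] at ha ha1
  have ha0 : 0 < a := by linarith
  have han : -(1 / (n : ℝ)) = a - 1 := by rw [hadef]; ring
  have hn0 : (2 : ℝ) ≤ n := by exact_mod_cast hn
  have hs : 2 * (n : ℝ) / ((n : ℝ) - 1) = 2 / a := by
    rw [hadef]
    field_simp
  rw [hs] at hγ
  obtain ⟨Γ, hΓdef⟩ : ∃ Γ : Rn n → ℂ, Γ = (𝓕 γ : L2 n) := ⟨_, rfl⟩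
  have hΓ : StronglyMeasurable Γ := hΓdef ▸ Lp.stronglyMeasurable _
  have hΓ2 : MemLp Γ 2 volume := hΓdef ▸ Lp.memLp (𝓕 γ : L2 n)
  obtain ⟨hU, hV, hK, hP⟩ := exists_weightedSq_ext ha ha1.le hΓ (hΓdef ▸ memLp_scale_mul ha0 hγ)
  set U : Rn n × ℝ → ℂ := fun p => Γ p.1 * (extProfile a p : ℂ)
  set V : Rn n × ℝ → ℂ := fun p => Γ p.1 * ((p.2⁻¹ * extFlux a p : ℝ) : ℂ)
  set K : Fin n → Rn n × ℝ → ℂ := fun i p =>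
    Γ p.1 * ((2 * Real.pi * Complex.I * (p.1 i : ℝ)) * (extProfile a p : ℂ))
  set P : Rn n × ℝ → ℂ := fun p => Γ p.1 * ((p.2⁻¹ * extSource a p : ℝ) : ℂ)
  obtain ⟨f, hf, hfr, hfs⟩ := hU.exists_fourierInv
  obtain ⟨g, hg, hgr, hgs⟩ := hV.exists_fourierInv
  choose k hk hkr hks using fun i => (hK i).exists_fourierInv
  obtain ⟨q, hq, hqr, hqs⟩ := hP.exists_fourierInv
  have hinv : ∀ {Q r : Rn n × ℝ → ℂ}, IsSlices (volume.restrict (Ioi 0)) r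
      (fun z => fourierInvL n (slice Q z)) →
      ∀ᵐ z ∂(volume.restrict (Ioi (0 : ℝ))), slice Q z = 𝓕 (slice r z) := fun h => by
    filter_upwards [h.slice_eq] with z hz
    rw [hz, fourier_fourierInvL]
  obtain ⟨φ, hφ⟩ : ∃ φ : H n, (φ : Rn n × ℝ → ℂ) =ᵐ[volume.restrict (halfSpace n)] f :=
    ⟨hfr.memLp.toLp f, ae_eq_weighted_iff.1 hfr.memLp.coeFn_toLp⟩
  obtain ⟨ψ, hψ⟩ : ∃ ψ : H n, (ψ : Rn n × ℝ → ℂ) =ᵐ[volume.restrict (halfSpace n)] q :=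
    ⟨hqr.memLp.toLp q, ae_eq_weighted_iff.1 hqr.memLp.coeFn_toLp⟩
  have hVl := locallyIntegrableOn_of_lintegral_rpow (r := 1) hgs.2.1 (by
    have e : ∀ Y : L2 n, ‖fourierInvL n Y‖ₑ = ‖Y‖ₑ := fun Y => by
      rw [← ofReal_norm, norm_fourierInvL, ofReal_norm]
    simp only [e]
    rw [hV.lintegral_slice]
    exact hV.2)
  have hgrad : HasGradient φ g k := by
    refine ⟨⟨?_, hgr⟩, fun i => ⟨?_, han ▸ hkr i⟩⟩
    · refine (isWeakDeriv_of_eq_primitive hf hg hfr hgr hfs hgs hVl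
        (c := fourierInvL n (slice U 1)) ?_).congr hφ.symm Filter.EventuallyEq.rfl
      filter_upwards [ae_restrict_mem measurableSet_Ioi] with z hz
      rw [slice_ext_eq_primitive ha0 ha1.le hΓ hΓ2 hV hz, map_add,
        (fourierInvL n).intervalIntegral_comp_comm
          (intervalIntegrable_of_locallyIntegrableOn hV.locallyIntegrableOn_slice one_pos hz)]
    · refine (isWeakDeriv_of_fourier_slice hfr (hkr i) ?_).congr hφ.symm Filter.EventuallyEq.rfl
      filter_upwards [hinv hfs, hinv (hks i), hU.isSlices.2.2, (hK i).isSlices.2.2]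
        with z h1 h2 h3 h4
      rw [← h1, ← h2]
      filter_upwards [h3, h4] with ξ h5 h6
      rw [h5, h6, inner_single_one]
      simp only [U]
      ring
  have hform : ∀ η ∈ energySpace n, form n φ η = inner ℂ η ψ := by
    intro η hη
    have hηg := hasGradient_of_mem hη
    obtain ⟨c, hc⟩ := hηg.exists_fourier_primitive
    obtain ⟨F, hF, hFs, -, hFi⟩ := (weightedSq_coe η).exists_fourier
    obtain ⟨G, hG, hGs, hGl, hGi⟩ := hηg.1.2.exists_fourier
    have hFr : WeightedSq n 1 F := by
      refine ⟨hF.aestronglyMeasurable, ?_⟩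
      rw [volume_restrict_halfSpace, hFi]
      exact (weightedSq_coe η).2
    have hGr : WeightedSq n 1 G := by
      refine ⟨hG.aestronglyMeasurable, ?_⟩
      rw [volume_restrict_halfSpace, hGi]
      exact hηg.1.2.2
    have hLs : ∀ i, IsSlices (volume.restrict (Ioi 0))
        (fun p => (2 * Real.pi * Complex.I * (p.1 i : ℝ)) * F p)
        (fun z => 𝓕 (slice (dx n i η) z)) := fun i => by
      have hm : Measurable fun p : Rn n × ℝ => 2 * Real.pi * Complex.I * ((p.1 i : ℝ) : ℂ) := by
        fun_prop
      refine ⟨(hm.mul hF.measurable).aestronglyMeasurable,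
        (fourierL n).continuous.comp_aestronglyMeasurable (hηg.2 i).2.isSlices.2.1, ?_⟩
      filter_upwards [hηg.fourier_slice i, hFs.2.2] with z h1 h2
      filter_upwards [h1, h2] with ξ h3 h4
      rw [h3, h4]
    have hLr : ∀ i, WeightedSq n (a - 1)
        (fun p => (2 * Real.pi * Complex.I * (p.1 i : ℝ)) * F p) := fun i => by
      refine (hLs i).weightedSq ?_
      simp only [enorm_fourier]
      rw [← han, (hηg.2 i).2.lintegral_slice]
      exact (hηg.2 i).2.2
    have hdx : ∀ i, WeightedSq n (a - 1) (dx n i η) := fun i => han ▸ (hηg.2 i).2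
    rw [form_eq hgrad hηg, inner_H_eq, han]
    have e1 := hgr.setIntegral_eq_fourier hηg.1.2 hV hGr (hinv hgs) hGs.slice_eq
    have e2 := fun i => (hkr i).setIntegral_eq_fourier (hdx i) (hK i) (hLr i) (hinv (hks i))
      (hLs i).slice_eq
    have e3 := hqr.setIntegral_eq_fourier (weightedSq_coe η) hP hFr (hinv hqs) hFs.slice_eq
    have e4 : ∫ p in halfSpace n, ((p.2 ^ (1 : ℝ) : ℝ) : ℂ) * (ψ p * star (η p))
        = ∫ p in halfSpace n, ((p.2 ^ (1 : ℝ) : ℝ) : ℂ) * (q p * star (η p)) := by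
      refine integral_congr_ae ?_
      filter_upwards [hψ] with p hp
      rw [hp]
    have d1 : ∀ p ∈ halfSpace n, ((p.2 ^ (1 : ℝ) : ℝ) : ℂ) * (V p * star (G p))
        = Γ p.1 * (extFlux a p * star (G p)) := fun p hp => by
      have hp0 : (p.2 : ℂ) ≠ 0 := by exact_mod_cast ne_of_gt (show 0 < p.2 from hp)
      simp only [V, Real.rpow_one]
      push_cast
      field_simp
    have d3 : ∀ p ∈ halfSpace n, ((p.2 ^ (1 : ℝ) : ℝ) : ℂ) * (P p * star (F p))
        = Γ p.1 * (extSource a p * star (F p)) := fun p hp => by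
      have hp0 : (p.2 : ℂ) ≠ 0 := by exact_mod_cast ne_of_gt (show 0 < p.2 from hp)
      simp only [P, Real.rpow_one]
      push_cast
      field_simp
    -- Conjugation changes the sign of the second factor `2πi ξ_i`, so the horizontal terms add up
    -- to `+|2πξ|²`.
    have d2 : ∀ p : Rn n × ℝ, ∑ i, ((p.2 ^ (a - 1) : ℝ) : ℂ) * (K i p *
        star ((2 * Real.pi * Complex.I * (p.1 i : ℝ)) * F p))
        = Γ p.1 * ((freqSq p.1 * p.2 ^ (a - 1) * extProfile a p : ℝ) * star (F p)) := fun p => by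
      have h1 : ∀ i, ((p.2 ^ (a - 1) : ℝ) : ℂ) * (K i p *
          star ((2 * Real.pi * Complex.I * (p.1 i : ℝ)) * F p))
          = -(2 * Real.pi * Complex.I * (p.1 i : ℝ)) ^ 2 *
            (((p.2 ^ (a - 1) : ℝ) : ℂ) * (Γ p.1 * ((extProfile a p : ℂ) * star (F p)))) := fun i => by
        simp only [K, star_mul', RCLike.star_def, Complex.conj_I, Complex.conj_ofReal,
          map_ofNat]
        ring
      rw [Finset.sum_congr rfl fun i _ => h1 i, ← Finset.sum_mul, Finset.sum_neg_distrib,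
        sum_freq_sq]
      push_cast
      ring
    have j1 := (hV.integrable_mul hGr).congr_fun d1 measurableSet_halfSpace
    have j3 := (hP.integrable_mul hFr).congr_fun d3 measurableSet_halfSpace
    have j2 := (integrable_finsetSum Finset.univ fun i _ => (hK i).integrable_mul (hLr i)).congr
      (Eventually.of_forall d2)
    rw [e1, Finset.sum_congr rfl fun i _ => e2 i, e4, e3,
      ← integral_finsetSum _ fun i _ => (hK i).integrable_mul (hLr i),
      setIntegral_congr_fun measurableSet_halfSpace d1,
      setIntegral_congr_fun measurableSet_halfSpace d3]
    refine (congrArg₂ (· + ·) rfl (integral_congr_ae (Eventually.of_forall d2))).trans ?_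
    exact integral_ext_eq_integral_source ha ha1.le hF hG hFs hGs hGl hc
      (hGi.trans_lt hηg.1.2.2) j1 j2 j3
  have hUc : ∀ ξ, Continuous fun z => U (ξ, z) := fun ξ =>
    Continuous.mul (continuous_const (y := Γ ξ)) (Complex.continuous_ofReal.comp
      ((continuous_extProfile ha0).comp (Continuous.prodMk_right ξ)))
  obtain ⟨M, hM⟩ : ∃ M, ∀ ξ z, 0 < z → ‖U (ξ, z)‖ ≤ M * ‖Γ ξ‖ := exists_ext_bound ha0 ha1.le Γ
  have hU0 : ∀ ξ, Tendsto (fun z => U (ξ, z)) (𝓝[>] 0) (𝓝 (Γ ξ)) := fun ξ => by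
    have h2 := ((hUc ξ).tendsto 0).mono_left (nhdsWithin_le_nhds (s := Ioi 0))
    have h3 : U (ξ, 0) = Γ ξ := by
      simp only [U, extProfile]
      rw [mul_zero, profile_zero ha0, Complex.ofReal_one, mul_one]
    rwa [h3] at h2
  -- The summand 1 keeps the constant positive when `ψ = 0`.
  refine ⟨φ, ⟨hgrad.mem_energySpace, ‖ψ‖ + 1, by positivity, fun η hη => ?_⟩,
    fun z => fourierInvL n (slice U z), ?_, ?_⟩
  · rw [hform η hη]
    refine (norm_inner_le_norm η ψ).trans ?_
    nlinarith [norm_nonneg η]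
  · refine isTraceFamily_fourierInvL (weightedSq_coe φ) (continuousOn_slice
      (stronglyMeasurable_ext ha0 hΓ) hΓ2.norm (Eventually.of_forall fun ξ => (hUc ξ).continuousOn)
      fun b _ => ⟨M, Eventually.of_forall fun ξ z hz _ => hM ξ z hz⟩) ?_
    rw [volume_restrict_halfSpace] at hφ
    filter_upwards [hinv hfs, ae_ae_of_ae_prod_swap hφ] with z h1 h2
    rw [h1, slice_congr h2]
  · obtain ⟨y, hy, hyl, -⟩ := exists_tendsto_slice (stronglyMeasurable_ext ha0 hΓ) hΓ2.norm
      (Eventually.of_forall hU0) one_pos (Eventually.of_forall fun ξ z hz _ => hM ξ z hz)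
    have e : y = 𝓕 γ := Lp.ext (hΓdef ▸ hy)
    have := ((fourierInvL n).continuous.tendsto y).comp hyl
    rwa [e, fourierInvL_fourier] at this

end TaubWave
end

/-! ### The theorem -/

theorem mainTheorem8 (n : ℕ) (hn : 2 ≤ n) :
    (∃ C : ℝ, 0 < C ∧ ∀ φ ∈ TaubWave.domainA n,
      (∃! ψ : TaubWave.H n, TaubWave.IsImageA n φ ψ) ∧
      ∀ ψ : TaubWave.H n, TaubWave.IsImageA n φ ψ →
        ∃ (v : ℝ → TaubWave.L2 n) (γ w m : TaubWave.L2 n),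
          TaubWave.IsTraceFamily n (TaubWave.dz n φ) v ∧
          TaubWave.IsBoundaryTrace n φ γ ∧
          (∀ z : ℝ, 0 < z → z ≤ 1 / 2 →
            ‖(z ^ (1 / (n : ℝ))) • v z‖ ≤ C * (‖ψ‖ + TaubWave.energyNorm n φ)) ∧
          (TaubWave.IsLaplacian n γ w ∧ ‖w‖ ≤ C * (‖ψ‖ + TaubWave.energyNorm n φ)) ∧
          Tendsto (fun z : ℝ => -(((1 - 1 / (n : ℝ)) * z ^ (1 / (n : ℝ))) • v z))
            (𝓝[>] 0) (𝓝 w) ∧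
          TaubWave.IsFractionalLaplacian n ((n : ℝ) / ((n : ℝ) - 1)) γ m) ∧
    (∀ γ : TaubWave.L2 n, TaubWave.MemHs n (2 * (n : ℝ) / ((n : ℝ) - 1)) γ →
      ∃ φ ∈ TaubWave.domainA n, TaubWave.IsBoundaryTrace n φ γ) := by
  have ha := (TaubWave.one_sub_one_div_mem hn).1
  -- The constant is `fluxConst (1 - 1 / n) (1 / 2)`, a function of `n` alone; `1 / 2` is the upper
  -- end of the range of `z` in i).
  exact ⟨⟨_, TaubWave.RadialSolution.fluxConst_pos (by linarith) (by norm_num : (0 : ℝ) < 1 / 2),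
    fun φ hφ => ⟨TaubWave.existsUnique_isImageA hφ, fun ψ h => h.boundary_regularity hn⟩⟩,
    fun γ hγ => TaubWave.exists_extension hn hγ⟩
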